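/- **Theorem (Identification of maximal and minimal Ishii solutions).** For $i=1,2$ let $H_i:\mathbb R\to\mathbb R$ be continuous with $H_i(q)\to+\infty$ as $|q|\to\infty$, and let $p_i^0\in\mathbb R$ be such that $H_i$ is nonincreasing on $(-\infty,p_i^0]$ and nondecreasing on $[p_i^0,+\infty)$. Set $$H_i^-(q)=\begin{cases}H_i(q)&q\le p_i^0\\ H_i(p_i^0)&q>p_i^0\end{cases},\qquad H_i^+(q)=\begin{cases}H_i(p_i^0)&q\le p_i^0\\ H_i(q)&q>p_i^0\end{cases},\qquad \check F_A(q_1,q_2)=\max\big(A,H_1^+(q_1),H_2^-(q_2)\big)\quad(A\in\mathbb R),$$ $$A_0=\max_{i=1,2}H_i(p_i^0),\qquad A^*=\max_{q\in[\min(p_1^0,p_2^0),\max(p_1^0,p_2^0)]}\min(H_1(q),H_2(q)),$$ $$A_I^+=\max(A^*,A_0),\qquad A_I^-=\begin{cases}A_I^+&\text{if }p_2^0<p_1^0,\\ A_0&\text{if }p_2^0\ge p_1^0.\end{cases}$$ All functions $u:[0,\infty)\times\mathbb R\to\mathbb R$ below are locally bounded; $u^*$ and $u_*$ are the upper and lower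 semi-continuous envelopes of $u$ on $[0,\infty)\times\mathbb R$. * $u$ is an *Ishii sub-solution* (resp. *super-solution*) if, whenever $\varphi\in C^1((0,\infty)\times\mathbb R)$ and $u^*\le\varphi$ (resp. $u_*\ge\varphi$) near a point $(t,x)$ with $t>0$, with equality at $(t,x)$, one has at $(t,x)$: $\varphi_t+H_1(\varphi_x)\le0$ (resp. $\ge0$) if $x<0$; $\varphi_t+H_2(\varphi_x)\le0$ (resp. $\ge0$) if $x>0$; and $\varphi_t+\min(H_1(\varphi_x),H_2(\varphi_x))\le0$ (resp. $\varphi_t+\max(H_1(\varphi_x),H_2(\varphi_x))\ge0$) if $x=0$. * $u$ is an *$\check F_A$-sub-solution* (resp. *super-solution*) if, whenever $\varphi$ is continuous on $(0,\infty)\times\mathbb R$ and $C^1$ on $(0,\infty)\times(-\infty,0]$ and on $(0,\infty)\times[0,\infty)$, and $u^*\le\varphi$ (resp. $u_*\ge\varphi$) near $(t,x)$ with $t>0$, with equality at $(t,x)$, the same inequalities hold at $(t,x)$ if $x\ne0$, and $\varphi_t(t,0)+\check F_A(\varphi_x(t,0^-),\varphi_x(t,0^+))\le0$ (resp. $\ge0$)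 if $x=0$. * An Ishii (resp. $\check F_A$-) *solution* is both a sub- and a super-solution. It has *initial datum* $u_0$ if $u^*(0,\cdot)\le u_0\le u_*(0,\cdot)$ on $\mathbb R$. It has *at most linear growth* if for every $T>0$ there is $C_T$ with $|u(t,x)|\le C_T(1+|x|)$ for all $(t,x)\in[0,T)\times\mathbb R$. Then $A_I^-\le A_I^+$ and the following holds. 1. Every Ishii sub-solution is an $\check F_{A_I^-}$-sub-solution. 2. Every Ishii super-solution is an $\check F_{A_I^+}$-super-solution. 3. If $A\in[A_I^-,A_I^+]$, every $\check F_A$-solution is an Ishii solution. 4. Let $u_0:\mathbb R\to\mathbb R$ be bounded and uniformly continuous. Among functions of at most linear growth there is exactly one $\check F_{A_I^+}$-solution with initial datum $u_0$; it is an Ishii solution, and it is the minimal one: it is $\le$ every Ishii solution of at most linear growth with initial datum $u_0$. Likewise, there is exactly one $\check F_{A_I^-}$-solution of at most linear growth with initial datum $u_0$, and it is the maximal Ishii solution of at most linear growth with initial datum $u_0$. 5. The Ishii solution of at most linear growth with initial datum $u_0$ is unique for every bounded and uniformly continuous $u_0$ if and only if $A_I^+=A_I^-$. -/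

import Mathlib

open Set Filter Topology

noncomputable section

namespace HJ

/-- The structure condition on a Hamiltonian `H` which is minimal at `p₀`: continuity,
quasi-convexity and coercivity. -/
structure IsQuasiConvexHamiltonian (H : ℝ → ℝ) (p₀ : ℝ) : Prop where
  continuous : Continuous H
  nonincreasing : AntitoneOn H (Iic p₀)
  nondecreasing : MonotoneOn H (Ici p₀)
  coercive : Tendsto H (cocompact ℝ) atTop

/-- The nonincreasing part `H⁻` of `H`. -/
def decPart (H : ℝ → ℝ) (p₀ q : ℝ) : ℝ := if q ≤ p₀ then H q else H p₀

/-- The nondecreasing part `H⁺` of `H`. -/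
def incPart (H : ℝ → ℝ) (p₀ q : ℝ) : ℝ := if q ≤ p₀ then H p₀ else H q

/-- The `A`-limited flux on the real line, `max (A, H₁⁺(q₁), H₂⁻(q₂))`. -/
def fluxFun (H₁ H₂ : ℝ → ℝ) (p₁ p₂ A q₁ q₂ : ℝ) : ℝ :=
  max A (max (incPart H₁ p₁ q₁) (decPart H₂ p₂ q₂))

/-- `A₀ = max (min H₁, min H₂)`; the minimum of `Hᵢ` is attained at `pᵢ`. -/
def fluxA0 (H₁ H₂ : ℝ → ℝ) (p₁ p₂ : ℝ) : ℝ := max (H₁ p₁) (H₂ p₂)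

/-- `A^*`, the maximum of `min (H₁, H₂)` over the chord between `p₁` and `p₂`. -/
def fluxAstar (H₁ H₂ : ℝ → ℝ) (p₁ p₂ : ℝ) : ℝ :=
  sSup ((fun q => min (H₁ q) (H₂ q)) '' uIcc p₁ p₂)

/-- The upper Ishii flux limiter `A_I^+`. -/
def ishiiPlus (H₁ H₂ : ℝ → ℝ) (p₁ p₂ : ℝ) : ℝ :=
  max (fluxAstar H₁ H₂ p₁ p₂) (fluxA0 H₁ H₂ p₁ p₂)

/-- The lower Ishii flux limiter `A_I^-`. -/
def ishiiMinus (H₁ H₂ : ℝ → ℝ) (p₁ p₂ : ℝ) : ℝ :=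
  if p₂ < p₁ then ishiiPlus H₁ H₂ p₁ p₂ else fluxA0 H₁ H₂ p₁ p₂

/-! Functions on `[0, ∞) × ℝ` are represented by `u : ℝ → ℝ → ℝ` (time first), of which only
the values at times `t ≥ 0` are ever used. -/

/-- `u` is locally bounded on `[0, ∞) × ℝ`. -/
def LocallyBdd (u : ℝ → ℝ → ℝ) : Prop :=
  ∀ t x : ℝ, 0 ≤ t → ∃ C : ℝ, ∀ᶠ z in 𝓝[Ici (0 : ℝ) ×ˢ univ] (t, x), |u z.1 z.2| ≤ C

/-- The upper semi-continuous envelope `u^*` on `[0, ∞) × ℝ`. -/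
def upperEnv (u : ℝ → ℝ → ℝ) (t x : ℝ) : ℝ :=
  limsup (fun z : ℝ × ℝ => u z.1 z.2) (𝓝[Ici (0 : ℝ) ×ˢ univ] (t, x))

/-- The lower semi-continuous envelope `u_*` on `[0, ∞) × ℝ`. -/
def lowerEnv (u : ℝ → ℝ → ℝ) (t x : ℝ) : ℝ :=
  liminf (fun z : ℝ × ℝ => u z.1 z.2) (𝓝[Ici (0 : ℝ) ×ˢ univ] (t, x))

/-- `φ` touches the function `w` from above at `(t, x)`, locally. -/
def TouchesAbove (φ w : ℝ → ℝ → ℝ) (t x : ℝ) : Prop :=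
  (∀ᶠ z in 𝓝 (t, x), w z.1 z.2 ≤ φ z.1 z.2) ∧ w t x = φ t x

/-- `φ` touches the function `w` from below at `(t, x)`, locally. -/
def TouchesBelow (φ w : ℝ → ℝ → ℝ) (t x : ℝ) : Prop :=
  (∀ᶠ z in 𝓝 (t, x), φ z.1 z.2 ≤ w z.1 z.2) ∧ w t x = φ t x

/-- Test functions that are `C¹` on `(0, ∞) × ℝ`. -/
def IsSmoothTest (φ : ℝ → ℝ → ℝ) : Prop :=
  ContDiffOn ℝ 1 (fun z : ℝ × ℝ => φ z.1 z.2) (Ioi (0 : ℝ) ×ˢ univ)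

/-- Test functions that are continuous on `(0, ∞) × ℝ`, and `C¹` on `(0, ∞) × (-∞, 0]` and on
`(0, ∞) × [0, ∞)`. -/
def IsPiecewiseTest (φ : ℝ → ℝ → ℝ) : Prop :=
  ContinuousOn (fun z : ℝ × ℝ => φ z.1 z.2) (Ioi (0 : ℝ) ×ˢ univ) ∧
  ContDiffOn ℝ 1 (fun z : ℝ × ℝ => φ z.1 z.2) (Ioi (0 : ℝ) ×ˢ Iic (0 : ℝ)) ∧
  ContDiffOn ℝ 1 (fun z : ℝ × ℝ => φ z.1 z.2) (Ioi (0 : ℝ) ×ˢ Ici (0 : ℝ))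

/-- The time derivative `φ_t (t, x)`. -/
def dt (φ : ℝ → ℝ → ℝ) (t x : ℝ) : ℝ := deriv (fun s => φ s x) t

/-- The space derivative `φ_x (t, x)`. -/
def dx (φ : ℝ → ℝ → ℝ) (t x : ℝ) : ℝ := deriv (φ t) x

/-- The left space derivative `φ_x (t, 0⁻)`. -/
def dxLeft (φ : ℝ → ℝ → ℝ) (t : ℝ) : ℝ := derivWithin (φ t) (Iic 0) 0

/-- The right space derivative `φ_x (t, 0⁺)`. -/
def dxRight (φ : ℝ → ℝ → ℝ) (t : ℝ) : ℝ := derivWithin (φ t) (Ici 0) 0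

/-- Ishii sub-solutions on the line. -/
def IsIshiiSub (H₁ H₂ : ℝ → ℝ) (u : ℝ → ℝ → ℝ) : Prop :=
  LocallyBdd u ∧
  ∀ φ : ℝ → ℝ → ℝ, IsSmoothTest φ → ∀ t x : ℝ, 0 < t → TouchesAbove φ (upperEnv u) t x →
    (x < 0 → dt φ t x + H₁ (dx φ t x) ≤ 0) ∧
    (0 < x → dt φ t x + H₂ (dx φ t x) ≤ 0) ∧
    (x = 0 → dt φ t x + min (H₁ (dx φ t x)) (H₂ (dx φ t x)) ≤ 0)

/-- Ishii super-solutions on the line. -/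
def IsIshiiSuper (H₁ H₂ : ℝ → ℝ) (u : ℝ → ℝ → ℝ) : Prop :=
  LocallyBdd u ∧
  ∀ φ : ℝ → ℝ → ℝ, IsSmoothTest φ → ∀ t x : ℝ, 0 < t → TouchesBelow φ (lowerEnv u) t x →
    (x < 0 → 0 ≤ dt φ t x + H₁ (dx φ t x)) ∧
    (0 < x → 0 ≤ dt φ t x + H₂ (dx φ t x)) ∧
    (x = 0 → 0 ≤ dt φ t x + max (H₁ (dx φ t x)) (H₂ (dx φ t x)))

/-- Ishii solutions on the line. -/
def IsIshiiSol (H₁ H₂ : ℝ → ℝ) (u : ℝ → ℝ → ℝ) : Prop :=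
  IsIshiiSub H₁ H₂ u ∧ IsIshiiSuper H₁ H₂ u

/-- `A`-flux-limited sub-solutions on the line. -/
def IsFluxSub (H₁ H₂ : ℝ → ℝ) (p₁ p₂ A : ℝ) (u : ℝ → ℝ → ℝ) : Prop :=
  LocallyBdd u ∧
  ∀ φ : ℝ → ℝ → ℝ, IsPiecewiseTest φ → ∀ t x : ℝ, 0 < t → TouchesAbove φ (upperEnv u) t x →
    (x < 0 → dt φ t x + H₁ (dx φ t x) ≤ 0) ∧
    (0 < x → dt φ t x + H₂ (dx φ t x) ≤ 0) ∧
    (x = 0 → dt φ t x + fluxFun H₁ H₂ p₁ p₂ A (dxLeft φ t) (dxRight φ t) ≤ 0)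

/-- `A`-flux-limited super-solutions on the line. -/
def IsFluxSuper (H₁ H₂ : ℝ → ℝ) (p₁ p₂ A : ℝ) (u : ℝ → ℝ → ℝ) : Prop :=
  LocallyBdd u ∧
  ∀ φ : ℝ → ℝ → ℝ, IsPiecewiseTest φ → ∀ t x : ℝ, 0 < t → TouchesBelow φ (lowerEnv u) t x →
    (x < 0 → 0 ≤ dt φ t x + H₁ (dx φ t x)) ∧
    (0 < x → 0 ≤ dt φ t x + H₂ (dx φ t x)) ∧
    (x = 0 → 0 ≤ dt φ t x + fluxFun H₁ H₂ p₁ p₂ A (dxLeft φ t) (dxRight φ t))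

/-- `A`-flux-limited solutions on the line. -/
def IsFluxSol (H₁ H₂ : ℝ → ℝ) (p₁ p₂ A : ℝ) (u : ℝ → ℝ → ℝ) : Prop :=
  IsFluxSub H₁ H₂ p₁ p₂ A u ∧ IsFluxSuper H₁ H₂ p₁ p₂ A u

/-- The initial condition `u(0, ·) = u₀`, in the sense `u^*(0, ·) ≤ u₀ ≤ u_*(0, ·)`. -/
def HasInitialDatum (u : ℝ → ℝ → ℝ) (u₀ : ℝ → ℝ) : Prop :=
  ∀ x : ℝ, upperEnv u 0 x ≤ u₀ x ∧ u₀ x ≤ lowerEnv u 0 x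

/-- At most linear growth in space, locally uniformly in time. -/
def HasLinearGrowth (u : ℝ → ℝ → ℝ) : Prop :=
  ∀ T : ℝ, 0 < T → ∃ C : ℝ, ∀ t x : ℝ, 0 ≤ t → t < T → |u t x| ≤ C * (1 + |x|)

/-- Ishii solutions of the Cauchy problem with datum `u₀`, in the class of functions of at most
linear growth. -/
def IsIshiiCauchySol (H₁ H₂ : ℝ → ℝ) (u₀ : ℝ → ℝ) (u : ℝ → ℝ → ℝ) : Prop :=
  IsIshiiSol H₁ H₂ u ∧ HasInitialDatum u u₀ ∧ HasLinearGrowth u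

/-- `A`-flux-limited solutions of the Cauchy problem with datum `u₀`, in the class of functions
of at most linear growth. -/
def IsFluxCauchySol (H₁ H₂ : ℝ → ℝ) (p₁ p₂ A : ℝ) (u₀ : ℝ → ℝ) (u : ℝ → ℝ → ℝ) : Prop :=
  IsFluxSol H₁ H₂ p₁ p₂ A u ∧ HasInitialDatum u u₀ ∧ HasLinearGrowth u

/-- Bounded and uniformly continuous functions on the line. -/
def IsBUC (u₀ : ℝ → ℝ) : Prop := (∃ C : ℝ, ∀ x : ℝ, |u₀ x| ≤ C) ∧ UniformContinuous u₀

end HJ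

end

namespace HJ

/-! ### Semicontinuous envelopes -/

/-! The passage from Ishii's conditions to flux-limited ones rests on moving the slopes of a test
function one side at a time. Let a kink with time derivative `l` and right slope `q` touch a
sub-solution from above at the junction, and suppose that no `p ∈ [b, q]` satisfies `l + H₂ p ≤ 0`.
A `C¹` profile whose slope grows from about `b` to about `q` cannot touch the sub-solution at a
point `x > 0`, so it stays above, and the right slope may be lowered to `b` (`UKink.extend_right`).
Once both slopes have been moved to a common value the kink is smooth, and Ishii's inequality
applies.

For sub-solutions (`fluxFun_le_of_kink`), a violated flux inequality would let both slopes be moved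
to a very negative value if `H₂⁻` is responsible, to a very positive one if `H₁⁺` is, and to the
maximiser defining `A^*` if `p₂ < p₁`. For super-solutions (`le_fluxFun_of_kink`), a violation at
level `l` makes `{H₁ < l}` and `{H₂ < l}` open intervals containing `p₁` and `p₂`. Slopes can be
moved inside them, so Ishii's inequality forbids a common point. By connectedness the chord contains
a point outside both, and `l ≤ A^*`. Conversely, for `A` between the two Ishii limiters, the flux at
equal slopes lies between `min (H₁, H₂)` and `max (H₁, H₂)`.

Comparison doubles only the time variable, with a fixed parameter. At the maximum both functions are
seen at the same `x`, and their slopes have to be matched. If the slope `p` is not admissible for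
the sub-solution `u`, nor `-q` for the opposite `v` of the super-solution, with `q < p`, then nearby
jets of `u` and of `v` carry opposite slopes, which the equation forbids (`rightAbove_or`). Hence
the critical slopes of `u` on the two sides form a kink which, together with its opposite for `v`,
contradicts the junction inequalities (`false_of_doubling`). A maximum away from the origin is
treated as a junction between two copies of one Hamiltonian.

Perron's method gives existence (`exists_isFluxCauchySol`). An Ishii solution is a sub-solution for
`A_I^-` and a super-solution for `A_I^+`, so comparison makes the corresponding flux-limited
solutions maximal and minimal. If the limiters differ, the datum with slopes `p₁`, `p₂` separates
these two: at the junction one is at most `-A_I^+ t`, the other at least `-(A_I^- + δ) t` for small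
times. -/

lemma mem_domain_self {t x : ℝ} (ht : 0 ≤ t) : (t, x) ∈ Ici (0 : ℝ) ×ˢ (univ : Set ℝ) :=
  ⟨ht, mem_univ _⟩

lemma neBot_domain {t x : ℝ} (ht : 0 ≤ t) : (𝓝[Ici (0 : ℝ) ×ˢ univ] (t, x)).NeBot :=
  mem_closure_iff_nhdsWithin_neBot.1 (subset_closure (mem_domain_self ht))

lemma nhdsWithin_domain {t x : ℝ} (ht : 0 < t) :
    𝓝[Ici (0 : ℝ) ×ˢ univ] (t, x) = 𝓝 (t, x) := by
  apply nhdsWithin_eq_nhds.2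
  exact prod_mem_nhds (Ici_mem_nhds ht) univ_mem

lemma LocallyBdd.bddAbove {u : ℝ → ℝ → ℝ} (hu : LocallyBdd u) {t x : ℝ} (ht : 0 ≤ t) :
    IsBoundedUnder (· ≤ ·) (𝓝[Ici (0 : ℝ) ×ˢ univ] (t, x)) fun z : ℝ × ℝ => u z.1 z.2 := by
  obtain ⟨C, hC⟩ := hu t x ht
  exact ⟨C, by simpa using hC.mono fun z hz => (abs_le.1 hz).2⟩

lemma LocallyBdd.cobdd {u : ℝ → ℝ → ℝ} (hu : LocallyBdd u) {t x : ℝ} (ht : 0 ≤ t) :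
    IsCoboundedUnder (· ≤ ·) (𝓝[Ici (0 : ℝ) ×ˢ univ] (t, x)) fun z : ℝ × ℝ => u z.1 z.2 := by
  obtain ⟨C, hC⟩ := hu t x ht
  have := neBot_domain (x := x) ht
  refine IsBoundedUnder.isCoboundedUnder_le ⟨-C, ?_⟩
  simpa using hC.mono fun z hz => (abs_le.1 hz).1

lemma LocallyBdd.neg {u : ℝ → ℝ → ℝ} (hu : LocallyBdd u) : LocallyBdd fun t x => -u t x :=
  fun t x ht => by simpa using hu t x ht

/-- The real `sInf` is by definition `-sSup` of the reflected set, so no boundedness is needed.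
Super-solutions can thus be handled through their negatives, with upper envelopes and upper jets
only. -/
lemma lowerEnv_eq_neg (u : ℝ → ℝ → ℝ) (t x : ℝ) :
    lowerEnv u t x = -upperEnv (fun t x => -u t x) t x := by
  simp only [lowerEnv, upperEnv, liminf_eq, limsup_eq]
  rw [Real.sInf_def, neg_neg]
  congr 1
  ext a
  simp only [mem_ofPred_eq, Set.mem_neg, neg_le_neg_iff]

lemma LocallyBdd.le_upperEnv {u : ℝ → ℝ → ℝ} (hu : LocallyBdd u) {t x : ℝ} (ht : 0 ≤ t) :
    u t x ≤ upperEnv u t x :=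
  le_limsup_of_frequently_le
    (fun h => (mem_of_mem_nhdsWithin (mem_domain_self ht) h :) le_rfl) (hu.bddAbove ht)

lemma LocallyBdd.eventually_lt {u : ℝ → ℝ → ℝ} (hu : LocallyBdd u) {t x c : ℝ} (ht : 0 ≤ t)
    (h : upperEnv u t x < c) : ∀ᶠ z in 𝓝[Ici (0 : ℝ) ×ˢ univ] (t, x), u z.1 z.2 < c :=
  eventually_lt_of_limsup_lt h (hu.bddAbove ht)

lemma LocallyBdd.frequently_lt {u : ℝ → ℝ → ℝ} (hu : LocallyBdd u) {t x c : ℝ} (ht : 0 ≤ t)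
    (h : c < upperEnv u t x) : ∃ᶠ z in 𝓝[Ici (0 : ℝ) ×ˢ univ] (t, x), c < u z.1 z.2 :=
  frequently_lt_of_lt_limsup (hu.cobdd ht) h

lemma LocallyBdd.upperEnv_le {u : ℝ → ℝ → ℝ} (hu : LocallyBdd u) {t x c : ℝ} (ht : 0 ≤ t)
    (h : ∀ᶠ z in 𝓝[Ici (0 : ℝ) ×ˢ univ] (t, x), u z.1 z.2 ≤ c) : upperEnv u t x ≤ c :=
  limsup_le_of_le (hu.cobdd ht) h

lemma LocallyBdd.upperEnv_le_of_le {u : ℝ → ℝ → ℝ} (hu : LocallyBdd u) {t x : ℝ} (ht : 0 ≤ t)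
    {g : ℝ × ℝ → ℝ} (hg : ContinuousAt g (t, x))
    (h : ∀ᶠ z in 𝓝[Ici (0 : ℝ) ×ˢ univ] (t, x), u z.1 z.2 ≤ g z) :
    upperEnv u t x ≤ g (t, x) := by
  refine le_of_forall_pos_le_add fun ε hε => hu.upperEnv_le ht ?_
  have h2 : ∀ᶠ z in 𝓝[Ici (0 : ℝ) ×ˢ univ] (t, x), g z < g (t, x) + ε :=
    nhdsWithin_le_nhds (hg.eventually (gt_mem_nhds (by linarith)))
  filter_upwards [h, h2] with z h1 h2
  linarith

lemma LocallyBdd.upperSemicontinuousOn {u : ℝ → ℝ → ℝ} (hu : LocallyBdd u) :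
    UpperSemicontinuousOn (fun z : ℝ × ℝ => upperEnv u z.1 z.2) (Ici (0 : ℝ) ×ˢ univ) := by
  rw [upperSemicontinuousOn_iff]
  rintro ⟨t, x⟩ ⟨ht, -⟩ c hc
  obtain ⟨d, hd, hdc⟩ := exists_between hc
  have h1 := hu.eventually_lt ht hd
  rw [← eventually_eventually_nhdsWithin] at h1
  filter_upwards [h1, self_mem_nhdsWithin] with z hz hz0
  exact (hu.upperEnv_le hz0.1 (hz.mono fun _ h => h.le)).trans_lt hdc

lemma LocallyBdd.upperSemicontinuousAt {u : ℝ → ℝ → ℝ} (hu : LocallyBdd u) {t x : ℝ}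
    (ht : 0 < t) : UpperSemicontinuousAt (fun z : ℝ × ℝ => upperEnv u z.1 z.2) (t, x) := by
  have h := hu.upperSemicontinuousOn (t, x) (mem_domain_self ht.le)
  intro c hc
  have := h c hc
  rwa [nhdsWithin_domain ht] at this

lemma LocallyBdd.eventually_usc {u : ℝ → ℝ → ℝ} (hu : LocallyBdd u) {t x : ℝ}
    (ht : 0 < t) :
    ∀ᶠ z in 𝓝 (t, x), UpperSemicontinuousAt (fun z : ℝ × ℝ => upperEnv u z.1 z.2) z := by
  filter_upwards [continuousAt_fst.eventually (lt_mem_nhds ht)] with z hz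
  exact hu.upperSemicontinuousAt (x := z.2) hz

/-! ### Maximum principles -/

/-- A local maximum inside a box on whose boundary the function is nonpositive. -/
lemma exists_isLocalMax_of_box {f : ℝ × ℝ → ℝ} {a b c d : ℝ}
    (hf : UpperSemicontinuousOn f (Icc a b ×ˢ Icc c d))
    (hbd : ∀ t ∈ Icc a b, ∀ x ∈ Icc c d, (t = a ∨ t = b ∨ x = c ∨ x = d) → f (t, x) ≤ 0)
    {t₁ x₁ : ℝ} (ht₁ : t₁ ∈ Icc a b) (hx₁ : x₁ ∈ Icc c d) (hpos : 0 < f (t₁, x₁)) :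
    ∃ t ∈ Ioo a b, ∃ x ∈ Ioo c d, IsLocalMax f (t, x) ∧ 0 < f (t, x) := by
  obtain ⟨⟨t, x⟩, ⟨ht, hx⟩, hmax⟩ := hf.exists_isMaxOn
    (⟨(t₁, x₁), ht₁, hx₁⟩ : (Icc a b ×ˢ Icc c d).Nonempty) (isCompact_Icc.prod isCompact_Icc)
  have h0 : 0 < f (t, x) := hpos.trans_le (hmax (show (t₁, x₁) ∈ Icc a b ×ˢ Icc c d from ⟨ht₁, hx₁⟩))
  have hn : ¬ (t = a ∨ t = b ∨ x = c ∨ x = d) := fun h => h0.not_ge (hbd t ht x hx h)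
  push Not at hn
  have ht' : t ∈ Ioo a b := ⟨lt_of_le_of_ne ht.1 (Ne.symm hn.1), lt_of_le_of_ne ht.2 hn.2.1⟩
  have hx' : x ∈ Ioo c d :=
    ⟨lt_of_le_of_ne hx.1 (Ne.symm hn.2.2.1), lt_of_le_of_ne hx.2 hn.2.2.2⟩
  exact ⟨t, ht', x, hx', hmax.isLocalMax
    (prod_mem_nhds (Icc_mem_nhds ht'.1 ht'.2) (Icc_mem_nhds hx'.1 hx'.2)), h0⟩

lemma exists_bound_of_usc {f : ℝ × ℝ → ℝ} {K : Set (ℝ × ℝ)} (hK : IsCompact K)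
    (hf : UpperSemicontinuousOn f K) : ∃ M, 0 < M ∧ ∀ z ∈ K, f z ≤ M := by
  rcases K.eq_empty_or_nonempty with h | h
  · exact ⟨1, one_pos, by simp [h]⟩
  · obtain ⟨z, -, hz⟩ := hf.exists_isMaxOn h hK
    exact ⟨max 1 (f z), by simp, fun y hy => (hz hy).trans (le_max_right _ _)⟩

/-- An increasing `C¹` function of time which is small at `t₁` and large at `T`. -/
lemma exists_time_penalty {t₁ T m M : ℝ} (h : t₁ < T) (hm : 0 < m) :
    ∃ θ : ℝ → ℝ, ContDiff ℝ 1 θ ∧ (∀ t, 0 < deriv θ t) ∧ (∀ t, 0 < θ t) ∧ θ t₁ = m ∧ M ≤ θ T ∧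
      Monotone (deriv θ) := by
  -- With `1 + y ≤ exp y`, this lower bound on `k` yields `M ≤ m * exp (k * (T - t₁))`.
  obtain ⟨k, hk0, hk⟩ : ∃ k : ℝ, 0 < k ∧ M / m ≤ k * (T - t₁) := by
    refine ⟨max 1 (M / m / (T - t₁)), by simp, ?_⟩
    rw [← div_le_iff₀ (by linarith)]
    exact le_max_right _ _
  have hd : ∀ t, HasDerivAt (fun t => m * Real.exp (k * (t - t₁)))
      (m * (Real.exp (k * (t - t₁)) * (k * 1))) t := fun t =>
    ((((hasDerivAt_id t).sub_const t₁).const_mul k).exp).const_mul m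
  have hderiv : deriv (fun t => m * Real.exp (k * (t - t₁))) =
      fun t => m * (Real.exp (k * (t - t₁)) * (k * 1)) := funext fun t => (hd t).deriv
  refine ⟨fun t => m * Real.exp (k * (t - t₁)), by fun_prop, fun t => ?_, fun t => by positivity,
    by simp, ?_, ?_⟩
  · rw [hderiv]; positivity
  · have := Real.add_one_le_exp (k * (T - t₁))
    rw [div_le_iff₀ hm] at hk
    nlinarith
  · rw [hderiv]
    intro s t hst
    have : Real.exp (k * (s - t₁)) ≤ Real.exp (k * (t - t₁)) := by
      apply Real.exp_le_exp.2; gcongr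
    simp only
    gcongr

/-- Parabolic maximum principle on a box. -/
lemma nonpos_of_no_localMax {f : ℝ × ℝ → ℝ} {T c d : ℝ}
    (hf : UpperSemicontinuousOn f (Icc 0 T ×ˢ Icc c d))
    (h0 : ∀ x ∈ Icc c d, f (0, x) ≤ 0)
    (hc : ∀ t ∈ Icc 0 T, f (t, c) ≤ 0) (hd : ∀ t ∈ Icc 0 T, f (t, d) ≤ 0)
    (hno : ∀ a : ℝ → ℝ, ContDiff ℝ 1 a → (∀ t, 0 < deriv a t) → ∀ t ∈ Ioo 0 T, ∀ x ∈ Ioo c d,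
      IsLocalMax (fun z : ℝ × ℝ => f z - a z.1) (t, x) → False)
    {t x : ℝ} (ht0 : 0 ≤ t) (htT : t < T) (hx : x ∈ Icc c d) : f (t, x) ≤ 0 := by
  by_contra hpos
  push Not at hpos
  obtain ⟨M, hM0, hM⟩ := exists_bound_of_usc (isCompact_Icc.prod isCompact_Icc) hf
  -- `θ` costs only half of the positive value at time `t` but reaches the upper bound of `f` at
  -- time `T`. This excludes the final time, where nothing is known about `f`.
  obtain ⟨θ, hθ, hθ', hθ0, hθ1, hθT, -⟩ := exists_time_penalty (M := M) htT (half_pos hpos)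
  have hus : UpperSemicontinuousOn (fun z : ℝ × ℝ => f z - θ z.1) (Icc 0 T ×ˢ Icc c d) := by
    have hθc := hθ.continuous
    have : ContinuousOn (fun z : ℝ × ℝ => -θ z.1) (Icc 0 T ×ˢ Icc c d) := by fun_prop
    simpa only [sub_eq_add_neg] using hf.add this.upperSemicontinuousOn
  obtain ⟨s, hs, y, hy, hmax, -⟩ := exists_isLocalMax_of_box hus (by
    rintro t ht x hx (rfl | rfl | rfl | rfl)
    · have := h0 x hx; have := hθ0 0; simp only; linarith
    · have := hM (t, x) ⟨ht, hx⟩; simp only; linarith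
    · have := hc t ht; have := hθ0 t; simp only; linarith
    · have := hd t ht; have := hθ0 t; simp only; linarith)
    (t₁ := t) (x₁ := x) ⟨ht0, htT.le⟩ hx (by simp only; rw [hθ1]; linarith)
  exact hno θ hθ hθ' s hs y hy hmax

/-! ### Jets -/

/-- The piecewise linear function with slopes `q₁` on the left and `q₂` on the right of `0`. -/
noncomputable def kink (q₁ q₂ x : ℝ) : ℝ := q₁ * min x 0 + q₂ * max x 0

/-- `(l, p)` is the gradient at `(t, x)` of a separated `C¹` test function touching `w` from
above at `(t, x)`, up to a constant. -/
def UJet (w : ℝ → ℝ → ℝ) (t x l p : ℝ) : Prop :=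
  ∃ a g : ℝ → ℝ, ContDiff ℝ 1 a ∧ ContDiff ℝ 1 g ∧ deriv a t = l ∧ deriv g x = p ∧
    IsLocalMax (fun z : ℝ × ℝ => w z.1 z.2 - a z.1 - g z.2) (t, x)

/-- The analogue of `UJet` for test functions that are kinks in the space variable. -/
def UKink (w : ℝ → ℝ → ℝ) (t x l q₁ q₂ : ℝ) : Prop :=
  ∃ a : ℝ → ℝ, ContDiff ℝ 1 a ∧ deriv a t = l ∧
    IsLocalMax (fun z : ℝ × ℝ => w z.1 z.2 - a z.1 - kink q₁ q₂ (z.2 - x)) (t, x)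

@[simp] lemma kink_zero (q₁ q₂ : ℝ) : kink q₁ q₂ 0 = 0 := by simp [kink]

lemma kink_of_nonneg {q₁ q₂ x : ℝ} (hx : 0 ≤ x) : kink q₁ q₂ x = q₂ * x := by
  simp [kink, hx]

lemma kink_of_nonpos {q₁ q₂ x : ℝ} (hx : x ≤ 0) : kink q₁ q₂ x = q₁ * x := by
  simp [kink, hx]

lemma kink_self (p x : ℝ) : kink p p x = p * x := by
  rcases le_total x 0 with h | h
  · exact kink_of_nonpos h
  · exact kink_of_nonneg h

lemma kink_mono {q₁ q₂ r₁ r₂ : ℝ} (h₁ : r₁ ≤ q₁) (h₂ : q₂ ≤ r₂) (x : ℝ) :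
    kink q₁ q₂ x ≤ kink r₁ r₂ x := by
  rcases le_total x 0 with h | h
  · rw [kink_of_nonpos h, kink_of_nonpos h]; nlinarith
  · rw [kink_of_nonneg h, kink_of_nonneg h]; nlinarith

lemma kink_add (q₁ q₂ r₁ r₂ x : ℝ) :
    kink q₁ q₂ x + kink r₁ r₂ x = kink (q₁ + r₁) (q₂ + r₂) x := by
  simp only [kink]; ring

lemma kink_reflect (q₁ q₂ x : ℝ) : kink q₁ q₂ (-x) = kink (-q₂) (-q₁) x := by
  rcases le_total x 0 with h | h
  · rw [kink_of_nonpos h, kink_of_nonneg (by linarith)]; ring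
  · rw [kink_of_nonneg h, kink_of_nonpos (by linarith)]; ring

lemma kink_neg (q₁ q₂ x : ℝ) : -kink q₁ q₂ x = kink (-q₁) (-q₂) x := by
  simp only [kink]; ring

lemma continuous_kink (q₁ q₂ : ℝ) : Continuous (kink q₁ q₂) := by
  unfold kink; fun_prop

/-- Neighbourhoods in the plane in terms of squares. -/
lemma eventually_nhds_prod {t₀ x₀ : ℝ} {P : ℝ × ℝ → Prop} :
    (∀ᶠ z in 𝓝 (t₀, x₀), P z) ↔
      ∃ r > 0, ∀ t x, |t - t₀| < r → |x - x₀| < r → P (t, x) := by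
  rw [Metric.eventually_nhds_iff]
  constructor
  · rintro ⟨r, hr, h⟩
    refine ⟨r, hr, fun t x ht hx => h ?_⟩
    rw [Prod.dist_eq, Real.dist_eq, Real.dist_eq]
    exact max_lt ht hx
  · rintro ⟨r, hr, h⟩
    refine ⟨r, hr, fun {y} hy => ?_⟩
    rw [Prod.dist_eq, Real.dist_eq, Real.dist_eq] at hy
    exact h y.1 y.2 ((le_max_left _ _).trans_lt hy) ((le_max_right _ _).trans_lt hy)

lemma UKink.exists_touch {w : ℝ → ℝ → ℝ} {t x l q₁ q₂ : ℝ} (h : UKink w t x l q₁ q₂) :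
    ∃ a : ℝ → ℝ, ContDiff ℝ 1 a ∧ deriv a t = l ∧ a t = w t x ∧
      ∀ᶠ z in 𝓝 (t, x), w z.1 z.2 ≤ a z.1 + kink q₁ q₂ (z.2 - x) := by
  obtain ⟨a, ha, hd, hmax⟩ := h
  refine ⟨fun s => a s + (w t x - a t), by fun_prop, by simp [hd], by ring, ?_⟩
  filter_upwards [hmax] with z hz
  simp only [sub_self, kink_zero] at hz
  linarith

lemma UKink.of_touch {w : ℝ → ℝ → ℝ} {t x q₁ q₂ : ℝ} {a : ℝ → ℝ} (ha : ContDiff ℝ 1 a)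
    (h0 : a t = w t x)
    (h : ∀ᶠ z in 𝓝 (t, x), w z.1 z.2 ≤ a z.1 + kink q₁ q₂ (z.2 - x)) :
    UKink w t x (deriv a t) q₁ q₂ := by
  refine ⟨a, ha, rfl, ?_⟩
  filter_upwards [h] with z hz
  simp only [sub_self, kink_zero]
  linarith

lemma UKink.mono {w : ℝ → ℝ → ℝ} {t x l q₁ q₂ r₁ r₂ : ℝ} (h : UKink w t x l q₁ q₂)
    (h₁ : r₁ ≤ q₁) (h₂ : q₂ ≤ r₂) : UKink w t x l r₁ r₂ := by
  obtain ⟨a, ha, hd, h0, hle⟩ := h.exists_touch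
  rw [← hd]
  refine UKink.of_touch ha h0 (hle.mono fun z hz => hz.trans ?_)
  have := kink_mono h₁ h₂ (z.2 - x)
  linarith

lemma UKink.ujet {w : ℝ → ℝ → ℝ} {t x l p : ℝ} (h : UKink w t x l p p) : UJet w t x l p := by
  obtain ⟨a, ha, hd, hmax⟩ := h
  refine ⟨a, fun y => p * (y - x), ha, by fun_prop, hd, ?_, ?_⟩
  · simp
  · simpa only [kink_self] using hmax

lemma eventually_le_kink {g : ℝ → ℝ} {x p q₁ q₂ : ℝ} (hg : HasDerivAt g p x) (h₁ : q₁ < p)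
    (h₂ : p < q₂) : ∀ᶠ y in 𝓝 x, g y ≤ g x + kink q₁ q₂ (y - x) := by
  have hc : 0 < min (p - q₁) (q₂ - p) := lt_min (by linarith) (by linarith)
  filter_upwards [(hasDerivAt_iff_isLittleO.1 hg).def hc] with y hy
  simp only [smul_eq_mul, Real.norm_eq_abs] at hy
  have hy' := (abs_le.1 hy).2
  have h3 := min_le_left (p - q₁) (q₂ - p)
  have h4 := min_le_right (p - q₁) (q₂ - p)
  rcases le_total (y - x) 0 with h | h
  · rw [kink_of_nonpos h]; rw [abs_of_nonpos h] at hy'; nlinarith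
  · rw [kink_of_nonneg h]; rw [abs_of_nonneg h] at hy'; nlinarith

/-- The strict inequalities leave a linear margin on each side, which absorbs the remainder `o(|y -
x|)` of the `C¹` profile. -/
lemma UJet.ukink {w : ℝ → ℝ → ℝ} {t x l p q₁ q₂ : ℝ} (h : UJet w t x l p) (h₁ : q₁ < p)
    (h₂ : p < q₂) : UKink w t x l q₁ q₂ := by
  obtain ⟨a, g, ha, hg, hd, hp, hmax⟩ := h
  have hgd : HasDerivAt g p x := hp ▸ (hg.differentiable one_ne_zero x).hasDerivAt
  refine ⟨a, ha, hd, ?_⟩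
  filter_upwards [hmax, continuousAt_snd.eventually (eventually_le_kink hgd h₁ h₂)] with z h1 h2
  simp only [sub_self, kink_zero] at h1 h2 ⊢
  linarith

lemma UJet.congr {w w' : ℝ → ℝ → ℝ} {t x l p : ℝ} (h : UJet w' t x l p)
    (hle : ∀ᶠ z in 𝓝 (t, x), w z.1 z.2 ≤ w' z.1 z.2) (heq : w' t x ≤ w t x) :
    UJet w t x l p := by
  obtain ⟨a, g, ha, hg, hd, hp, hmax⟩ := h
  refine ⟨a, g, ha, hg, hd, hp, ?_⟩
  filter_upwards [hmax, hle] with z h1 h2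
  linarith

lemma UKink.congr {w w' : ℝ → ℝ → ℝ} {t x l q₁ q₂ : ℝ} (h : UKink w' t x l q₁ q₂)
    (hle : ∀ᶠ z in 𝓝 (t, x), w z.1 z.2 ≤ w' z.1 z.2) (heq : w' t x ≤ w t x) :
    UKink w t x l q₁ q₂ := by
  obtain ⟨a, ha, hd, hmax⟩ := h
  refine ⟨a, ha, hd, ?_⟩
  filter_upwards [hmax, hle] with z h1 h2
  linarith

lemma tendsto_reflect (t x : ℝ) :
    Tendsto (fun z : ℝ × ℝ => (z.1, -z.2)) (𝓝 (t, -x)) (𝓝 (t, x)) := by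
  have : ContinuousAt (fun z : ℝ × ℝ => (z.1, -z.2)) (t, -x) := by fun_prop
  simpa [ContinuousAt] using this

/-- Reflection exchanges the two sides and changes the sign of slopes, so one-sided statements only
need a proof on the right. -/
lemma UJet.reflect {w : ℝ → ℝ → ℝ} {t x l p : ℝ} (h : UJet w t x l p) :
    UJet (fun t x => w t (-x)) t (-x) l (-p) := by
  obtain ⟨a, g, ha, hg, hd, hp, hmax⟩ := h
  refine ⟨a, fun y => g (-y), ha, by fun_prop, hd, ?_, ?_⟩
  · rw [deriv_comp_neg]; simp [hp]
  · filter_upwards [(tendsto_reflect t x).eventually hmax] with z hz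
    simpa using hz

lemma UKink.reflect {w : ℝ → ℝ → ℝ} {t x l q₁ q₂ : ℝ} (h : UKink w t x l q₁ q₂) :
    UKink (fun t x => w t (-x)) t (-x) l (-q₂) (-q₁) := by
  obtain ⟨a, ha, hd, hmax⟩ := h
  refine ⟨a, ha, hd, ?_⟩
  filter_upwards [(tendsto_reflect t x).eventually hmax] with z hz
  have e : z.2 - -x = -(-z.2 - x) := by ring
  simp only [e, kink_reflect, neg_neg, sub_self, kink_zero] at hz ⊢
  exact hz

lemma eventually_reflect {t x : ℝ} {P : ℝ × ℝ → Prop} (h : ∀ᶠ z in 𝓝 (t, x), P z) :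
    ∀ᶠ z in 𝓝 (t, -x), P (z.1, -z.2) := (tendsto_reflect t x).eventually h

lemma usc_reflect {w : ℝ → ℝ → ℝ} {t x : ℝ}
    (h : ∀ᶠ z in 𝓝 (t, x), UpperSemicontinuousAt (fun z : ℝ × ℝ => w z.1 z.2) z) :
    ∀ᶠ z in 𝓝 (t, -x), UpperSemicontinuousAt (fun z : ℝ × ℝ => w z.1 (-z.2)) z := by
  filter_upwards [eventually_reflect h] with z hz c hc
  have := (tendsto_reflect z.1 (-z.2))
  rw [neg_neg] at this
  exact this.eventually (hz c hc)

lemma exists_Icc_subset_of_isOpen {b q : ℝ} {U : Set ℝ} (hU : IsOpen U) (h : Icc b q ⊆ U)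
    (hbq : b ≤ q) : ∃ κ > 0, Icc (b - κ) (q + κ) ⊆ U := by
  obtain ⟨κ, hκ, hsub⟩ := isCompact_Icc.exists_cthickening_subset_open hU h
  refine ⟨κ, hκ, fun p hp => hsub ?_⟩
  refine Metric.mem_cthickening_of_dist_le p (max b (min p q)) κ _
    ⟨le_max_left _ _, max_le hbq (min_le_right _ _)⟩ ?_
  rw [Real.dist_eq, abs_le]
  obtain ⟨h3, h4⟩ := hp
  rcases le_total p q with h1 | h1
  · rw [min_eq_left h1]
    rcases le_total b p with h2 | h2
    · rw [max_eq_right h2]; constructor <;> linarith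
    · rw [max_eq_left h2]; constructor <;> linarith
  · rw [min_eq_right h1, max_eq_right hbq]; constructor <;> linarith

/-- A `C¹` profile whose slope is `b` at `x₀` and increases to `q` away from `x₀`. -/
lemma exists_profile {b q η : ℝ} (x₀ : ℝ) (hbq : b < q) (hη : 0 < η) :
    ∃ g : ℝ → ℝ, ContDiff ℝ 1 g ∧ g x₀ = 0 ∧ deriv g x₀ = b ∧
      (∀ x, x₀ ≤ x → deriv g x ∈ Icc b q) ∧ ∀ x, x₀ ≤ x → q * (x - x₀) - η ≤ g x := by
  have hD : 0 < q - b := by linarith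
  have hρ : 0 < η / (q - b) := by positivity
  -- The decay length for which the slope at `x₀`, which is `q - η / ρ`, equals `b`.
  set ρ := η / (q - b) with hρd
  have hgd : ∀ x, HasDerivAt (fun x => q * (x - x₀) - η * (1 - Real.exp (-(x - x₀) / ρ)))
      (q - (q - b) * Real.exp (-(x - x₀) / ρ)) x := fun x => by
    have h1 : HasDerivAt (fun x => Real.exp (-(x - x₀) / ρ))
        (Real.exp (-(x - x₀) / ρ) * (-1 / ρ)) x :=
      (((hasDerivAt_id x).sub_const x₀).neg.div_const ρ).exp
    have h2 := (((hasDerivAt_id x).sub_const x₀).const_mul q).sub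
      (((hasDerivAt_const x (1 : ℝ)).sub h1).const_mul η)
    refine h2.congr_deriv ?_
    have : η = ρ * (q - b) := by rw [hρd]; field_simp
    rw [this]
    field_simp
    ring
  refine ⟨fun x => q * (x - x₀) - η * (1 - Real.exp (-(x - x₀) / ρ)), ?_, ?_, ?_, ?_, ?_⟩
  · fun_prop
  · simp
  · rw [(hgd x₀).deriv]; simp
  · intro x hx
    rw [(hgd x).deriv]
    have he0 := Real.exp_pos (-(x - x₀) / ρ)
    have he1 : Real.exp (-(x - x₀) / ρ) ≤ 1 := by
      rw [Real.exp_le_one_iff]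
      exact div_nonpos_of_nonpos_of_nonneg (by linarith) hρ.le
    constructor <;> nlinarith
  · intro x hx
    have : 0 < η * Real.exp (-(x - x₀) / ρ) := by positivity
    linarith

lemma exists_time_parabola {a : ℝ → ℝ} (ha : ContDiff ℝ 1 a) (t₀ : ℝ) :
    ∃ A : ℝ → ℝ, ContDiff ℝ 1 A ∧ deriv A t₀ = deriv a t₀ ∧ ∀ t, A t = a t + (t - t₀) ^ 2 := by
  refine ⟨fun t => a t + (t - t₀) ^ 2, by fun_prop, ?_, fun t => rfl⟩
  have h1 := ((ha.differentiable one_ne_zero t₀).hasDerivAt).add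
    (((hasDerivAt_id t₀).sub_const t₀).pow 2)
  refine (h1.congr_deriv (g' := deriv a t₀) (by simp)).deriv

/-- If the slope `q` is admissible on the right and no slope between `b` and `q` can occur in a
jet on the right, then the slope `b` is admissible on the right. -/
lemma UKink.extend_right {w : ℝ → ℝ → ℝ} {t₀ x₀ l q₁ q b : ℝ} {G : ℝ → ℝ} (hG : Continuous G)
    (husc : ∀ᶠ z in 𝓝 (t₀, x₀), UpperSemicontinuousAt (fun z : ℝ × ℝ => w z.1 z.2) z)
    (hjet : ∀ᶠ z in 𝓝 (t₀, x₀), x₀ < z.2 → ∀ l' p, UJet w z.1 z.2 l' p → l' + G p ≤ 0)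
    (h : UKink w t₀ x₀ l q₁ q) (hb : b ≤ q) (hpos : ∀ p ∈ Icc b q, 0 < l + G p) :
    UKink w t₀ x₀ l q₁ b := by
  -- Room at both ends of the interval: slopes steeper than `q` gain height at the far side of the
  -- box, and an initial slope below `b` puts the final kink strictly above the profile.
  obtain ⟨κ, hκ, hsub⟩ := exists_Icc_subset_of_isOpen
    (U := {p | 0 < l + G p}) (isOpen_lt (by fun_prop) (by fun_prop)) hpos hb
  obtain ⟨p₀, hp₀, hmin⟩ := isCompact_Icc.exists_isMinOn
    (⟨b, by constructor <;> linarith⟩ : (Icc (b - κ) (q + κ)).Nonempty) hG.continuousOn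
  have hδ : 0 < l + G p₀ := hsub hp₀
  obtain ⟨a, ha, hd, h0, hle⟩ := h.exists_touch
  obtain ⟨r, hr, hr'⟩ := eventually_nhds_prod.1 ((hle.and husc).and hjet)
  obtain ⟨A, hAc, hA0, hA⟩ := exists_time_parabola ha t₀
  rw [hd] at hA0
  have hAcont : ContinuousAt (deriv A) t₀ := (hAc.continuous_deriv le_rfl).continuousAt
  obtain ⟨τ', hτ', hτ''⟩ := Metric.eventually_nhds_iff.1
    (hAcont.eventually (lt_mem_nhds (show l - (l + G p₀) < deriv A t₀ by rw [hA0]; linarith)))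
  obtain ⟨τ, hτ, hττ⟩ := exists_between (lt_min hr hτ')
  obtain ⟨hτr, hττ'⟩ := lt_min_iff.1 hττ
  obtain ⟨X, hX, hXr⟩ := exists_between hr
  -- The deficit of the profile below its asymptote is paid by `κ X` on the side `x = x₀ + X` and by
  -- the parabola `τ ^ 2` at the times `t₀ ± τ`.
  obtain ⟨g, hgc, hgx, hgd0, hgd, hglow⟩ := exists_profile x₀
    (show b - κ < q + κ by linarith) (show 0 < min (κ * X) (τ ^ 2) by positivity)
  have hη1 := min_le_left (κ * X) (τ ^ 2)
  have hη2 := min_le_right (κ * X) (τ ^ 2)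
  have hin : ∀ t ∈ Icc (t₀ - τ) (t₀ + τ), ∀ x ∈ Icc x₀ (x₀ + X),
      |t - t₀| < r ∧ |x - x₀| < r := fun t ht x hx =>
    ⟨by rw [abs_lt]; constructor <;> linarith [ht.1, ht.2],
      by rw [abs_lt]; constructor <;> linarith [hx.1, hx.2]⟩
  have hus : UpperSemicontinuousOn (fun z : ℝ × ℝ => w z.1 z.2 + (-A z.1 - g z.2))
      (Icc (t₀ - τ) (t₀ + τ) ×ˢ Icc x₀ (x₀ + X)) := by
    rintro ⟨t, x⟩ ⟨ht, hx⟩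
    obtain ⟨h1, h2⟩ := hin t ht x hx
    have hc1 := hAc.continuous
    have hc2 := hgc.continuous
    have h3 : Continuous fun z : ℝ × ℝ => -A z.1 - g z.2 := by fun_prop
    exact UpperSemicontinuousWithinAt.add
      (UpperSemicontinuousAt.upperSemicontinuousWithinAt _ (hr' t x h1 h2).1.2)
      h3.continuousAt.continuousWithinAt.upperSemicontinuousWithinAt
  have hbd : ∀ t ∈ Icc (t₀ - τ) (t₀ + τ), ∀ x ∈ Icc x₀ (x₀ + X),
      (t = t₀ - τ ∨ t = t₀ + τ ∨ x = x₀ ∨ x = x₀ + X) →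
      w (t, x).1 (t, x).2 + (-A (t, x).1 - g (t, x).2) ≤ 0 := by
    intro t ht x hx hor
    obtain ⟨h1, h2⟩ := hin t ht x hx
    have h3 := (hr' t x h1 h2).1.1
    have h4 := hglow x hx.1
    simp only at h3 ⊢
    rw [kink_of_nonneg (by linarith [hx.1])] at h3
    rw [hA]
    have hxx : 0 ≤ κ * (x - x₀) := mul_nonneg hκ.le (by linarith [hx.1])
    have hq : (q + κ) * (x - x₀) = q * (x - x₀) + κ * (x - x₀) := by ring
    rcases hor with rfl | rfl | rfl | rfl
    · have : (t₀ - τ - t₀) ^ 2 = τ ^ 2 := by ring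
      linarith
    · have : (t₀ + τ - t₀) ^ 2 = τ ^ 2 := by ring
      linarith
    · rw [hgx]; rw [sub_self, mul_zero] at h3; linarith [sq_nonneg (t - t₀)]
    · have e : x₀ + X - x₀ = X := by ring
      rw [e] at h3 h4 hq
      linarith [sq_nonneg (t - t₀)]
  -- An interior maximum would be a jet with slope in `[b - κ, q + κ]` and time derivative above `-G
  -- p₀`, where `G p₀` is the least value of `G` there.
  have key : ∀ t ∈ Icc (t₀ - τ) (t₀ + τ), ∀ x ∈ Icc x₀ (x₀ + X), w t x ≤ A t + g x := by
    intro t₁ ht₁ x₁ hx₁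
    by_contra hcon
    push Not at hcon
    obtain ⟨t, ht, x, hx, hmax, -⟩ := exists_isLocalMax_of_box hus hbd ht₁ hx₁
      (by simp only; linarith)
    obtain ⟨h1, h2⟩ := hin t (Ioo_subset_Icc_self ht) x (Ioo_subset_Icc_self hx)
    have hj : UJet w t x (deriv A t) (deriv g x) := by
      refine ⟨A, g, hAc, hgc, rfl, rfl, ?_⟩
      convert hmax using 2 with z
      ring
    have h3 := (hr' t x h1 h2).2 hx.1 _ _ hj
    have h4 : l - (l + G p₀) < deriv A t := hτ'' (by
      rw [Real.dist_eq, abs_lt]; constructor <;> linarith [ht.1, ht.2])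
    have h5 : G p₀ ≤ G (deriv g x) := hmin (hgd x hx.1.le)
    linarith
  rw [← hA0]
  refine UKink.of_touch hAc (by simp [hA, h0]) ?_
  have hg' := eventually_le_kink (q₁ := b - κ - 1) (q₂ := b)
    (hgc.differentiable one_ne_zero x₀).hasDerivAt (by linarith) (by linarith)
  rw [hgx] at hg'
  filter_upwards [hle, continuousAt_snd.eventually hg',
    continuousAt_fst.eventually (Icc_mem_nhds (show t₀ - τ < t₀ by linarith)
      (show t₀ < t₀ + τ by linarith)),
    continuousAt_snd.eventually (Iio_mem_nhds (show x₀ < x₀ + X by linarith))] with z h1 h2 h3 h4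
  rcases le_total (z.2 - x₀) 0 with hz | hz
  · rw [kink_of_nonpos hz] at h1 ⊢
    rw [hA]; linarith [sq_nonneg (z.1 - t₀)]
  · have h5 := key z.1 h3 z.2 ⟨by linarith, le_of_lt h4⟩
    rw [kink_of_nonneg hz] at h2 ⊢
    linarith

lemma UKink.extend_left {w : ℝ → ℝ → ℝ} {t₀ x₀ l q q₂ b : ℝ} {G : ℝ → ℝ} (hG : Continuous G)
    (husc : ∀ᶠ z in 𝓝 (t₀, x₀), UpperSemicontinuousAt (fun z : ℝ × ℝ => w z.1 z.2) z)
    (hjet : ∀ᶠ z in 𝓝 (t₀, x₀), z.2 < x₀ → ∀ l' p, UJet w z.1 z.2 l' p → l' + G p ≤ 0)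
    (h : UKink w t₀ x₀ l q q₂) (hb : q ≤ b) (hpos : ∀ p ∈ Icc q b, 0 < l + G p) :
    UKink w t₀ x₀ l b q₂ := by
  have key := UKink.extend_right (w := fun t x => w t (-x)) (x₀ := -x₀) (q := -q) (b := -b)
    (G := fun p => G (-p)) (by fun_prop) (usc_reflect husc)
    (by
      filter_upwards [eventually_reflect hjet] with z hz hlt l' p hj
      have := hj.reflect
      simp only [neg_neg] at this
      exact hz (by linarith) l' (-p) this)
    h.reflect (neg_le_neg hb)
    (fun p hp => hpos (-p) ⟨by linarith [hp.2], by linarith [hp.1]⟩)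
  simpa using key.reflect

/-! ### Quasi-convex functions and the flux function -/

/-- Continuous functions which are nonincreasing before `p₀` and nondecreasing after `p₀`. -/
structure IsQuasiConvex (H : ℝ → ℝ) (p₀ : ℝ) : Prop where
  continuous : Continuous H
  anti : AntitoneOn H (Iic p₀)
  mono : MonotoneOn H (Ici p₀)

lemma IsQuasiConvexHamiltonian.isQuasiConvex {H : ℝ → ℝ} {p₀ : ℝ}
    (h : IsQuasiConvexHamiltonian H p₀) : IsQuasiConvex H p₀ :=
  ⟨h.continuous, h.nonincreasing, h.nondecreasing⟩

lemma incPart_eq (H : ℝ → ℝ) (p₀ q : ℝ) : incPart H p₀ q = H (max q p₀) := by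
  unfold incPart
  split_ifs with h
  · rw [max_eq_right h]
  · rw [max_eq_left (not_le.1 h).le]

lemma decPart_eq (H : ℝ → ℝ) (p₀ q : ℝ) : decPart H p₀ q = H (min q p₀) := by
  unfold decPart
  split_ifs with h
  · rw [min_eq_left h]
  · rw [min_eq_right (not_le.1 h).le]

namespace IsQuasiConvex

variable {H : ℝ → ℝ} {p₀ : ℝ}

lemma min_le (h : IsQuasiConvex H p₀) (q : ℝ) : H p₀ ≤ H q := by
  rcases le_total q p₀ with h1 | h1
  · exact h.anti h1 (mem_Iic.2 le_rfl) h1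
  · exact h.mono (mem_Ici.2 le_rfl) h1 h1

lemma inc_le (h : IsQuasiConvex H p₀) (q : ℝ) : incPart H p₀ q ≤ H q := by
  rw [incPart_eq]
  rcases le_total q p₀ with h1 | h1
  · rw [max_eq_right h1]; exact h.min_le q
  · rw [max_eq_left h1]

lemma dec_le (h : IsQuasiConvex H p₀) (q : ℝ) : decPart H p₀ q ≤ H q := by
  rw [decPart_eq]
  rcases le_total q p₀ with h1 | h1
  · rw [min_eq_left h1]
  · rw [min_eq_right h1]; exact h.min_le q

lemma inc_mono (h : IsQuasiConvex H p₀) : Monotone (incPart H p₀) := fun q r hqr => by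
  rw [incPart_eq, incPart_eq]
  exact h.mono (mem_Ici.2 (le_max_right _ _)) (mem_Ici.2 (le_max_right _ _)) (max_le_max_right _ hqr)

lemma dec_anti (h : IsQuasiConvex H p₀) : Antitone (decPart H p₀) := fun q r hqr => by
  rw [decPart_eq, decPart_eq]
  exact h.anti (mem_Iic.2 (min_le_right _ _)) (mem_Iic.2 (min_le_right _ _)) (min_le_min_right _ hqr)

lemma min_le_inc (h : IsQuasiConvex H p₀) (q : ℝ) : H p₀ ≤ incPart H p₀ q := by
  rw [incPart_eq]; exact h.min_le _

lemma min_le_dec (h : IsQuasiConvex H p₀) (q : ℝ) : H p₀ ≤ decPart H p₀ q := by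
  rw [decPart_eq]; exact h.min_le _

lemma le_max (h : IsQuasiConvex H p₀) {r s p : ℝ} (hr : r ≤ s) (hs : s ≤ p) :
    H s ≤ max (H r) (H p) := by
  rcases le_total s p₀ with h1 | h1
  · exact (h.anti (hr.trans h1) h1 hr).trans (le_max_left _ _)
  · exact (h.mono h1 (h1.trans hs) hs).trans (le_max_right _ _)

end IsQuasiConvex

section flux

variable {H₁ H₂ : ℝ → ℝ} {p₁ p₂ A : ℝ}

lemma fluxFun_mono (h₁ : IsQuasiConvex H₁ p₁) (h₂ : IsQuasiConvex H₂ p₂) {q₁ q₂ r₁ r₂ : ℝ}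
    (hq : q₁ ≤ r₁) (hr : r₂ ≤ q₂) :
    fluxFun H₁ H₂ p₁ p₂ A q₁ q₂ ≤ fluxFun H₁ H₂ p₁ p₂ A r₁ r₂ :=
  max_le_max le_rfl (max_le_max (h₁.inc_mono hq) (h₂.dec_anti hr))

lemma continuous_fluxFun (h₁ : Continuous H₁) (h₂ : Continuous H₂) :
    Continuous fun q : ℝ × ℝ => fluxFun H₁ H₂ p₁ p₂ A q.1 q.2 := by
  simp only [fluxFun, incPart_eq, decPart_eq]
  fun_prop

lemma le_fluxAstar (h₁ : Continuous H₁) (h₂ : Continuous H₂) {q : ℝ} (hq : q ∈ uIcc p₁ p₂) :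
    min (H₁ q) (H₂ q) ≤ fluxAstar H₁ H₂ p₁ p₂ := by
  refine le_csSup ?_ (mem_image_of_mem _ hq)
  exact (isCompact_uIcc.image (by fun_prop)).bddAbove

lemma exists_fluxAstar_eq (h₁ : Continuous H₁) (h₂ : Continuous H₂) :
    ∃ q ∈ uIcc p₁ p₂, fluxAstar H₁ H₂ p₁ p₂ = min (H₁ q) (H₂ q) := by
  obtain ⟨q, hq, hq'⟩ := (isCompact_uIcc (a := p₁) (b := p₂)).exists_sSup_image_eq
    ⟨p₁, left_mem_uIcc⟩ (f := fun q => min (H₁ q) (H₂ q)) (by fun_prop)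
  exact ⟨q, hq, hq'⟩

lemma ishiiMinus_le_ishiiPlus : ishiiMinus H₁ H₂ p₁ p₂ ≤ ishiiPlus H₁ H₂ p₁ p₂ := by
  unfold ishiiMinus
  split_ifs
  · exact le_rfl
  · exact le_max_right _ _

/-- At slopes `p ≥ p₁` the part `H₁⁺` is `H₁`, and at slopes `p ≤ p₂` the part `H₂⁻` is `H₂`. The
remaining slopes lie between `p₂` and `p₁`, where the limiter dominates through `A^*`. -/
lemma min_le_fluxFun (h₁ : IsQuasiConvex H₁ p₁) (h₂ : IsQuasiConvex H₂ p₂)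
    (hA : ishiiMinus H₁ H₂ p₁ p₂ ≤ A) (p : ℝ) :
    min (H₁ p) (H₂ p) ≤ fluxFun H₁ H₂ p₁ p₂ A p p := by
  unfold fluxFun
  rw [incPart_eq, decPart_eq]
  rcases le_total p₁ p with h | h
  · rw [max_eq_left h]
    exact (min_le_left _ _).trans ((le_max_left _ _).trans (le_max_right _ _))
  rcases le_total p p₂ with h' | h'
  · rw [min_eq_left h']
    exact (min_le_right _ _).trans ((le_max_right _ _).trans (le_max_right _ _))
  rcases lt_or_ge p₂ p₁ with h'' | h''
  · rw [ishiiMinus, if_pos h''] at hA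
    refine le_trans ?_ ((le_max_left _ _).trans (hA.trans (le_max_left _ _)))
    exact le_fluxAstar h₁.continuous h₂.continuous (mem_uIcc.2 (Or.inr ⟨h', h⟩))
  · have : p = p₁ := le_antisymm h (h''.trans h')
    subst this
    rw [max_self]
    exact (min_le_left _ _).trans ((le_max_left _ _).trans (le_max_right _ _))

/-- Compare `p` with the maximiser `q` of `A^*`. When moving away from `q` in either direction, one
of the two Hamiltonians can only grow; the order of `p₁` and `p₂` decides which. -/
lemma fluxFun_le_max (h₁ : IsQuasiConvex H₁ p₁) (h₂ : IsQuasiConvex H₂ p₂)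
    (hA : A ≤ ishiiPlus H₁ H₂ p₁ p₂) (p : ℝ) :
    fluxFun H₁ H₂ p₁ p₂ A p p ≤ max (H₁ p) (H₂ p) := by
  refine max_le (hA.trans (max_le ?_ ?_)) (max_le_max (h₁.inc_le p) (h₂.dec_le p))
  · obtain ⟨q, hq, h⟩ := exists_fluxAstar_eq (p₁ := p₁) (p₂ := p₂) h₁.continuous h₂.continuous
    rw [h]
    rcases mem_uIcc.1 hq with ⟨ha, hb⟩ | ⟨ha, hb⟩ <;> rcases le_total p q with hp | hp
    · exact (min_le_right _ _).trans ((h₂.anti (hp.trans hb) hb hp).trans (le_max_right _ _))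
    · exact (min_le_left _ _).trans ((h₁.mono ha (ha.trans hp) hp).trans (le_max_left _ _))
    · exact (min_le_left _ _).trans ((h₁.anti (hp.trans hb) hb hp).trans (le_max_left _ _))
    · exact (min_le_right _ _).trans ((h₂.mono ha (ha.trans hp) hp).trans (le_max_right _ _))
  · exact max_le_max (h₁.min_le p) (h₂.min_le p)

end flux

/-! ### Kinks and Ishii's conditions -/

section core

variable {G₁ G₂ : ℝ → ℝ} {p₁ p₂ : ℝ} {w : ℝ → ℝ → ℝ} {t₀ x₀ l q₁ q₂ : ℝ}

/-- Coercivity is required only at the level `-l`, so that truncated Hamiltonians are covered as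
well. -/
lemma exists_le_of_coercive {G₁ G₂ : ℝ → ℝ} {l : ℝ} (hc₁ : ∀ᶠ p in cocompact ℝ, 0 < l + G₁ p)
    (hc₂ : ∀ᶠ p in cocompact ℝ, 0 < l + G₂ p) (b : ℝ) :
    (∃ p ≤ b, 0 < l + G₁ p ∧ 0 < l + G₂ p) ∧ ∃ p ≥ b, 0 < l + G₁ p ∧ 0 < l + G₂ p := by
  rw [cocompact_eq_atBot_atTop, eventually_sup] at hc₁ hc₂
  obtain ⟨p, h1, h2⟩ := ((eventually_le_atBot b).and (hc₁.1.and hc₂.1)).exists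
  obtain ⟨p', h1', h2'⟩ := ((eventually_ge_atTop b).and (hc₁.2.and hc₂.2)).exists
  exact ⟨⟨p, h1, h2⟩, p', h1', h2'⟩

/-- Ishii's sub-solution inequalities imply the flux-limited ones with the lower Ishii flux
limiter. -/
lemma fluxFun_le_of_kink (h₁ : IsQuasiConvex G₁ p₁) (h₂ : IsQuasiConvex G₂ p₂)
    (husc : ∀ᶠ z in 𝓝 (t₀, x₀), UpperSemicontinuousAt (fun z : ℝ × ℝ => w z.1 z.2) z)
    (hL : ∀ᶠ z in 𝓝 (t₀, x₀), z.2 < x₀ → ∀ l' p, UJet w z.1 z.2 l' p → l' + G₁ p ≤ 0)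
    (hR : ∀ᶠ z in 𝓝 (t₀, x₀), x₀ < z.2 → ∀ l' p, UJet w z.1 z.2 l' p → l' + G₂ p ≤ 0)
    (h0 : ∀ p, UJet w t₀ x₀ l p → l + min (G₁ p) (G₂ p) ≤ 0)
    (hc₁ : ∀ᶠ p in cocompact ℝ, 0 < l + G₁ p) (hc₂ : ∀ᶠ p in cocompact ℝ, 0 < l + G₂ p)
    (hk : UKink w t₀ x₀ l q₁ q₂) :
    l + fluxFun G₁ G₂ p₁ p₂ (ishiiMinus G₁ G₂ p₁ p₂) q₁ q₂ ≤ 0 := by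
  have h0' : ∀ p, 0 < l + G₁ p → 0 < l + G₂ p → ¬ UKink w t₀ x₀ l p p := fun p ha hb hk => by
    have := h0 p hk.ujet
    have : 0 < l + min (G₁ p) (G₂ p) := by
      rcases min_choice (G₁ p) (G₂ p) with h | h <;> rw [h] <;> assumption
    linarith
  -- `G₂⁻` is nonincreasing, so a violation at `q₂` persists at all smaller slopes. Both slopes can
  -- be lowered to a common very negative one, where Ishii's inequality fails by coercivity.
  have hdec : l + decPart G₂ p₂ q₂ ≤ 0 := by
    by_contra hcon
    obtain ⟨b, hb, hb1, hb2⟩ := (exists_le_of_coercive hc₁ hc₂ (min q₁ q₂)).1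
    refine h0' b hb1 hb2 ((hk.extend_right h₂.continuous husc hR
      (hb.trans (min_le_right _ _)) fun p hp => ?_).mono (hb.trans (min_le_left _ _)) le_rfl)
    have := h₂.dec_le p
    have := h₂.dec_anti hp.2
    linarith
  have hinc : l + incPart G₁ p₁ q₁ ≤ 0 := by
    by_contra hcon
    obtain ⟨b, hb, hb1, hb2⟩ := (exists_le_of_coercive hc₁ hc₂ (max q₁ q₂)).2
    refine h0' b hb1 hb2 ((hk.extend_left h₁.continuous husc hL
      (le_trans (le_max_left _ _) hb) fun p hp => ?_).mono le_rfl (le_trans (le_max_right _ _) hb))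
    have := h₁.inc_le p
    have := h₁.inc_mono hp.1
    linarith
  have hA0 : fluxA0 G₁ G₂ p₁ p₂ ≤ -l := by
    have := h₁.min_le_inc q₁
    have := h₂.min_le_dec q₂
    exact max_le (by linarith) (by linarith)
  have hA : ishiiMinus G₁ G₂ p₁ p₂ ≤ -l := by
    unfold ishiiMinus
    split_ifs with hp
    · refine max_le ?_ hA0
      -- Here `p₂ ≤ q ≤ p₁`: slopes above `q` increase `G₂` and slopes below `q` increase `G₁`, so
      -- the right slope can be lowered and the left slope raised to `q`.
      obtain ⟨q, hq, h⟩ := exists_fluxAstar_eq (p₁ := p₁) (p₂ := p₂) h₁.continuous h₂.continuous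
      rw [h]
      by_contra hcon
      push Not at hcon
      rw [uIcc_of_ge hp.le] at hq
      have hq1 : 0 < l + G₁ q := by linarith [min_le_left (G₁ q) (G₂ q)]
      have hq2 : 0 < l + G₂ q := by linarith [min_le_right (G₁ q) (G₂ q)]
      have hk1 : UKink w t₀ x₀ l q₁ q := by
        rcases le_total q₂ q with h' | h'
        · exact hk.mono le_rfl h'
        · refine hk.extend_right h₂.continuous husc hR h' fun p hp => ?_
          have := h₂.mono hq.1 (hq.1.trans hp.1) hp.1
          linarith
      refine h0' q hq1 hq2 ?_
      rcases le_total q q₁ with h' | h'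
      · exact hk1.mono h' le_rfl
      · refine hk1.extend_left h₁.continuous husc hL h' fun p hp => ?_
        have := h₁.anti (hp.2.trans hq.2) hq.2 hp.2
        linarith
    · exact hA0
  have : fluxFun G₁ G₂ p₁ p₂ (ishiiMinus G₁ G₂ p₁ p₂) q₁ q₂ ≤ -l :=
    max_le hA (max_le (by linarith) (by linarith))
  linarith

/-- Ishii's super-solution inequalities imply the flux-limited ones with the upper Ishii flux
limiter. The super-solution is `-w`. -/
lemma le_fluxFun_of_kink {H₁ H₂ : ℝ → ℝ} (h₁ : IsQuasiConvex H₁ p₁) (h₂ : IsQuasiConvex H₂ p₂)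
    (husc : ∀ᶠ z in 𝓝 (t₀, x₀), UpperSemicontinuousAt (fun z : ℝ × ℝ => w z.1 z.2) z)
    (hL : ∀ᶠ z in 𝓝 (t₀, x₀), z.2 < x₀ → ∀ l' p, UJet w z.1 z.2 l' p → l' + -H₁ (-p) ≤ 0)
    (hR : ∀ᶠ z in 𝓝 (t₀, x₀), x₀ < z.2 → ∀ l' p, UJet w z.1 z.2 l' p → l' + -H₂ (-p) ≤ 0)
    (h0 : ∀ p, UJet w t₀ x₀ l p → l ≤ max (H₁ (-p)) (H₂ (-p)))
    (hk : UKink w t₀ x₀ l q₁ q₂) :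
    l ≤ fluxFun H₁ H₂ p₁ p₂ (ishiiPlus H₁ H₂ p₁ p₂) (-q₁) (-q₂) := by
  by_contra hcon
  push Not at hcon
  simp only [fluxFun, max_lt_iff, incPart_eq, decPart_eq] at hcon
  obtain ⟨hA, hr₁, hr₂⟩ := hcon
  -- The slopes at which the monotone parts take the values of `H₁` and `H₂` themselves; passing to
  -- them only weakens the kink.
  set r₁ := max (-q₁) p₁
  set r₂ := min (-q₂) p₂
  have hk' : UKink w t₀ x₀ l (-r₁) (-r₂) :=
    hk.mono (by linarith [le_max_left (-q₁) p₁]) (by linarith [min_le_left (-q₂) p₂])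
  -- Strict sublevel sets of quasi-convex functions are intervals, so the two slopes can travel from
  -- `r₂` and `r₁` to `p` without leaving them.
  have hno : ∀ p, H₁ p < l → ¬ H₂ p < l := by
    intro p hp1 hp2
    have hk1 : UKink w t₀ x₀ l (-r₁) (-p) := by
      rcases le_total p r₂ with h | h
      · exact hk'.mono le_rfl (by linarith)
      · refine hk'.extend_right (G := fun p => -H₂ (-p)) (by have := h₂.continuous; fun_prop)
          husc hR (by linarith) fun s hs => ?_
        have := h₂.le_max (show r₂ ≤ -s by linarith [hs.2]) (show -s ≤ p by linarith [hs.1])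
        have := max_lt hr₂ hp2
        linarith
    have hk2 : UKink w t₀ x₀ l (-p) (-p) := by
      rcases le_total r₁ p with h | h
      · exact hk1.mono (by linarith) le_rfl
      · refine hk1.extend_left (G := fun p => -H₁ (-p)) (by have := h₁.continuous; fun_prop)
          husc hL (by linarith) fun s hs => ?_
        have := h₁.le_max (show p ≤ -s by linarith [hs.2]) (show -s ≤ r₁ by linarith [hs.1])
        have := max_lt hp1 hr₁
        linarith
    have := h0 _ hk2.ujet
    rw [neg_neg] at this
    exact this.not_gt (max_lt hp1 hp2)
  -- The two sublevel sets are open, contain `p₂` and `p₁`, and have no common point, so they cannot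
  -- cover the connected chord.
  have hsub : ∃ p ∈ uIcc p₁ p₂, l ≤ min (H₁ p) (H₂ p) := by
    by_contra hcon
    push Not at hcon
    obtain ⟨p, -, hp1, hp2⟩ := (isPreconnected_uIcc (a := p₁) (b := p₂)) {p | H₁ p < l} {p | H₂ p < l}
      (isOpen_lt h₁.continuous continuous_const) (isOpen_lt h₂.continuous continuous_const)
      (fun p hp => min_lt_iff.1 (hcon p hp))
      ⟨p₁, left_mem_uIcc, (h₁.min_le r₁).trans_lt hr₁⟩
      ⟨p₂, right_mem_uIcc, (h₂.min_le r₂).trans_lt hr₂⟩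
    exact hno p hp1 hp2
  obtain ⟨p, hp, hlp⟩ := hsub
  have := le_fluxAstar h₁.continuous h₂.continuous hp
  have : fluxAstar H₁ H₂ p₁ p₂ ≤ ishiiPlus H₁ H₂ p₁ p₂ := le_max_left _ _
  linarith

end core

/-! ### Sub-solutions in terms of jets -/

/-- The sub-solution inequalities at `(t, x)` in terms of jets. -/
def JetSub (H₁ H₂ : ℝ → ℝ) (F : ℝ → ℝ → ℝ) (w : ℝ → ℝ → ℝ) (t x : ℝ) : Prop :=
  (x < 0 → ∀ l p, UJet w t x l p → l + H₁ p ≤ 0) ∧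
  (0 < x → ∀ l p, UJet w t x l p → l + H₂ p ≤ 0) ∧
  (x = 0 → ∀ l q₁ q₂, UKink w t x l q₁ q₂ → l + F q₁ q₂ ≤ 0)

/-- `v` satisfies the super-solution inequalities at `(t, x)`, in terms of jets of `-v`. -/
def JetSuper (H₁ H₂ : ℝ → ℝ) (F : ℝ → ℝ → ℝ) (v : ℝ → ℝ → ℝ) (t x : ℝ) : Prop :=
  JetSub (fun p => -H₁ (-p)) (fun p => -H₂ (-p)) (fun q₁ q₂ => -F (-q₁) (-q₂))
    (fun t x => -v t x) t x

lemma dt_separated {a g : ℝ → ℝ} (c : ℝ) (t x : ℝ) :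
    dt (fun t x => a t + g x + c) t x = deriv a t := by
  simp [dt]

lemma dx_separated {a g : ℝ → ℝ} (c : ℝ) (t x : ℝ) :
    dx (fun t x => a t + g x + c) t x = deriv g x := by
  simp [dx]

lemma isSmoothTest_separated {a g : ℝ → ℝ} (ha : ContDiff ℝ 1 a) (hg : ContDiff ℝ 1 g) (c : ℝ) :
    IsSmoothTest fun t x => a t + g x + c := by
  unfold IsSmoothTest; fun_prop

lemma IsSmoothTest.isPiecewiseTest {φ : ℝ → ℝ → ℝ} (h : IsSmoothTest φ) : IsPiecewiseTest φ :=
  ⟨h.continuousOn, h.mono (prod_mono_right (subset_univ _)), h.mono (prod_mono_right (subset_univ _))⟩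

lemma isPiecewiseTest_kink {a : ℝ → ℝ} (ha : ContDiff ℝ 1 a) (q₁ q₂ c : ℝ) :
    IsPiecewiseTest fun t x => a t + kink q₁ q₂ x + c := by
  have hc := ha.continuous
  have hk := continuous_kink q₁ q₂
  refine ⟨by fun_prop, ?_, ?_⟩
  · have : ContDiff ℝ 1 fun z : ℝ × ℝ => a z.1 + q₁ * z.2 + c := by fun_prop
    refine this.contDiffOn.congr fun z hz => ?_
    simp only [kink_of_nonpos hz.2]
  · have : ContDiff ℝ 1 fun z : ℝ × ℝ => a z.1 + q₂ * z.2 + c := by fun_prop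
    refine this.contDiffOn.congr fun z hz => ?_
    simp only [kink_of_nonneg hz.2]

lemma dxLeft_kink {a : ℝ → ℝ} (q₁ q₂ c t : ℝ) :
    dxLeft (fun t x => a t + kink q₁ q₂ x + c) t = q₁ := by
  have h : HasDerivAt (fun x => a t + q₁ * x + c) q₁ 0 := by
    simpa using (((hasDerivAt_id (0 : ℝ)).const_mul q₁).const_add (a t)).add_const c
  exact (h.hasDerivWithinAt.congr (fun x hx => by simp only [kink_of_nonpos hx])
    (by simp)).derivWithin (uniqueDiffWithinAt_Iic 0)

lemma dxRight_kink {a : ℝ → ℝ} (q₁ q₂ c t : ℝ) :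
    dxRight (fun t x => a t + kink q₁ q₂ x + c) t = q₂ := by
  have h : HasDerivAt (fun x => a t + q₂ * x + c) q₂ 0 := by
    simpa using (((hasDerivAt_id (0 : ℝ)).const_mul q₂).const_add (a t)).add_const c
  exact (h.hasDerivWithinAt.congr (fun x hx => by simp only [kink_of_nonneg hx])
    (by simp)).derivWithin (uniqueDiffWithinAt_Ici 0)

lemma dxLeft_of_smooth {φ : ℝ → ℝ → ℝ} (h : IsSmoothTest φ) {t : ℝ} (ht : 0 < t) :
    dxLeft φ t = dx φ t 0 ∧ dxRight φ t = dx φ t 0 := by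
  have hd : DifferentiableAt ℝ (fun z : ℝ × ℝ => φ z.1 z.2) (t, 0) :=
    (ContDiffOn.differentiableOn h one_ne_zero).differentiableAt
      (prod_mem_nhds (Ioi_mem_nhds ht) univ_mem)
  have hx : DifferentiableAt ℝ (φ t) 0 :=
    hd.comp (f := fun x : ℝ => (t, x)) 0 (by fun_prop)
  exact ⟨hx.derivWithin (uniqueDiffWithinAt_Iic 0), hx.derivWithin (uniqueDiffWithinAt_Ici 0)⟩

section toJet

variable {w : ℝ → ℝ → ℝ} {t x l p q₁ q₂ : ℝ}

lemma UJet.exists_touchesAbove (h : UJet w t x l p) : ∃ φ, IsSmoothTest φ ∧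
    TouchesAbove φ w t x ∧ dt φ t x = l ∧ dx φ t x = p := by
  obtain ⟨a, g, ha, hg, rfl, rfl, hmax⟩ := h
  refine ⟨_, isSmoothTest_separated ha hg (w t x - a t - g x), ⟨?_, by ring⟩,
    dt_separated _ _ _, dx_separated _ _ _⟩
  filter_upwards [hmax] with z hz
  linarith

lemma UJet.exists_touchesBelow (h : UJet (fun t x => -w t x) t x l p) : ∃ φ, IsSmoothTest φ ∧
    TouchesBelow φ w t x ∧ dt φ t x = -l ∧ dx φ t x = -p := by
  obtain ⟨a, g, ha, hg, rfl, rfl, hmax⟩ := h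
  refine ⟨_, isSmoothTest_separated ha.neg hg.neg (w t x + a t + g x), ⟨?_, by ring⟩,
    (dt_separated _ _ _).trans (deriv.fun_neg ..), (dx_separated _ _ _).trans (deriv.fun_neg ..)⟩
  filter_upwards [hmax] with z hz
  linarith

lemma UKink.exists_touchesAbove (h : UKink w t 0 l q₁ q₂) : ∃ φ, IsPiecewiseTest φ ∧
    TouchesAbove φ w t 0 ∧ dt φ t 0 = l ∧ dxLeft φ t = q₁ ∧ dxRight φ t = q₂ := by
  obtain ⟨a, ha, rfl, hmax⟩ := h
  refine ⟨_, isPiecewiseTest_kink ha q₁ q₂ (w t 0 - a t), ⟨?_, by simp⟩,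
    dt_separated _ _ _, dxLeft_kink _ _ _ _, dxRight_kink _ _ _ _⟩
  filter_upwards [hmax] with z hz
  simp only [sub_zero, kink_zero] at hz
  linarith

lemma UKink.exists_touchesBelow (h : UKink (fun t x => -w t x) t 0 l q₁ q₂) :
    ∃ φ, IsPiecewiseTest φ ∧ TouchesBelow φ w t 0 ∧ dt φ t 0 = -l ∧ dxLeft φ t = -q₁ ∧
      dxRight φ t = -q₂ := by
  obtain ⟨a, ha, rfl, hmax⟩ := h
  refine ⟨_, isPiecewiseTest_kink ha.neg (-q₁) (-q₂) (w t 0 + a t), ⟨?_, by simp⟩,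
    (dt_separated _ _ _).trans (deriv.fun_neg ..), dxLeft_kink _ _ _ _, dxRight_kink _ _ _ _⟩
  filter_upwards [hmax] with z hz
  simp only [sub_zero, kink_zero] at hz
  rw [← kink_neg]
  linarith

end toJet

section

variable {H₁ H₂ : ℝ → ℝ} {p₁ p₂ A : ℝ} {u : ℝ → ℝ → ℝ}

lemma IsFluxSub.jetSub (h : IsFluxSub H₁ H₂ p₁ p₂ A u) {t : ℝ} (ht : 0 < t) (x : ℝ) :
    JetSub H₁ H₂ (fluxFun H₁ H₂ p₁ p₂ A) (upperEnv u) t x := by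
  refine ⟨fun hx l p hj => ?_, fun hx l p hj => ?_, ?_⟩
  · obtain ⟨φ, hφ, ht', rfl, rfl⟩ := hj.exists_touchesAbove
    exact (h.2 φ hφ.isPiecewiseTest t x ht ht').1 hx
  · obtain ⟨φ, hφ, ht', rfl, rfl⟩ := hj.exists_touchesAbove
    exact (h.2 φ hφ.isPiecewiseTest t x ht ht').2.1 hx
  · rintro rfl l q₁ q₂ hj
    obtain ⟨φ, hφ, ht', rfl, rfl, rfl⟩ := hj.exists_touchesAbove
    exact (h.2 φ hφ t 0 ht ht').2.2 rfl

lemma IsFluxSuper.jetSuper (h : IsFluxSuper H₁ H₂ p₁ p₂ A u) {t : ℝ} (ht : 0 < t) (x : ℝ) :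
    JetSuper H₁ H₂ (fluxFun H₁ H₂ p₁ p₂ A) (lowerEnv u) t x := by
  refine ⟨fun hx l p hj => ?_, fun hx l p hj => ?_, ?_⟩
  · obtain ⟨φ, hφ, ht', h1, h2⟩ := hj.exists_touchesBelow
    have := (h.2 φ hφ.isPiecewiseTest t x ht ht').1 hx
    rw [h1, h2] at this; linarith
  · obtain ⟨φ, hφ, ht', h1, h2⟩ := hj.exists_touchesBelow
    have := (h.2 φ hφ.isPiecewiseTest t x ht ht').2.1 hx
    rw [h1, h2] at this; linarith
  · rintro rfl l q₁ q₂ hj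
    obtain ⟨φ, hφ, ht', h1, h2, h3⟩ := hj.exists_touchesBelow
    have := (h.2 φ hφ t 0 ht ht').2.2 rfl
    rw [h1, h2, h3] at this; linarith

/-- A flux-limited sub-solution is an Ishii sub-solution if the flux limiter is at least
`A_I^-`. -/
lemma IsFluxSub.isIshiiSub (h₁ : IsQuasiConvex H₁ p₁) (h₂ : IsQuasiConvex H₂ p₂)
    (hA : ishiiMinus H₁ H₂ p₁ p₂ ≤ A) (h : IsFluxSub H₁ H₂ p₁ p₂ A u) : IsIshiiSub H₁ H₂ u := by
  refine ⟨h.1, fun φ hφ t x ht ht' => ?_⟩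
  obtain ⟨ha, hb, hc⟩ := h.2 φ hφ.isPiecewiseTest t x ht ht'
  refine ⟨ha, hb, ?_⟩
  rintro rfl
  have := hc rfl
  rw [(dxLeft_of_smooth hφ ht).1, (dxLeft_of_smooth hφ ht).2] at this
  linarith [min_le_fluxFun h₁ h₂ hA (dx φ t 0)]

/-- A flux-limited super-solution is an Ishii super-solution if the flux limiter is at most
`A_I^+`. -/
lemma IsFluxSuper.isIshiiSuper (h₁ : IsQuasiConvex H₁ p₁) (h₂ : IsQuasiConvex H₂ p₂)
    (hA : A ≤ ishiiPlus H₁ H₂ p₁ p₂) (h : IsFluxSuper H₁ H₂ p₁ p₂ A u) :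
    IsIshiiSuper H₁ H₂ u := by
  refine ⟨h.1, fun φ hφ t x ht ht' => ?_⟩
  obtain ⟨ha, hb, hc⟩ := h.2 φ hφ.isPiecewiseTest t x ht ht'
  refine ⟨ha, hb, ?_⟩
  rintro rfl
  have := hc rfl
  rw [(dxLeft_of_smooth hφ ht).1, (dxLeft_of_smooth hφ ht).2] at this
  linarith [fluxFun_le_max h₁ h₂ hA (dx φ t 0)]

end

/-! ### Stability of jets -/

section family

variable {𝓕 : Set (ℝ → ℝ → ℝ)} {t₀ x₀ W₀ l q₁ q₂ : ℝ}

/-- With `y = K * (α + β)`, the hypothesis multiplied by `2 K` reads `0 < 2 δ² + 2 δ y - y² - (K (α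
- β))²`, which is impossible for `y ≥ 4 δ`. -/
lemma mul_add_lt_of_penalty {K δ η α β : ℝ} (hK : 0 < K) (hδ : 0 < δ) (hα : 0 ≤ α) (hβ : 0 ≤ β)
    (hη : 2 * K * η = δ ^ 2) (h : 0 < 2 * η + δ * (α + β) - K * (α ^ 2 + β ^ 2)) :
    K * (α + β) < 4 * δ := by
  by_contra hcon
  push Not at hcon
  have h1 : 0 < 2 * K * (2 * η + δ * (α + β) - K * (α ^ 2 + β ^ 2)) := by positivity
  have h2 : 2 * K * (2 * η + δ * (α + β) - K * (α ^ 2 + β ^ 2)) =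
      2 * δ ^ 2 + 2 * δ * (K * (α + β)) - (K * (α + β)) ^ 2 - (K * (α - β)) ^ 2 := by
    rw [← hη]; ring
  rw [h2] at h1
  have h3 : 4 * δ * (K * (α + β)) ≤ (K * (α + β)) ^ 2 := by rw [pow_two]; gcongr
  have h4 : 4 * δ * δ ≤ K * (α + β) * δ := by gcongr
  nlinarith [sq_nonneg (K * (α - β))]

/-- Suppose that the functions of the family `𝓕` are bounded from above near `(t₀, x₀)` by a
function which is differentiable in time and one-sidedly differentiable in space at that point,
and that they come close to its value at the point. Then some of them are touched from above by
a nearby test function. -/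
lemma exists_localMax_of_family
    (husc : ∀ᶠ z in 𝓝 (t₀, x₀), ∀ w ∈ 𝓕, UpperSemicontinuousAt (fun z : ℝ × ℝ => w z.1 z.2) z)
    (hle : ∀ δ > 0, ∀ᶠ z in 𝓝 (t₀, x₀), ∀ w ∈ 𝓕, w z.1 z.2 ≤
      W₀ + l * (z.1 - t₀) + kink q₁ q₂ (z.2 - x₀) + δ * (|z.1 - t₀| + |z.2 - x₀|))
    (happ : ∀ ε > 0, ∃ᶠ z in 𝓝 (t₀, x₀), ∃ w ∈ 𝓕, W₀ - ε < w z.1 z.2) {ε : ℝ} (hε : 0 < ε) :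
    ∃ w ∈ 𝓕, ∃ t x, |t - t₀| < ε ∧ |x - x₀| < ε ∧ ∃ a g : ℝ → ℝ, ContDiff ℝ 1 a ∧
      ContDiff ℝ 1 g ∧ |deriv a t - l| < ε ∧ |deriv g x| < ε ∧ deriv g x₀ = 0 ∧
      IsLocalMax (fun z : ℝ × ℝ => w z.1 z.2 - a z.1 - kink q₁ q₂ (z.2 - x₀) - g z.2) (t, x) := by
  set δ := ε / 8 with hδ
  have hδ0 : 0 < δ := by positivity
  obtain ⟨r', hr', hr''⟩ := eventually_nhds_prod.1 (husc.and (hle δ hδ0))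
  obtain ⟨r, hr0, hrr⟩ := exists_between (lt_min hr' hε)
  obtain ⟨hrr', hrε⟩ := lt_min_iff.1 hrr
  -- On the boundary of the box the penalty is at least `K r² = 4 δ r` and beats the errors `2 η + 2
  -- δ r`, since `8 η = δ r`. At the maximum the gradient of the penalty is below `8 δ = ε`.
  set K := 4 * δ / r with hK
  have hK0 : 0 < K := by positivity
  have hKr : K * r = 4 * δ := by rw [hK]; field_simp
  set η := δ ^ 2 / (2 * K) with hη
  have hη0 : 0 < η := by positivity
  have hKη : 2 * K * η = δ ^ 2 := by rw [hη]; field_simp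
  have hηr : 8 * η = δ * r := by
    have h1 : K * (8 * η) = K * (δ * r) := by
      have h2 : K * (8 * η) = 4 * (2 * K * η) := by ring
      have h3 : K * (δ * r) = δ * (K * r) := by ring
      rw [h2, h3, hKη, hKr]; ring
    exact mul_left_cancel₀ hK0.ne' h1
  have hkc := continuous_kink q₁ q₂
  set f : (ℝ → ℝ → ℝ) → ℝ × ℝ → ℝ := fun w z => w z.1 z.2 + (2 * η - W₀ - l * (z.1 - t₀) -
    kink q₁ q₂ (z.2 - x₀) - K * (z.1 - t₀) ^ 2 - K * (z.2 - x₀) ^ 2) with hf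
  have hcont : Continuous fun z : ℝ × ℝ => 2 * η - W₀ - l * (z.1 - t₀) -
    kink q₁ q₂ (z.2 - x₀) - K * (z.1 - t₀) ^ 2 - K * (z.2 - x₀) ^ 2 := by fun_prop
  have hnear : ∀ᶠ z in 𝓝 (t₀, x₀), η - W₀ < 2 * η - W₀ - l * (z.1 - t₀) -
      kink q₁ q₂ (z.2 - x₀) - K * (z.1 - t₀) ^ 2 - K * (z.2 - x₀) ^ 2 :=
    hcont.continuousAt.eventually (lt_mem_nhds (by simp; linarith))
  obtain ⟨⟨t₁, x₁⟩, ⟨w, hw, hw1⟩, hw2, hbox⟩ := ((happ η hη0).and_eventually (hnear.and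
    (prod_mem_nhds (Icc_mem_nhds (show t₀ - r < t₀ by linarith) (show t₀ < t₀ + r by linarith))
      (Icc_mem_nhds (show x₀ - r < x₀ by linarith) (show x₀ < x₀ + r by linarith))))).exists
  have hin : ∀ t ∈ Icc (t₀ - r) (t₀ + r), ∀ x ∈ Icc (x₀ - r) (x₀ + r),
      |t - t₀| ≤ r ∧ |x - x₀| ≤ r := fun t ht x hx =>
    ⟨by rw [abs_le]; constructor <;> linarith [ht.1, ht.2],
      by rw [abs_le]; constructor <;> linarith [hx.1, hx.2]⟩
  have hfle : ∀ t ∈ Icc (t₀ - r) (t₀ + r), ∀ x ∈ Icc (x₀ - r) (x₀ + r),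
      f w (t, x) ≤ 2 * η + δ * (|t - t₀| + |x - x₀|) - K * (|t - t₀| ^ 2 + |x - x₀| ^ 2) := by
    intro t ht x hx
    obtain ⟨h1, h2⟩ := hin t ht x hx
    have h3 := (hr'' t x (by linarith) (by linarith)).2 w hw
    simp only at h3
    simp only [hf, sq_abs]
    linarith
  obtain ⟨t, ht, x, hx, hmax, hpos⟩ := exists_isLocalMax_of_box (f := f w)
    (a := t₀ - r) (b := t₀ + r) (c := x₀ - r) (d := x₀ + r) (by
      rintro ⟨t, x⟩ ⟨ht, hx⟩
      obtain ⟨h1, h2⟩ := hin t ht x hx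
      exact UpperSemicontinuousWithinAt.add
        (UpperSemicontinuousAt.upperSemicontinuousWithinAt _
          ((hr'' t x (by linarith) (by linarith)).1 w hw))
        hcont.continuousAt.continuousWithinAt.upperSemicontinuousWithinAt) (by
      intro t ht x hx hor
      obtain ⟨h1, h2⟩ := hin t ht x hx
      refine (hfle t ht x hx).trans ?_
      have h3 : r ^ 2 ≤ |t - t₀| ^ 2 + |x - x₀| ^ 2 := by
        rcases hor with rfl | rfl | rfl | rfl
        · rw [show t₀ - r - t₀ = -r by ring, abs_neg, abs_of_pos hr0]; nlinarith
        · rw [show t₀ + r - t₀ = r by ring, abs_of_pos hr0]; nlinarith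
        · rw [show x₀ - r - x₀ = -r by ring, abs_neg, abs_of_pos hr0]; nlinarith
        · rw [show x₀ + r - x₀ = r by ring, abs_of_pos hr0]; nlinarith
      have h4 : K * r ^ 2 ≤ K * (|t - t₀| ^ 2 + |x - x₀| ^ 2) := by gcongr
      have h5 : K * r ^ 2 = 4 * (δ * r) := by rw [pow_two, ← mul_assoc, hKr]; ring
      have h6 : δ * (|t - t₀| + |x - x₀|) ≤ δ * (r + r) := by gcongr
      have h7 : δ * (r + r) = 2 * (δ * r) := by ring
      have h8 : 0 < δ * r := by positivity
      linarith) hbox.1 hbox.2 (by simp only [hf]; simp only at hw1 hw2; linarith)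
  have h1 := hfle t (Ioo_subset_Icc_self ht) x (Ioo_subset_Icc_self hx)
  set m := |t - t₀| + |x - x₀| with hm
  have hm0 : 0 ≤ m := by positivity
  have hKm : K * m < 4 * δ :=
    mul_add_lt_of_penalty hK0 hδ0 (abs_nonneg _) (abs_nonneg _) hKη (hpos.trans_le h1)
  have habs : ∀ y, |y| ≤ m → |2 * K * y| < ε := fun y hy => by
    rw [abs_mul, abs_of_pos (by positivity)]
    have : K * |y| ≤ K * m := by gcongr
    linarith
  have hta : |t - t₀| < r := abs_lt.2 ⟨by linarith [ht.1], by linarith [ht.2]⟩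
  have hxa : |x - x₀| < r := abs_lt.2 ⟨by linarith [hx.1], by linarith [hx.2]⟩
  have hpar : ∀ y₀ y : ℝ, HasDerivAt (fun y => K * (y - y₀) ^ 2) (2 * K * (y - y₀)) y :=
    fun y₀ y => ((((hasDerivAt_id y).sub_const y₀).pow 2).const_mul K).congr_deriv (by simp; ring)
  refine ⟨w, hw, t, x, by linarith, by linarith, fun t => l * (t - t₀) + K * (t - t₀) ^ 2,
    fun x => K * (x - x₀) ^ 2, by fun_prop, by fun_prop, ?_, ?_, ?_, ?_⟩
  · have : HasDerivAt (fun t => l * (t - t₀) + K * (t - t₀) ^ 2) (l + 2 * K * (t - t₀)) t := by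
      refine ((((hasDerivAt_id t).sub_const t₀).const_mul l).add (hpar t₀ t)).congr_deriv ?_
      simp
    rw [this.deriv, add_sub_cancel_left]
    exact habs _ (by rw [hm]; linarith [abs_nonneg (x - x₀)])
  · rw [(hpar x₀ x).deriv]
    exact habs _ (by rw [hm]; linarith [abs_nonneg (t - t₀)])
  · rw [(hpar x₀ x₀).deriv]; simp
  · filter_upwards [hmax] with z hz
    simp only [hf] at hz
    linarith

end family

/-! ### First-order expansions of test functions. -/

section expansion

variable {Φ : ℝ × ℝ → ℝ} {L : ℝ × ℝ →L[ℝ] ℝ} {S : Set (ℝ × ℝ)} {t₀ x₀ : ℝ}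

lemma eventually_abs_le_of_hasFDerivWithinAt (h : HasFDerivWithinAt Φ L S (t₀, x₀)) {δ : ℝ}
    (hδ : 0 < δ) : ∀ᶠ z in 𝓝[S] (t₀, x₀),
      |Φ z - Φ (t₀, x₀) - (L (1, 0) * (z.1 - t₀) + L (0, 1) * (z.2 - x₀))| ≤
        δ * (|z.1 - t₀| + |z.2 - x₀|) := by
  filter_upwards [h.isLittleO.def hδ] with z hz
  have e : z - (t₀, x₀) = (z.1 - t₀) • ((1 : ℝ), (0 : ℝ)) + (z.2 - x₀) • ((0 : ℝ), (1 : ℝ)) := by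
    ext <;> simp
  have h1 : L (z - (t₀, x₀)) = L (1, 0) * (z.1 - t₀) + L (0, 1) * (z.2 - x₀) := by
    rw [e, map_add, map_smul, map_smul, smul_eq_mul, smul_eq_mul]; ring
  have h2 : ‖z - (t₀, x₀)‖ ≤ |z.1 - t₀| + |z.2 - x₀| := by
    rw [Prod.norm_def]
    exact max_le (by simp) (by simp)
  rw [h1, Real.norm_eq_abs] at hz
  exact hz.trans (by gcongr)

lemma hasDerivWithinAt_time (h : HasFDerivWithinAt Φ L S (t₀, x₀)) {s : Set ℝ}
    (hs : ∀ t ∈ s, (t, x₀) ∈ S) : HasDerivWithinAt (fun t => Φ (t, x₀)) (L (1, 0)) s t₀ :=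
  h.comp_hasDerivWithinAt (f := fun t => (t, x₀)) t₀
    ((hasDerivWithinAt_id t₀ s).prodMk (hasDerivWithinAt_const t₀ s x₀)) hs

lemma hasDerivWithinAt_space (h : HasFDerivWithinAt Φ L S (t₀, x₀))
    {s : Set ℝ} (hs : ∀ x ∈ s, (t₀, x) ∈ S) :
    HasDerivWithinAt (fun x => Φ (t₀, x)) (L (0, 1)) s x₀ :=
  h.comp_hasDerivWithinAt (f := fun x => (t₀, x)) x₀
    ((hasDerivWithinAt_const x₀ s t₀).prodMk (hasDerivWithinAt_id x₀ s)) hs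

end expansion

section expansion

variable {φ : ℝ → ℝ → ℝ} {t₀ x₀ : ℝ}

lemma eventually_abs_sub_le (h : DifferentiableAt ℝ (fun z : ℝ × ℝ => φ z.1 z.2) (t₀, x₀))
    {δ : ℝ} (hδ : 0 < δ) : ∀ᶠ z in 𝓝 (t₀, x₀),
      |φ z.1 z.2 - φ t₀ x₀ - (dt φ t₀ x₀ * (z.1 - t₀) +
        kink (dx φ t₀ x₀) (dx φ t₀ x₀) (z.2 - x₀))| ≤ δ * (|z.1 - t₀| + |z.2 - x₀|) := by
  have h' := h.hasFDerivAt.hasFDerivWithinAt (s := univ)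
  have h1 := eventually_abs_le_of_hasFDerivWithinAt h' hδ
  have h2 : dt φ t₀ x₀ = _ := (hasDerivWithinAt_univ.1
    (hasDerivWithinAt_time h' (s := univ) fun _ _ => mem_univ _)).deriv
  have h3 : dx φ t₀ x₀ = _ := (hasDerivWithinAt_univ.1
    (hasDerivWithinAt_space h' (s := univ) fun _ _ => mem_univ _)).deriv
  rw [nhdsWithin_univ] at h1
  simpa only [kink_self, h2, h3] using h1

lemma IsPiecewiseTest.differentiableAt (h : IsPiecewiseTest φ) (ht : 0 < t₀) (hx : x₀ ≠ 0) :
    DifferentiableAt ℝ (fun z : ℝ × ℝ => φ z.1 z.2) (t₀, x₀) := by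
  rcases lt_or_gt_of_ne hx with hx | hx
  · exact (h.2.1.differentiableOn one_ne_zero).differentiableAt
      (prod_mem_nhds (Ioi_mem_nhds ht) (Iic_mem_nhds hx))
  · exact (h.2.2.differentiableOn one_ne_zero).differentiableAt
      (prod_mem_nhds (Ioi_mem_nhds ht) (Ici_mem_nhds hx))

/-- The expansions on the two closed half-planes share the time derivative along `x = 0`, so they
glue into a single expansion along a kink. -/
lemma IsPiecewiseTest.eventually_abs_sub_le (h : IsPiecewiseTest φ) (ht : 0 < t₀)
    {δ : ℝ} (hδ : 0 < δ) : ∀ᶠ z in 𝓝 (t₀, 0),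
      |φ z.1 z.2 - φ t₀ 0 - (dt φ t₀ 0 * (z.1 - t₀) +
        kink (dxLeft φ t₀) (dxRight φ t₀) (z.2 - 0))| ≤ δ * (|z.1 - t₀| + |z.2 - 0|) := by
  have hL := ((h.2.1.differentiableOn one_ne_zero) (t₀, 0) ⟨ht, self_mem_Iic⟩).hasFDerivWithinAt
  have hR := ((h.2.2.differentiableOn one_ne_zero) (t₀, 0) ⟨ht, self_mem_Ici⟩).hasFDerivWithinAt
  have hLt : dt φ t₀ 0 = _ := ((hasDerivWithinAt_time hL (s := Ioi 0)
    fun t ht => ⟨ht, self_mem_Iic⟩).hasDerivAt (Ioi_mem_nhds ht)).deriv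
  have hRt : dt φ t₀ 0 = _ := ((hasDerivWithinAt_time hR (s := Ioi 0)
    fun t ht => ⟨ht, self_mem_Ici⟩).hasDerivAt (Ioi_mem_nhds ht)).deriv
  have hLx : dxLeft φ t₀ = _ := (hasDerivWithinAt_space hL (s := Iic 0)
    fun x hx => ⟨ht, hx⟩).derivWithin (uniqueDiffWithinAt_Iic 0)
  have hRx : dxRight φ t₀ = _ := (hasDerivWithinAt_space hR (s := Ici 0)
    fun x hx => ⟨ht, hx⟩).derivWithin (uniqueDiffWithinAt_Ici 0)
  have h1 := eventually_nhdsWithin_iff.1 (eventually_abs_le_of_hasFDerivWithinAt hL hδ)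
  have h2 := eventually_nhdsWithin_iff.1 (eventually_abs_le_of_hasFDerivWithinAt hR hδ)
  filter_upwards [h1, h2, continuousAt_fst.eventually (Ioi_mem_nhds ht)] with z h1 h2 h3
  rcases le_total z.2 0 with hz | hz
  · have := h1 ⟨h3, hz⟩
    rw [← hLt, ← hLx] at this
    rwa [kink_of_nonpos (by simpa using hz)]
  · have := h2 ⟨h3, hz⟩
    rw [← hRt, ← hRx] at this
    rwa [kink_of_nonneg (by simpa using hz)]

end expansion

section relaxed

variable {𝓕 : Set (ℝ → ℝ → ℝ)} {t₀ x₀ W₀ l q₁ q₂ p : ℝ} {H H₁ H₂ : ℝ → ℝ} {F : ℝ → ℝ → ℝ}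

/-- Where the kink is locally linear it merges with the `C¹` penalty into one smooth profile. -/
lemma kink_ujet {w : ℝ → ℝ → ℝ} {t x : ℝ} {a g : ℝ → ℝ} (ha : ContDiff ℝ 1 a)
    (hg : ContDiff ℝ 1 g) {q : ℝ} (hq : ∀ᶠ y in 𝓝 x, kink q₁ q₂ (y - x₀) = q * (y - x₀))
    (hmax : IsLocalMax (fun z : ℝ × ℝ => w z.1 z.2 - a z.1 - kink q₁ q₂ (z.2 - x₀) - g z.2)
      (t, x)) : UJet w t x (deriv a t) (q + deriv g x) := by
  refine ⟨a, fun y => q * (y - x₀) + g y, ha, by fun_prop, rfl, ?_, ?_⟩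
  · have := (((hasDerivAt_id x).sub_const x₀).const_mul q).add
      (hg.differentiable one_ne_zero x).hasDerivAt
    exact (this.congr_deriv (by simp)).deriv
  · have hq0 := hq.self_of_nhds
    filter_upwards [hmax, continuousAt_snd.eventually hq] with z h1 h2
    simp only [h2, hq0] at h1 ⊢
    linarith

/-- Stability of the sub-solution inequality away from the interface. -/
lemma add_le_of_family (hH : Continuous H)
    (husc : ∀ᶠ z in 𝓝 (t₀, x₀), ∀ w ∈ 𝓕, UpperSemicontinuousAt (fun z : ℝ × ℝ => w z.1 z.2) z)
    (hjet : ∀ᶠ z in 𝓝 (t₀, x₀), ∀ w ∈ 𝓕, ∀ l p, UJet w z.1 z.2 l p → l + H p ≤ 0)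
    (hle : ∀ δ > 0, ∀ᶠ z in 𝓝 (t₀, x₀), ∀ w ∈ 𝓕, w z.1 z.2 ≤
      W₀ + l * (z.1 - t₀) + kink p p (z.2 - x₀) + δ * (|z.1 - t₀| + |z.2 - x₀|))
    (happ : ∀ ε > 0, ∃ᶠ z in 𝓝 (t₀, x₀), ∃ w ∈ 𝓕, W₀ - ε < w z.1 z.2) : l + H p ≤ 0 := by
  by_contra hcon
  push Not at hcon
  have hc : Continuous fun z : ℝ × ℝ => z.1 + H z.2 := by fun_prop
  obtain ⟨r₁, hr₁, h1⟩ := eventually_nhds_prod.1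
    (hc.continuousAt.eventually (lt_mem_nhds (show (0 : ℝ) < (l, p).1 + H (l, p).2 from hcon)))
  obtain ⟨r₂, hr₂, h2⟩ := eventually_nhds_prod.1 hjet
  obtain ⟨w, hw, t, x, ht, hx, a, g, ha, hg, hal, hgp, -, hmax⟩ :=
    exists_localMax_of_family husc hle happ (lt_min hr₁ hr₂)
  obtain ⟨ht1, ht2⟩ := lt_min_iff.1 ht
  obtain ⟨hx1, hx2⟩ := lt_min_iff.1 hx
  have h3 := h2 t x ht2 hx2 w hw _ _ (kink_ujet ha hg
    (Eventually.of_forall fun y => kink_self _ _) hmax)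
  have h4 := h1 (deriv a t) (p + deriv g x) (lt_min_iff.1 hal).1
    (by rw [add_sub_cancel_left]; exact (lt_min_iff.1 hgp).1)
  exact h3.not_gt h4

/-- Stability of the sub-solution inequalities at the interface, in a relaxed sense. -/
lemma not_pos_of_family (hH₁ : Continuous H₁) (hH₂ : Continuous H₂)
    (hF : Continuous fun q : ℝ × ℝ => F q.1 q.2)
    (husc : ∀ᶠ z in 𝓝 (t₀, 0), ∀ w ∈ 𝓕, UpperSemicontinuousAt (fun z : ℝ × ℝ => w z.1 z.2) z)
    (hjet : ∀ᶠ z in 𝓝 (t₀, 0), ∀ w ∈ 𝓕, JetSub H₁ H₂ F w z.1 z.2)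
    (hle : ∀ δ > 0, ∀ᶠ z in 𝓝 (t₀, 0), ∀ w ∈ 𝓕, w z.1 z.2 ≤
      W₀ + l * (z.1 - t₀) + kink q₁ q₂ (z.2 - 0) + δ * (|z.1 - t₀| + |z.2 - 0|))
    (happ : ∀ ε > 0, ∃ᶠ z in 𝓝 (t₀, 0), ∃ w ∈ 𝓕, W₀ - ε < w z.1 z.2)
    (h₁ : 0 < l + H₁ q₁) (h₂ : 0 < l + H₂ q₂) (h₃ : 0 < l + F q₁ q₂) : False := by
  have hc1 : Continuous fun z : ℝ × ℝ => z.1 + H₁ z.2 := by fun_prop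
  have hc2 : Continuous fun z : ℝ × ℝ => z.1 + H₂ z.2 := by fun_prop
  have hc3 : Continuous fun z : ℝ × ℝ => z.1 + F (q₁ - z.2) (q₂ + z.2) := by
    have : Continuous fun z : ℝ × ℝ => F (q₁ - z.2) (q₂ + z.2) :=
      hF.comp (f := fun z : ℝ × ℝ => (q₁ - z.2, q₂ + z.2)) (by fun_prop)
    fun_prop
  obtain ⟨r₁, hr₁, e1⟩ := eventually_nhds_prod.1
    (hc1.continuousAt.eventually (lt_mem_nhds (show (0 : ℝ) < (l, q₁).1 + H₁ (l, q₁).2 from h₁)))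
  obtain ⟨r₂, hr₂, e2⟩ := eventually_nhds_prod.1
    (hc2.continuousAt.eventually (lt_mem_nhds (show (0 : ℝ) < (l, q₂).1 + H₂ (l, q₂).2 from h₂)))
  obtain ⟨r₃, hr₃, e3⟩ := eventually_nhds_prod.1 (hc3.continuousAt.eventually
    (lt_mem_nhds (show (0 : ℝ) < (l, (0 : ℝ)).1 + F (q₁ - (l, (0 : ℝ)).2) (q₂ + (l, (0 : ℝ)).2) by
      simpa using h₃)))
  obtain ⟨r₄, hr₄, e4⟩ := eventually_nhds_prod.1 hjet
  obtain ⟨w, hw, t, x, ht, hx, a, g, ha, hg, hal, hgp, hg0, hmax⟩ :=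
    exists_localMax_of_family husc hle happ (lt_min (lt_min hr₁ hr₂) (lt_min hr₃ hr₄))
  simp only [lt_min_iff] at ht hx hal hgp
  have hJ := e4 t x ht.2.2 hx.2.2 w hw
  rcases lt_trichotomy x 0 with hx0 | rfl | hx0
  · have h5 := hJ.1 hx0 _ _ (kink_ujet ha hg (q := q₁) (by
      filter_upwards [gt_mem_nhds hx0] with y hy
      exact kink_of_nonpos (by linarith)) hmax)
    exact h5.not_gt (e1 (deriv a t) (q₁ + deriv g x) hal.1.1
      (by rw [add_sub_cancel_left]; exact hgp.1.1))
  · have hgd : HasDerivAt g 0 0 := by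
      simpa only [hg0] using (hg.differentiable one_ne_zero 0).hasDerivAt
    -- The penalty has slope zero at the junction; opening the kink by `r₃ / 2` on each side absorbs
    -- it.
    have h5 : UKink w t 0 (deriv a t) (q₁ - r₃ / 2) (q₂ + r₃ / 2) := by
      refine ⟨a, ha, rfl, ?_⟩
      filter_upwards [hmax, continuousAt_snd.eventually (eventually_le_kink hgd
        (show -(r₃ / 2) < 0 by linarith) (show 0 < r₃ / 2 by linarith))] with z k1 k2
      have k3 := kink_add q₁ q₂ (-(r₃ / 2)) (r₃ / 2) (z.2 - 0)
      rw [← sub_eq_add_neg] at k3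
      simp only [sub_self, kink_zero] at k1 ⊢
      linarith
    have h6 := hJ.2.2 rfl _ _ _ h5
    exact h6.not_gt (e3 (deriv a t) (r₃ / 2) hal.2.1
      (by rw [sub_zero, abs_of_pos (by linarith)]; linarith))
  · have h5 := hJ.2.1 hx0 _ _ (kink_ujet ha hg (q := q₂) (by
      filter_upwards [lt_mem_nhds hx0] with y hy
      exact kink_of_nonneg (by linarith)) hmax)
    exact h5.not_gt (e2 (deriv a t) (q₂ + deriv g x) hal.1.2
      (by rw [add_sub_cancel_left]; exact hgp.1.2))

end relaxed

/-! ### From jets back to arbitrary test functions. -/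

section conversion

variable {H₁ H₂ : ℝ → ℝ} {p₁ p₂ A : ℝ} {u : ℝ → ℝ → ℝ}

/-- A function which is the upper envelope of the supremum of a family of sub-solutions is a
sub-solution. -/
lemma IsFluxSub.of_family {𝓕 : Set (ℝ → ℝ → ℝ)} (h₁ : IsQuasiConvexHamiltonian H₁ p₁)
    (h₂ : IsQuasiConvexHamiltonian H₂ p₂) (hu : LocallyBdd u)
    (husc : ∀ w ∈ 𝓕, ∀ t x, 0 < t → UpperSemicontinuousAt (fun z : ℝ × ℝ => w z.1 z.2) (t, x))
    (hjet : ∀ w ∈ 𝓕, ∀ t x, 0 < t → JetSub H₁ H₂ (fluxFun H₁ H₂ p₁ p₂ A) w t x)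
    (hle : ∀ w ∈ 𝓕, ∀ t x, 0 < t → w t x ≤ upperEnv u t x)
    (happ : ∀ t x, 0 < t → ∀ ε > 0, ∃ᶠ z in 𝓝 (t, x), ∃ w ∈ 𝓕, upperEnv u t x - ε < w z.1 z.2) :
    IsFluxSub H₁ H₂ p₁ p₂ A u := by
  refine ⟨hu, fun φ hφ t x ht hT => ?_⟩
  have hpos : ∀ᶠ z : ℝ × ℝ in 𝓝 (t, x), 0 < z.1 :=
    continuousAt_fst.eventually (lt_mem_nhds ht)
  have hU : ∀ᶠ z in 𝓝 (t, x), ∀ w ∈ 𝓕,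
      UpperSemicontinuousAt (fun z : ℝ × ℝ => w z.1 z.2) z := by
    filter_upwards [hpos] with z hz w hw
    exact husc w hw _ _ hz
  have hJ : ∀ᶠ z in 𝓝 (t, x), ∀ w ∈ 𝓕, JetSub H₁ H₂ (fluxFun H₁ H₂ p₁ p₂ A) w z.1 z.2 := by
    filter_upwards [hpos] with z hz w hw
    exact hjet w hw _ _ hz
  have hW : ∀ᶠ z in 𝓝 (t, x), ∀ w ∈ 𝓕, w z.1 z.2 ≤ φ z.1 z.2 := by
    filter_upwards [hpos, hT.1] with z hz hz' w hw
    exact (hle w hw _ _ hz).trans hz'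
  have hsmooth : x ≠ 0 → ∀ δ > 0, ∀ᶠ z in 𝓝 (t, x), ∀ w ∈ 𝓕, w z.1 z.2 ≤
      upperEnv u t x + dt φ t x * (z.1 - t) + kink (dx φ t x) (dx φ t x) (z.2 - x) +
        δ * (|z.1 - t| + |z.2 - x|) := fun hx δ hδ => by
    filter_upwards [hW, HJ.eventually_abs_sub_le (hφ.differentiableAt ht hx) hδ] with z k1 k2 w hw
    have := (abs_le.1 k2).2
    have := k1 w hw
    rw [hT.2]
    linarith
  refine ⟨fun hx => ?_, fun hx => ?_, ?_⟩
  · refine add_le_of_family h₁.continuous hU ?_ (hsmooth hx.ne) (happ t x ht)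
    filter_upwards [hJ, continuousAt_snd.eventually (gt_mem_nhds hx)] with z k1 k2 w hw
    exact (k1 w hw).1 k2
  · refine add_le_of_family h₂.continuous hU ?_ (hsmooth hx.ne') (happ t x ht)
    filter_upwards [hJ, continuousAt_snd.eventually (lt_mem_nhds hx)] with z k1 k2 w hw
    exact (k1 w hw).2.1 k2
  · rintro rfl
    set l := dt φ t 0
    -- Stability yields only that one of three inequalities holds, because the perturbed maximum may
    -- leave the junction. This remains true for the weaker kinks, with smaller left and larger
    -- right slope.
    have key : ∀ q₁ ≤ dxLeft φ t, ∀ q₂ ≥ dxRight φ t, 0 < l + H₁ q₁ → 0 < l + H₂ q₂ →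
        ¬ 0 < l + fluxFun H₁ H₂ p₁ p₂ A q₁ q₂ := by
      intro q₁ hq₁ q₂ hq₂ k1 k2 k3
      refine not_pos_of_family h₁.continuous h₂.continuous
        (continuous_fluxFun h₁.continuous h₂.continuous) hU hJ (W₀ := upperEnv u t 0) ?_
        (happ t 0 ht) k1 k2 k3
      intro δ hδ
      filter_upwards [hW, hφ.eventually_abs_sub_le ht hδ] with z k1 k2 w hw
      have := (abs_le.1 k2).2
      have := k1 w hw
      have := kink_mono hq₁ hq₂ (z.2 - 0)
      rw [hT.2]
      linarith
    have hc : ∀ (H : ℝ → ℝ), Tendsto H (cocompact ℝ) atTop → ∀ᶠ p in cocompact ℝ, 0 < l + H p :=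
      fun H h => (h.eventually (eventually_gt_atTop (-l))).mono fun p hp => by linarith
    have hc₁ := hc H₁ h₁.coercive
    have hc₂ := hc H₂ h₂.coercive
    -- Coercive slopes `r₁`, `r₂` exclude the alternatives on the two half-lines. Each of the three
    -- terms of the flux is tested by keeping the slope on which it depends and replacing the
    -- others.
    obtain ⟨r₁, hr₁, hr₁', -⟩ := (exists_le_of_coercive hc₁ hc₂ (dxLeft φ t)).1
    obtain ⟨r₂, hr₂, -, hr₂'⟩ := (exists_le_of_coercive hc₁ hc₂ (dxRight φ t)).2
    by_contra hcon
    push Not at hcon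
    have hcon' : -l < fluxFun H₁ H₂ p₁ p₂ A (dxLeft φ t) (dxRight φ t) := by linarith
    rw [fluxFun, lt_max_iff, lt_max_iff] at hcon'
    rcases hcon' with h | h | h
    · refine key r₁ hr₁ r₂ hr₂ hr₁' hr₂' ?_
      have : A ≤ fluxFun H₁ H₂ p₁ p₂ A r₁ r₂ := le_max_left _ _
      linarith
    · refine key _ le_rfl r₂ hr₂ ?_ hr₂' ?_
      · linarith [h₁.isQuasiConvex.inc_le (dxLeft φ t)]
      · have : incPart H₁ p₁ (dxLeft φ t) ≤ fluxFun H₁ H₂ p₁ p₂ A (dxLeft φ t) r₂ :=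
          (le_max_left _ _).trans (le_max_right _ _)
        linarith
    · refine key r₁ hr₁ _ le_rfl hr₁' ?_ ?_
      · linarith [h₂.isQuasiConvex.dec_le (dxRight φ t)]
      · have : decPart H₂ p₂ (dxRight φ t) ≤ fluxFun H₁ H₂ p₁ p₂ A r₁ (dxRight φ t) :=
          (le_max_right _ _).trans (le_max_right _ _)
        linarith

/-- A single function is a family in the sense of `IsFluxSub.of_family`, so separated test functions
and pure kinks suffice. -/
lemma IsFluxSub.of_jetSub (h₁ : IsQuasiConvexHamiltonian H₁ p₁)
    (h₂ : IsQuasiConvexHamiltonian H₂ p₂) (hu : LocallyBdd u)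
    (hjet : ∀ t x, 0 < t → JetSub H₁ H₂ (fluxFun H₁ H₂ p₁ p₂ A) (upperEnv u) t x) :
    IsFluxSub H₁ H₂ p₁ p₂ A u := by
  refine IsFluxSub.of_family (𝓕 := {upperEnv u}) h₁ h₂ hu ?_ ?_ ?_ ?_
  · rintro w rfl t x ht; exact hu.upperSemicontinuousAt ht
  · rintro w rfl t x ht; exact hjet t x ht
  · rintro w rfl t x ht; exact le_rfl
  · intro t x ht ε hε
    have h := hu.frequently_lt ht.le (show upperEnv u t x - ε < upperEnv u t x by linarith)
    rw [nhdsWithin_domain ht] at h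
    refine (h.and_eventually (continuousAt_fst.eventually (lt_mem_nhds ht))).mono fun z hz => ?_
    exact ⟨_, rfl, hz.1.trans_le (hu.le_upperEnv (le_of_lt hz.2))⟩

lemma IsFluxSuper.of_jetSuper (h₁ : IsQuasiConvexHamiltonian H₁ p₁)
    (h₂ : IsQuasiConvexHamiltonian H₂ p₂) (hu : LocallyBdd u)
    (hjet : ∀ t x, 0 < t → JetSuper H₁ H₂ (fluxFun H₁ H₂ p₁ p₂ A) (lowerEnv u) t x) :
    IsFluxSuper H₁ H₂ p₁ p₂ A u := by
  refine ⟨hu, fun φ hφ t x ht hT => ?_⟩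
  have hpos : ∀ᶠ z : ℝ × ℝ in 𝓝 (t, x), 0 < z.1 :=
    continuousAt_fst.eventually (lt_mem_nhds ht)
  set w : ℝ → ℝ → ℝ := fun t x => -lowerEnv u t x with hw
  have hwE : w = upperEnv fun t x => -u t x := by
    funext t x; simp only [hw, lowerEnv_eq_neg, neg_neg]
  have hU : ∀ᶠ z in 𝓝 (t, x), ∀ w' ∈ ({w} : Set (ℝ → ℝ → ℝ)),
      UpperSemicontinuousAt (fun z : ℝ × ℝ => w' z.1 z.2) z := by
    filter_upwards [hpos] with z hz
    rintro w' rfl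
    rw [hwE]
    exact hu.neg.upperSemicontinuousAt (x := z.2) hz
  have happ : ∀ ε > 0, ∃ᶠ z in 𝓝 (t, x), ∃ w' ∈ ({w} : Set (ℝ → ℝ → ℝ)),
      w t x - ε < w' z.1 z.2 := fun ε hε => by
    have h : ∃ᶠ z in 𝓝 (t, x), z = (t, x) := fun h => h.self_of_nhds rfl
    refine h.mono ?_
    rintro _ rfl
    exact ⟨w, rfl, by simp only; linarith⟩
  have hsmooth : x ≠ 0 → ∀ δ > 0, ∀ᶠ z in 𝓝 (t, x), ∀ w' ∈ ({w} : Set (ℝ → ℝ → ℝ)), w' z.1 z.2 ≤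
      w t x + -dt φ t x * (z.1 - t) + kink (-dx φ t x) (-dx φ t x) (z.2 - x) +
        δ * (|z.1 - t| + |z.2 - x|) := fun hx δ hδ => by
    filter_upwards [hT.1, HJ.eventually_abs_sub_le (hφ.differentiableAt ht hx) hδ] with z k1 k2
    rintro w' rfl
    have := (abs_le.1 k2).1
    rw [← kink_neg, hw]
    simp only
    rw [hT.2]
    linarith
  refine ⟨fun hx => ?_, fun hx => ?_, ?_⟩
  · have := add_le_of_family (H := fun p => -H₁ (-p)) (by have := h₁.continuous; fun_prop) hU (by
      filter_upwards [hpos, continuousAt_snd.eventually (gt_mem_nhds hx)] with z k1 k2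
      rintro w' rfl
      exact (hjet z.1 z.2 k1).1 k2) (hsmooth hx.ne) happ
    rw [neg_neg] at this
    linarith
  · have := add_le_of_family (H := fun p => -H₂ (-p)) (by have := h₂.continuous; fun_prop) hU (by
      filter_upwards [hpos, continuousAt_snd.eventually (lt_mem_nhds hx)] with z k1 k2
      rintro w' rfl
      exact (hjet z.1 z.2 k1).2.1 k2) (hsmooth hx.ne') happ
    rw [neg_neg] at this
    linarith
  · rintro rfl
    by_contra hcon
    push Not at hcon
    -- These slopes leave the flux unchanged, and there `H₁` and `H₂` are at most the flux. A
    -- violated junction inequality therefore violates all three alternatives of the relaxed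
    -- condition.
    set q₁ := max (dxLeft φ t) p₁ with hq₁
    set q₂ := min (dxRight φ t) p₂ with hq₂
    have hflux : fluxFun H₁ H₂ p₁ p₂ A (dxLeft φ t) (dxRight φ t) =
        fluxFun H₁ H₂ p₁ p₂ A q₁ q₂ := by
      simp only [fluxFun, incPart_eq, decPart_eq, hq₁, hq₂, max_assoc, min_assoc, max_self,
        min_self]
    have hle1 : H₁ q₁ ≤ fluxFun H₁ H₂ p₁ p₂ A q₁ q₂ := by
      refine le_trans ?_ ((le_max_left _ _).trans (le_max_right _ _))
      rw [incPart_eq, max_eq_left (le_max_right _ _)]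
    have hle2 : H₂ q₂ ≤ fluxFun H₁ H₂ p₁ p₂ A q₁ q₂ := by
      refine le_trans ?_ ((le_max_right _ _).trans (le_max_right _ _))
      rw [decPart_eq, min_eq_left (min_le_right _ _)]
    rw [hflux] at hcon
    have hFc := continuous_fluxFun (p₁ := p₁) (p₂ := p₂) (A := A) h₁.continuous h₂.continuous
    refine not_pos_of_family (H₁ := fun p => -H₁ (-p)) (H₂ := fun p => -H₂ (-p))
      (F := fun q₁ q₂ => -fluxFun H₁ H₂ p₁ p₂ A (-q₁) (-q₂)) (l := -dt φ t 0) (q₁ := -q₁)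
      (q₂ := -q₂) (by have := h₁.continuous; fun_prop) (by have := h₂.continuous; fun_prop)
      (hFc.comp (f := fun q : ℝ × ℝ => (-q.1, -q.2)) (by fun_prop)).neg hU (by
        filter_upwards [hpos] with z k1
        rintro w' rfl
        exact hjet z.1 z.2 k1) (W₀ := w t 0) ?_ happ ?_ ?_ ?_
    · intro δ hδ
      filter_upwards [hT.1, hφ.eventually_abs_sub_le ht hδ] with z k1 k2
      rintro w' rfl
      have := (abs_le.1 k2).1
      have := kink_mono (neg_le_neg (le_max_left (dxLeft φ t) p₁))
        (neg_le_neg (min_le_left (dxRight φ t) p₂)) (z.2 - 0)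
      rw [← kink_neg] at this
      rw [hw]
      simp only
      rw [hT.2]
      linarith
    · rw [neg_neg]; linarith
    · rw [neg_neg]; linarith
    · rw [neg_neg, neg_neg]; linarith

/-- Ishii sub-solutions are flux-limited sub-solutions for the flux limiter `A_I^-`. -/
theorem IsIshiiSub.isFluxSub (h₁ : IsQuasiConvexHamiltonian H₁ p₁)
    (h₂ : IsQuasiConvexHamiltonian H₂ p₂) (h : IsIshiiSub H₁ H₂ u) :
    IsFluxSub H₁ H₂ p₁ p₂ (ishiiMinus H₁ H₂ p₁ p₂) u := by
  have hL : ∀ t x, 0 < t → x < 0 → ∀ l p, UJet (upperEnv u) t x l p → l + H₁ p ≤ 0 := by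
    intro t x ht hx l p hj
    obtain ⟨φ, hφ, ht', rfl, rfl⟩ := hj.exists_touchesAbove
    exact (h.2 φ hφ t x ht ht').1 hx
  have hR : ∀ t x, 0 < t → 0 < x → ∀ l p, UJet (upperEnv u) t x l p → l + H₂ p ≤ 0 := by
    intro t x ht hx l p hj
    obtain ⟨φ, hφ, ht', rfl, rfl⟩ := hj.exists_touchesAbove
    exact (h.2 φ hφ t x ht ht').2.1 hx
  refine IsFluxSub.of_jetSub h₁ h₂ h.1 fun t x ht => ⟨hL t x ht, hR t x ht, ?_⟩
  rintro rfl l q₁ q₂ hk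
  have hpos : ∀ᶠ z : ℝ × ℝ in 𝓝 (t, 0), 0 < z.1 :=
    continuousAt_fst.eventually (lt_mem_nhds ht)
  refine fluxFun_le_of_kink h₁.isQuasiConvex h₂.isQuasiConvex (h.1.eventually_usc ht)
    (hpos.mono fun z hz => hL _ _ hz) (hpos.mono fun z hz => hR _ _ hz) ?_ ?_ ?_ hk
  · intro p hj
    obtain ⟨φ, hφ, ht', rfl, rfl⟩ := hj.exists_touchesAbove
    exact (h.2 φ hφ t 0 ht ht').2.2 rfl
  · exact (h₁.coercive.eventually (eventually_gt_atTop (-l))).mono fun p hp => by linarith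
  · exact (h₂.coercive.eventually (eventually_gt_atTop (-l))).mono fun p hp => by linarith

/-- Ishii super-solutions are flux-limited super-solutions for the flux limiter `A_I^+`. -/
theorem IsIshiiSuper.isFluxSuper (h₁ : IsQuasiConvexHamiltonian H₁ p₁)
    (h₂ : IsQuasiConvexHamiltonian H₂ p₂) (h : IsIshiiSuper H₁ H₂ u) :
    IsFluxSuper H₁ H₂ p₁ p₂ (ishiiPlus H₁ H₂ p₁ p₂) u := by
  have hL : ∀ t x, 0 < t → x < 0 → ∀ l p, UJet (fun t x => -lowerEnv u t x) t x l p →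
      l + -H₁ (-p) ≤ 0 := by
    intro t x ht hx l p hj
    obtain ⟨φ, hφ, ht', k1, k2⟩ := hj.exists_touchesBelow
    have := (h.2 φ hφ t x ht ht').1 hx
    rw [k1, k2] at this; linarith
  have hR : ∀ t x, 0 < t → 0 < x → ∀ l p, UJet (fun t x => -lowerEnv u t x) t x l p →
      l + -H₂ (-p) ≤ 0 := by
    intro t x ht hx l p hj
    obtain ⟨φ, hφ, ht', k1, k2⟩ := hj.exists_touchesBelow
    have := (h.2 φ hφ t x ht ht').2.1 hx
    rw [k1, k2] at this; linarith
  refine IsFluxSuper.of_jetSuper h₁ h₂ h.1 fun t x ht => ⟨hL t x ht, hR t x ht, ?_⟩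
  rintro rfl l q₁ q₂ hk
  have hpos : ∀ᶠ z : ℝ × ℝ in 𝓝 (t, 0), 0 < z.1 :=
    continuousAt_fst.eventually (lt_mem_nhds ht)
  have := le_fluxFun_of_kink h₁.isQuasiConvex h₂.isQuasiConvex
    (by simpa only [lowerEnv_eq_neg, neg_neg] using h.1.neg.eventually_usc ht)
    (hpos.mono fun z hz => hL _ _ hz) (hpos.mono fun z hz => hR _ _ hz) (by
      intro p hj
      obtain ⟨φ, hφ, ht', k1, k2⟩ := hj.exists_touchesBelow
      have := (h.2 φ hφ t 0 ht ht').2.2 rfl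
      rw [k1, k2] at this
      linarith) hk
  linarith

end conversion

/-! ### Matching the slopes of a sub-solution and a super-solution -/

/-- The time penalty `|τ|^{3/2}`. -/
noncomputable def timePen (τ : ℝ) : ℝ := ‖τ‖ ^ (3 / 2 : ℝ)

lemma contDiff_timePen : ContDiff ℝ 1 timePen := contDiff_norm_rpow (by norm_num)

@[simp] lemma timePen_zero : timePen 0 = 0 := by
  simp [timePen, Real.zero_rpow (show (3 / 2 : ℝ) ≠ 0 by norm_num)]

lemma timePen_pos {τ : ℝ} (h : τ ≠ 0) : 0 < timePen τ :=
  Real.rpow_pos_of_pos (norm_pos_iff.2 h) _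

lemma timePen_nonneg (τ : ℝ) : 0 ≤ timePen τ := Real.rpow_nonneg (norm_nonneg _) _

@[simp] lemma deriv_timePen_zero : deriv timePen 0 = 0 := by
  have h : IsLocalMin timePen 0 := Eventually.of_forall fun τ => by simp [timePen_nonneg]
  exact h.deriv_eq_zero

lemma timePen_eq (τ : ℝ) : timePen τ = |τ| * √|τ| := by
  rw [timePen, Real.norm_eq_abs, Real.sqrt_eq_rpow, show (3 / 2 : ℝ) = 1 + 1 / 2 by norm_num,
    Real.rpow_one_add' (abs_nonneg _) (by norm_num)]

lemma mul_sq_le_timePen {N τ : ℝ} (hN : 0 < N) (h : |τ| ≤ (1 / N) ^ 2) :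
    N * (|τ| * |τ|) ≤ timePen τ := by
  rw [timePen_eq]
  have h1 : √|τ| ≤ 1 / N := Real.sqrt_le_iff.2 ⟨by positivity, h⟩
  have h2 : N * √|τ| ≤ 1 := by
    rw [le_div_iff₀ hN] at h1; linarith
  have h3 : |τ| = √|τ| * √|τ| := (Real.mul_self_sqrt (abs_nonneg _)).symm
  calc N * (|τ| * |τ|) = |τ| * (N * √|τ|) * √|τ| := by nth_rw 2 [h3]; ring
    _ ≤ |τ| * 1 * √|τ| := by gcongr
    _ = |τ| * √|τ| := by ring

/-- The exponent `3/2` exceeds `1`, which makes the penalty `C¹` with zero derivative at `0`. It is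
below `2`, so near `0` the penalty absorbs the cross term of the doubled times for any `N`. -/
lemma mul_mul_le_timePen {N τ σ : ℝ} (hN : 0 < N) (hτ : |τ| ≤ (1 / N) ^ 2)
    (hσ : |σ| ≤ (1 / N) ^ 2) : N * |τ| * |σ| ≤ timePen τ + timePen σ := by
  have h1 := mul_sq_le_timePen hN hτ
  have h2 := mul_sq_le_timePen hN hσ
  have h3 := timePen_nonneg τ
  have h4 := timePen_nonneg σ
  rcases le_total |τ| |σ| with h | h
  · have : N * |τ| * |σ| ≤ N * |σ| * |σ| := by gcongr
    linarith
  · have : N * |τ| * |σ| ≤ N * |τ| * |τ| := by gcongr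
    linarith

/-- To the right of `x₀`, the line of slope `p` lies above `u`, up to functions of time. -/
def RightAbove (u : ℝ → ℝ → ℝ) (ψ : ℝ → ℝ) (t₀ x₀ p : ℝ) : Prop :=
  ∀ᶠ z in 𝓝 (t₀, x₀), x₀ ≤ z.2 → u z.1 z.2 ≤ ψ z.1 + timePen (z.1 - t₀) + p * (z.2 - x₀)

lemma RightAbove.mono {u : ℝ → ℝ → ℝ} {ψ : ℝ → ℝ} {t₀ x₀ p q : ℝ}
    (h : RightAbove u ψ t₀ x₀ p) (hpq : p ≤ q) : RightAbove u ψ t₀ x₀ q := by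
  filter_upwards [h] with z hz hx
  have := hz hx
  nlinarith

section oneSided

variable {u v : ℝ → ℝ → ℝ} {ψ χ : ℝ → ℝ} {t₀ s₀ x₀ N : ℝ}

lemma usc_sub_of_contDiff {a : ℝ → ℝ} (ha : ContDiff ℝ 1 a) (p : ℝ) {S : Set (ℝ × ℝ)}
    (hu : ∀ z ∈ S, UpperSemicontinuousAt (fun z : ℝ × ℝ => u z.1 z.2) z) :
    UpperSemicontinuousOn (fun z : ℝ × ℝ => u z.1 z.2 + (-a z.1 - p * (z.2 - x₀))) S := by
  intro z hz
  have hac := ha.continuous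
  have h3 : Continuous fun z : ℝ × ℝ => -a z.1 - p * (z.2 - x₀) := by fun_prop
  exact UpperSemicontinuousWithinAt.add
    (UpperSemicontinuousAt.upperSemicontinuousWithinAt _ (hu z hz))
    h3.continuousAt.continuousWithinAt.upperSemicontinuousWithinAt

lemma contDiff_add_timePen (hψ : ContDiff ℝ 1 ψ) (t₀ : ℝ) :
    ContDiff ℝ 1 fun t => ψ t + timePen (t - t₀) :=
  hψ.add (contDiff_timePen.comp (contDiff_id.sub contDiff_const))

lemma deriv_add_timePen (hψ : ContDiff ℝ 1 ψ) (t₀ : ℝ) :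
    deriv (fun t => ψ t + timePen (t - t₀)) t₀ = deriv ψ t₀ := by
  have h1 : HasDerivAt timePen 0 (t₀ - t₀) := by
    have := (contDiff_timePen.differentiable one_ne_zero (t₀ - t₀)).hasDerivAt
    rwa [show deriv timePen (t₀ - t₀) = 0 by simp] at this
  have h2 := (hψ.differentiable one_ne_zero t₀).hasDerivAt.add
    (h1.comp (h := fun t => t - t₀) t₀ ((hasDerivAt_id t₀).sub_const t₀))
  exact (h2.congr_deriv (by simp)).deriv

/-- Data for the box arguments below: a time step `τ` and a space step `X₀`. -/
lemma exists_box_data (hψ : ContDiff ℝ 1 ψ)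
    (husc : ∀ᶠ z in 𝓝 (t₀, x₀), UpperSemicontinuousAt (fun z : ℝ × ℝ => u z.1 z.2) z)
    (hu0 : ∀ᶠ t in 𝓝 t₀, u t x₀ ≤ ψ t) {ε : ℝ} (hε : 0 < ε) (p : ℝ) :
    ∃ τ > 0, ∃ X > 0, τ < ε ∧ X < ε ∧
      (∀ t ∈ Icc (t₀ - τ) (t₀ + τ), |deriv (fun t => ψ t + timePen (t - t₀)) t - deriv ψ t₀| < ε) ∧
      (∀ t ∈ Icc (t₀ - τ) (t₀ + τ), u t x₀ ≤ ψ t) ∧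
      (∀ z ∈ Icc (t₀ - τ) (t₀ + τ) ×ˢ Icc x₀ (x₀ + X),
        UpperSemicontinuousAt (fun z : ℝ × ℝ => u z.1 z.2) z) ∧
      ∀ t, (t = t₀ - τ ∨ t = t₀ + τ) → ∀ x ∈ Icc x₀ (x₀ + X),
        u t x ≤ ψ t + timePen (t - t₀) + min p 0 * (x - x₀) := by
  have hc := ((contDiff_add_timePen hψ t₀).continuous_deriv le_rfl).continuousAt (x := t₀)
  have hd := deriv_add_timePen hψ t₀
  obtain ⟨r₁, hr₁, e1⟩ := Metric.eventually_nhds_iff.1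
    ((hc.eventually (Metric.ball_mem_nhds _ hε)).and hu0)
  obtain ⟨r₂, hr₂, e2⟩ := eventually_nhds_prod.1 husc
  obtain ⟨τ, hτ, hτ'⟩ := exists_between (lt_min (lt_min hr₁ hr₂) hε)
  simp only [lt_min_iff] at hτ'
  have hmem : ∀ t ∈ Icc (t₀ - τ) (t₀ + τ), |t - t₀| ≤ τ := fun t ht => by
    rw [abs_le]; constructor <;> linarith [ht.1, ht.2]
  -- At these two times `timePen` is strictly positive, and upper semi-continuity carries the strict
  -- inequality from `x₀` to nearby `x`.
  have hside : ∀ t, (t = t₀ - τ ∨ t = t₀ + τ) → ∀ᶠ x in 𝓝 x₀, x₀ ≤ x →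
      u t x ≤ ψ t + timePen (t - t₀) + min p 0 * (x - x₀) := by
    intro t ht
    have htm : t ∈ Icc (t₀ - τ) (t₀ + τ) := by
      rcases ht with rfl | rfl <;> constructor <;> linarith
    have hθ : 0 < timePen (t - t₀) := timePen_pos (by rcases ht with rfl | rfl <;> simp [hτ.ne'])
    have h1 := (e1 ((hmem t htm).trans_lt hτ'.1.1)).2
    have h2 := e2 t x₀ ((hmem t htm).trans_lt hτ'.1.2) (by simpa using hr₂)
    have h3 := h2 (ψ t + timePen (t - t₀) / 2) (by simp only; linarith)
    have h4 : Tendsto (fun x : ℝ => (t, x)) (𝓝 x₀) (𝓝 (t, x₀)) :=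
      (Continuous.tendsto (by fun_prop) x₀)
    have h5 : ∀ᶠ x in 𝓝 x₀, -(timePen (t - t₀) / 2) < min p 0 * (x - x₀) := by
      have : ContinuousAt (fun x => min p 0 * (x - x₀)) x₀ := by fun_prop
      exact this.eventually (lt_mem_nhds (by simp; linarith))
    filter_upwards [h4.eventually h3, h5] with x k1 k2 _
    linarith
  obtain ⟨r₃, hr₃, e3⟩ := Metric.eventually_nhds_iff.1 ((hside _ (Or.inl rfl)).and
    (hside _ (Or.inr rfl)))
  obtain ⟨X, hX, hX'⟩ := exists_between (lt_min (lt_min hr₂ hr₃) hε)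
  simp only [lt_min_iff] at hX'
  have hmemX : ∀ x ∈ Icc x₀ (x₀ + X), |x - x₀| ≤ X := fun x hx => by
    rw [abs_le]; constructor <;> linarith [hx.1, hx.2]
  refine ⟨τ, hτ, X, hX, hτ'.2, hX'.2, fun t ht => ?_, fun t ht => ?_, fun z hz => ?_, ?_⟩
  · have := (e1 ((hmem t ht).trans_lt hτ'.1.1)).1
    rwa [Real.dist_eq, hd] at this
  · exact (e1 ((hmem t ht).trans_lt hτ'.1.1)).2
  · exact e2 z.1 z.2 ((hmem _ hz.1).trans_lt hτ'.1.2) ((hmemX _ hz.2).trans_lt hX'.1.1)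
  · rintro t ht x hx
    have := e3 ((hmemX x hx).trans_lt hX'.1.2)
    rcases ht with rfl | rfl
    · exact this.1 hx.1
    · exact this.2 hx.1

/-- If slopes on the right are coercively controlled, some line lies above. -/
lemma exists_rightAbove {G : ℝ → ℝ} (hψ : ContDiff ℝ 1 ψ)
    (husc : ∀ᶠ z in 𝓝 (t₀, x₀), UpperSemicontinuousAt (fun z : ℝ × ℝ => u z.1 z.2) z)
    (hu0 : ∀ᶠ t in 𝓝 t₀, u t x₀ ≤ ψ t)
    (hjet : ∀ᶠ z in 𝓝 (t₀, x₀), x₀ < z.2 → ∀ l p, UJet u z.1 z.2 l p → l + G p ≤ 0)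
    (hG : ∃ δ > 0, ∀ᶠ p in atTop, δ < deriv ψ t₀ + G p) : ∃ p, RightAbove u ψ t₀ x₀ p := by
  obtain ⟨δ, hδ, hG⟩ := hG
  obtain ⟨r, hr, hr'⟩ := eventually_nhds_prod.1 hjet
  obtain ⟨τ, hτ, X, hX, hτr, hXr, h1, h2, h3, h4⟩ :=
    exists_box_data hψ husc hu0 (lt_min hr hδ) 0
  rw [lt_min_iff] at hτr hXr
  have hθ := contDiff_add_timePen hψ t₀
  obtain ⟨M, hM0, hM⟩ := exists_bound_of_usc (isCompact_Icc.prod isCompact_Icc)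
    (usc_sub_of_contDiff (x₀ := x₀) hθ 0 h3)
  -- Such a steep line is above `u` on the sides of the box by `M ≤ p * X`, and coercivity prevents
  -- contact inside.
  obtain ⟨p, hpG, hpM⟩ := (hG.and (eventually_ge_atTop (M / X))).exists
  have hp0 : 0 ≤ p := le_trans (by positivity) hpM
  have hpX : M ≤ p * X := (div_le_iff₀ hX).1 hpM
  refine ⟨p, ?_⟩
  have key : ∀ t ∈ Icc (t₀ - τ) (t₀ + τ), ∀ x ∈ Icc x₀ (x₀ + X),
      u t x ≤ ψ t + timePen (t - t₀) + p * (x - x₀) := by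
    intro t' ht' x' hx'
    by_contra hcon
    push Not at hcon
    obtain ⟨t, ht, x, hx, hmax, -⟩ := exists_isLocalMax_of_box
      (usc_sub_of_contDiff (x₀ := x₀) hθ p h3) (by
        intro t ht x hx hor
        have hpx : 0 ≤ p * (x - x₀) := mul_nonneg hp0 (by linarith [hx.1])
        simp only
        rcases or_assoc.2 hor with hor | rfl | rfl
        · have := h4 t hor x hx
          rw [min_self, zero_mul] at this
          linarith
        · have := h2 t ht
          have := timePen_nonneg (t - t₀)
          rw [sub_self, mul_zero]
          linarith
        · have := hM (t, x₀ + X) ⟨ht, hx⟩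
          rw [show x₀ + X - x₀ = X by ring]
          simp only at this
          linarith) ht' hx' (by simp only; linarith)
    have hj : UJet u t x (deriv (fun t => ψ t + timePen (t - t₀)) t) p := by
      refine UKink.ujet ⟨_, hθ, rfl, ?_⟩
      filter_upwards [hmax] with z hz
      simp only [kink_self] at hz ⊢
      rw [sub_self, mul_zero]
      linarith
    have k1 := hr' t x (by rw [abs_lt]; constructor <;> linarith [ht.1, ht.2])
      (by rw [abs_lt]; constructor <;> linarith [hx.1, hx.2]) hx.1 _ _ hj
    have k2 := (abs_lt.1 (h1 t (Ioo_subset_Icc_self ht))).1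
    have k3 := min_le_right r δ
    linarith
  filter_upwards [prod_mem_nhds (Icc_mem_nhds (show t₀ - τ < t₀ by linarith)
    (show t₀ < t₀ + τ by linarith)) (Iic_mem_nhds (show x₀ < x₀ + X by linarith))] with z hz hx
  exact key z.1 hz.1 z.2 ⟨hx, hz.2⟩

/-- If `u + v` is locally bounded from above as below, and neither the slope `p` for `u` nor the
slope `-q` for `v` is admissible, with `q < p`, then `u` has nearby jets with any slope in
between. -/
lemma exists_ujet_between (hψ : ContDiff ℝ 1 ψ)
    (husc : ∀ᶠ z in 𝓝 (t₀, x₀), UpperSemicontinuousAt (fun z : ℝ × ℝ => u z.1 z.2) z)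
    (hu0 : ∀ᶠ t in 𝓝 t₀, u t x₀ ≤ ψ t) (hv0 : ∀ᶠ s in 𝓝 s₀, v s x₀ ≤ χ s) (hN : 0 < N)
    {r : ℝ} (hr : 0 < r)
    (huv : ∀ t s x, |t - t₀| < r → |s - s₀| < r → x₀ ≤ x → x < x₀ + r →
      u t x + v s x ≤ ψ t + χ s + N * |t - t₀| * |s - s₀|)
    {p q p' : ℝ} (hp : ¬ RightAbove u ψ t₀ x₀ p) (hq : ¬ RightAbove v χ s₀ x₀ (-q))
    (hqp : q < p') (hpp : p' < p) {ε : ℝ} (hε : 0 < ε) :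
    ∃ t x l, |t - t₀| < ε ∧ x₀ < x ∧ x < x₀ + ε ∧ |l - deriv ψ t₀| < ε ∧ UJet u t x l p' := by
  have hN2 : 0 < (1 / N) ^ 2 := by positivity
  obtain ⟨τ, hτ, X, hX, hτr, hXr, h1, h2, h3, h4⟩ :=
    exists_box_data hψ husc hu0 (lt_min (lt_min hr hN2) hε) p'
  simp only [lt_min_iff] at hτr hXr h1
  have hθ := contDiff_add_timePen hψ t₀
  obtain ⟨r', hr', hv0'⟩ := Metric.eventually_nhds_iff.1 hv0
  -- Where `v` exceeds its line of slope `-q`, the bound on `u + v` pushes `u` below the line of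
  -- slope `q` along the whole side `x = x₁` of the box.
  obtain ⟨⟨s₁, x₁⟩, hs₁, ⟨hs₁', hx₁'⟩⟩ := ((not_eventually.1 hq).and_eventually
    (prod_mem_nhds (Metric.ball_mem_nhds s₀ (lt_min (lt_min hr hN2) hr'))
      (Iio_mem_nhds (show x₀ < x₀ + X by linarith)))).exists
  push Not at hs₁
  simp only [Metric.mem_ball, Real.dist_eq, lt_min_iff, mem_Iio] at hs₁ hs₁' hx₁'
  obtain ⟨hx₁, hs₁⟩ := hs₁
  have hx₁0 : x₀ < x₁ := by
    refine lt_of_le_of_ne hx₁ fun h => ?_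
    subst h
    have := hv0' (Real.dist_eq s₁ s₀ ▸ hs₁'.2)
    have := timePen_nonneg (s₁ - s₀)
    rw [sub_self, mul_zero] at hs₁
    linarith
  -- Between `x₀` and `x₁` the function `u` exceeds the line of slope `p > p'`, so subtracting the
  -- line of slope `p'` leaves a positive interior maximum.
  obtain ⟨⟨t₂, x₂⟩, ht₂, ⟨ht₂', hx₂'⟩⟩ := ((not_eventually.1 hp).and_eventually
    (prod_mem_nhds (Icc_mem_nhds (show t₀ - τ < t₀ by linarith) (show t₀ < t₀ + τ by linarith))
      (Iio_mem_nhds hx₁0))).exists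
  push Not at ht₂
  simp only [mem_Iio] at ht₂ ht₂' hx₂'
  obtain ⟨hx₂, ht₂⟩ := ht₂
  have hsub : Icc x₀ x₁ ⊆ Icc x₀ (x₀ + X) := Icc_subset_Icc_right hx₁'.le
  obtain ⟨t, ht, x, hx, hmax, -⟩ := exists_isLocalMax_of_box
    (usc_sub_of_contDiff (x₀ := x₀) (S := Icc (t₀ - τ) (t₀ + τ) ×ˢ Icc x₀ x₁) hθ p'
      fun z hz => h3 z ⟨hz.1, hsub hz.2⟩) (by
      intro t ht x hx hor
      simp only
      rcases or_assoc.2 hor with hor | rfl | rfl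
      · have k1 := h4 t hor x (hsub hx)
        have k2 : min p' 0 * (x - x₀) ≤ p' * (x - x₀) :=
          mul_le_mul_of_nonneg_right (min_le_left _ _) (by linarith [hx.1])
        linarith
      · have := h2 t ht
        have := timePen_nonneg (t - t₀)
        rw [sub_self, mul_zero]
        linarith
      · have ht0 : |t - t₀| ≤ τ := by rw [abs_le]; constructor <;> linarith [ht.1, ht.2]
        have k1 := huv t s₁ x (by linarith) hs₁'.1.1 hx.1 (by linarith)
        have k2 := mul_mul_le_timePen hN (τ := t - t₀) (σ := s₁ - s₀) (by linarith)
          hs₁'.1.2.le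
        have k3 : 0 < (p' - q) * (x - x₀) := mul_pos (by linarith) (by linarith)
        have k4 : (p' - q) * (x - x₀) = p' * (x - x₀) + -q * (x - x₀) := by ring
        linarith) ht₂' ⟨hx₂, hx₂'.le⟩ (by
      simp only
      have k3 : 0 ≤ (p - p') * (x₂ - x₀) := mul_nonneg (by linarith) (by linarith)
      linarith)
  refine ⟨t, x, deriv (fun t => ψ t + timePen (t - t₀)) t, ?_, hx.1, by linarith [hx.2],
    (h1 t (Ioo_subset_Icc_self ht)).2, UKink.ujet ⟨_, hθ, rfl, ?_⟩⟩
  · rw [abs_lt]; constructor <;> linarith [ht.1, ht.2]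
  · filter_upwards [hmax] with z hz
    simp only [kink_self] at hz ⊢
    rw [sub_self, mul_zero]
    linarith

/-- Only the time derivatives vary along the approximation; the slope is exactly `p`, so `G` need
not be continuous. -/
lemma add_le_of_nearby_jets {G : ℝ → ℝ} {l p : ℝ}
    (hjet : ∀ᶠ z in 𝓝 (t₀, x₀), x₀ < z.2 → ∀ l p, UJet u z.1 z.2 l p → l + G p ≤ 0)
    (hex : ∀ ε > 0, ∃ t x l', |t - t₀| < ε ∧ x₀ < x ∧ x < x₀ + ε ∧ |l' - l| < ε ∧
      UJet u t x l' p) : l + G p ≤ 0 := by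
  obtain ⟨r, hr, hr'⟩ := eventually_nhds_prod.1 hjet
  refine le_of_forall_pos_le_add fun ε hε => ?_
  obtain ⟨t, x, l', ht, hx, hx', hl, hj⟩ := hex (min r ε) (lt_min hr hε)
  rw [lt_min_iff] at ht hl
  have k1 := hr' t x ht.1
    (by rw [abs_lt]; constructor <;> linarith [min_le_left r ε]) hx _ _ hj
  have k2 := (abs_lt.1 hl.2).1
  linarith

/-- Either the slope `p` is admissible for `u` or the slope `-q` is admissible for `v`. -/
lemma rightAbove_or {G G' : ℝ → ℝ} (hψ : ContDiff ℝ 1 ψ) (hχ : ContDiff ℝ 1 χ)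
    (husc : ∀ᶠ z in 𝓝 (t₀, x₀), UpperSemicontinuousAt (fun z : ℝ × ℝ => u z.1 z.2) z)
    (hvsc : ∀ᶠ z in 𝓝 (s₀, x₀), UpperSemicontinuousAt (fun z : ℝ × ℝ => v z.1 z.2) z)
    (hu0 : ∀ᶠ t in 𝓝 t₀, u t x₀ ≤ ψ t) (hv0 : ∀ᶠ s in 𝓝 s₀, v s x₀ ≤ χ s) (hN : 0 < N)
    {r : ℝ} (hr : 0 < r)
    (huv : ∀ t s x, |t - t₀| < r → |s - s₀| < r → x₀ ≤ x → x < x₀ + r →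
      u t x + v s x ≤ ψ t + χ s + N * |t - t₀| * |s - s₀|)
    (hju : ∀ᶠ z in 𝓝 (t₀, x₀), x₀ < z.2 → ∀ l p, UJet u z.1 z.2 l p → l + G p ≤ 0)
    (hjv : ∀ᶠ z in 𝓝 (s₀, x₀), x₀ < z.2 → ∀ l p, UJet v z.1 z.2 l p → l + G' p ≤ 0)
    (hcon : ∀ p, deriv ψ t₀ + G p ≤ 0 → deriv χ s₀ + G' (-p) ≤ 0 → False)
    {p q : ℝ} (hqp : q < p) : RightAbove u ψ t₀ x₀ p ∨ RightAbove v χ s₀ x₀ (-q) := by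
  by_contra h
  push Not at h
  obtain ⟨p', h1, h2⟩ := exists_between hqp
  refine hcon p' (add_le_of_nearby_jets hju fun ε hε => ?_)
    (add_le_of_nearby_jets hjv fun ε hε => ?_)
  · exact exists_ujet_between hψ husc hu0 hv0 hN hr huv h.1 h.2 h1 h2 hε
  · refine exists_ujet_between hχ hvsc hv0 hu0 hN hr (fun s t x hs ht hx hx' => ?_) h.2
      (q := -p) (by rw [neg_neg]; exact h.1) (neg_lt_neg h2) (neg_lt_neg h1) hε
    have := huv t s x ht hs hx hx'
    have e : N * |s - s₀| * |t - t₀| = N * |t - t₀| * |s - s₀| := by ring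
    linarith

end oneSided

section twoSided

variable {u v : ℝ → ℝ → ℝ} {ψ χ : ℝ → ℝ} {t₀ s₀ x₀ N : ℝ}

lemma RightAbove.ukink {p₁ p₂ : ℝ} (hψ : ContDiff ℝ 1 ψ) (h0 : ψ t₀ = u t₀ x₀)
    (hR : RightAbove u ψ t₀ x₀ p₂) (hL : RightAbove (fun t x => u t (-x)) ψ t₀ (-x₀) (-p₁)) :
    UKink u t₀ x₀ (deriv ψ t₀) p₁ p₂ := by
  rw [← deriv_add_timePen hψ t₀]
  refine UKink.of_touch (contDiff_add_timePen hψ t₀) (by simp [h0]) ?_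
  have hL' := eventually_reflect hL
  rw [neg_neg] at hL'
  filter_upwards [hR, hL'] with z k1 k2
  rcases le_total z.2 x₀ with h | h
  · rw [kink_of_nonpos (by linarith)]
    have := k2 (by linarith)
    simp only [neg_neg] at this
    linarith
  · rw [kink_of_nonneg (by linarith)]
    exact k1 h

/-- There cannot be a strict sub-solution `u` and a super-solution `-v` such that `u + v` is
bounded from above near a point as in the doubling of the time variable. -/
lemma false_of_doubling {KL KR KL' KR' : ℝ → ℝ} {F F' : ℝ → ℝ → ℝ} (hψ : ContDiff ℝ 1 ψ)
    (hχ : ContDiff ℝ 1 χ)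
    (husc : ∀ᶠ z in 𝓝 (t₀, x₀), UpperSemicontinuousAt (fun z : ℝ × ℝ => u z.1 z.2) z)
    (hvsc : ∀ᶠ z in 𝓝 (s₀, x₀), UpperSemicontinuousAt (fun z : ℝ × ℝ => v z.1 z.2) z)
    (hψ0 : ψ t₀ = u t₀ x₀) (hχ0 : χ s₀ = v s₀ x₀)
    (hu0 : ∀ᶠ t in 𝓝 t₀, u t x₀ ≤ ψ t) (hv0 : ∀ᶠ s in 𝓝 s₀, v s x₀ ≤ χ s) (hN : 0 < N)
    {r : ℝ} (hr : 0 < r)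
    (huv : ∀ t s x, |t - t₀| < r → |s - s₀| < r → |x - x₀| < r →
      u t x + v s x ≤ ψ t + χ s + N * |t - t₀| * |s - s₀|)
    (hjuL : ∀ᶠ z in 𝓝 (t₀, x₀), z.2 < x₀ → ∀ l p, UJet u z.1 z.2 l p → l + KL p ≤ 0)
    (hjuR : ∀ᶠ z in 𝓝 (t₀, x₀), x₀ < z.2 → ∀ l p, UJet u z.1 z.2 l p → l + KR p ≤ 0)
    (hjvL : ∀ᶠ z in 𝓝 (s₀, x₀), z.2 < x₀ → ∀ l p, UJet v z.1 z.2 l p → l + KL' p ≤ 0)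
    (hjvR : ∀ᶠ z in 𝓝 (s₀, x₀), x₀ < z.2 → ∀ l p, UJet v z.1 z.2 l p → l + KR' p ≤ 0)
    (hku : ∀ q₁ q₂, UKink u t₀ x₀ (deriv ψ t₀) q₁ q₂ → deriv ψ t₀ + F q₁ q₂ ≤ 0)
    (hkv : ∀ q₁ q₂, UKink v s₀ x₀ (deriv χ s₀) q₁ q₂ → deriv χ s₀ + F' q₁ q₂ ≤ 0)
    (hF : Continuous fun q : ℝ × ℝ => F q.1 q.2) (hF' : Continuous fun q : ℝ × ℝ => F' q.1 q.2)
    (hconL : ∀ p, deriv ψ t₀ + KL p ≤ 0 → deriv χ s₀ + KL' (-p) ≤ 0 → False)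
    (hconR : ∀ p, deriv ψ t₀ + KR p ≤ 0 → deriv χ s₀ + KR' (-p) ≤ 0 → False)
    (hconF : ∀ q₁ q₂, deriv ψ t₀ + F q₁ q₂ ≤ 0 → deriv χ s₀ + F' (-q₁) (-q₂) ≤ 0 → False)
    (hcoL : ∃ δ > 0, ∀ᶠ p in atBot, δ < deriv ψ t₀ + KL p)
    (hcoR : ∃ δ > 0, ∀ᶠ p in atTop, δ < deriv ψ t₀ + KR p)
    (hcoF₁ : ∀ q₂, ∃ q₁, 0 < deriv ψ t₀ + F q₁ q₂)
    (hcoF₂ : ∀ q₁, ∃ q₂, 0 < deriv ψ t₀ + F q₁ q₂) : False := by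
  set u' : ℝ → ℝ → ℝ := fun t x => u t (-x) with hu'
  set v' : ℝ → ℝ → ℝ := fun t x => v t (-x) with hv'
  have hrefl : ∀ {w : ℝ → ℝ → ℝ} {G : ℝ → ℝ} {t : ℝ},
      (∀ᶠ z in 𝓝 (t, x₀), z.2 < x₀ → ∀ l p, UJet w z.1 z.2 l p → l + G p ≤ 0) →
      ∀ᶠ z in 𝓝 (t, -x₀), -x₀ < z.2 → ∀ l p, UJet (fun t x => w t (-x)) z.1 z.2 l p →
        l + G (-p) ≤ 0 := by
    intro w G t h
    filter_upwards [eventually_reflect h] with z hz hx l p hj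
    have := hj.reflect
    simp only [neg_neg] at this
    exact hz (by linarith) _ _ this
  have hR : ∀ {p q}, q < p → RightAbove u ψ t₀ x₀ p ∨ RightAbove v χ s₀ x₀ (-q) := fun hqp =>
    rightAbove_or hψ hχ husc hvsc hu0 hv0 hN hr (fun t s x ht hs hx hx' => huv t s x ht hs
      (by rw [abs_lt]; constructor <;> linarith)) hjuR hjvR hconR hqp
  have hL : ∀ {p q}, q < p → RightAbove u' ψ t₀ (-x₀) p ∨ RightAbove v' χ s₀ (-x₀) (-q) :=
    fun hqp => rightAbove_or (G := fun p => KL (-p)) (G' := fun p => KL' (-p)) hψ hχ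
      (usc_reflect husc) (usc_reflect hvsc) (by simpa [hu'] using hu0) (by simpa [hv'] using hv0)
      hN hr (fun t s x ht hs hx hx' => huv t s (-x) ht hs
        (by rw [abs_lt]; constructor <;> linarith)) (hrefl hjuL) (hrefl hjvL)
      (fun p h1 h2 => hconL (-p) h1 h2) hqp
  obtain ⟨pR, hpR⟩ := exists_rightAbove hψ husc hu0 hjuR hcoR
  obtain ⟨pL, hpL⟩ := exists_rightAbove (G := fun p => KL (-p)) hψ (usc_reflect husc)
    (by simpa [hu'] using hu0) (hrefl hjuL) (by
      obtain ⟨δ, hδ, h⟩ := hcoL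
      exact ⟨δ, hδ, tendsto_neg_atTop_atBot.eventually h⟩)
  -- A very negative admissible slope on the right, paired with the admissible left slope `-pL`,
  -- would contradict the coercivity of `F`.
  have hbddR : BddBelow {p | RightAbove u ψ t₀ x₀ p} := by
    obtain ⟨b, hb⟩ := hcoF₂ (-pL)
    refine ⟨b, fun p hp => ?_⟩
    by_contra hpb
    push Not at hpb
    have := hku (-pL) b ((hp.mono hpb.le).ukink hψ hψ0 (by simpa using hpL))
    linarith
  have hbddL : BddBelow {p | RightAbove u' ψ t₀ (-x₀) p} := by
    obtain ⟨b, hb⟩ := hcoF₁ pR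
    refine ⟨-b, fun p hp => ?_⟩
    by_contra hpb
    push Not at hpb
    have := hku b pR (hpR.ukink hψ hψ0 (hp.mono hpb.le))
    linarith
  have hinf : ∀ {w : ℝ → ℝ → ℝ} {y : ℝ}, BddBelow {p | RightAbove w ψ t₀ y p} →
      {p | RightAbove w ψ t₀ y p}.Nonempty → ∀ ε > 0,
      RightAbove w ψ t₀ y (sInf {p | RightAbove w ψ t₀ y p} + ε) ∧
      ¬ RightAbove w ψ t₀ y (sInf {p | RightAbove w ψ t₀ y p} - ε / 2) := by
    intro w y hb hne ε hε
    refine ⟨?_, fun h => ?_⟩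
    · obtain ⟨p, hp, hlt⟩ := exists_lt_of_csInf_lt hne
        (show sInf {p | RightAbove w ψ t₀ y p} < sInf {p | RightAbove w ψ t₀ y p} + ε by linarith)
      exact RightAbove.mono hp hlt.le
    · have := csInf_le hb h
      linarith
  -- Critical slopes. Slopes just above them are admissible for `u`; just below they are not, and by
  -- `rightAbove_or` the opposite slopes are admissible for `v`. So one kink and its opposite serve
  -- `u` and `v`, up to `ε`.
  set cR := sInf {p | RightAbove u ψ t₀ x₀ p}
  set cL := sInf {p | RightAbove u' ψ t₀ (-x₀) p}
  have hku' : ∀ ε > 0, deriv ψ t₀ + F (-cL - ε) (cR + ε) ≤ 0 := fun ε hε =>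
    hku _ _ ((hinf hbddR ⟨pR, hpR⟩ ε hε).1.ukink hψ hψ0 (by
      rw [show -(-cL - ε) = cL + ε by ring]
      exact (hinf hbddL ⟨pL, hpL⟩ ε hε).1))
  have hkv' : ∀ ε > 0, deriv χ s₀ + F' (cL - ε) (-cR + ε) ≤ 0 := fun ε hε => by
    refine hkv _ _ (RightAbove.ukink hχ hχ0 ?_ ?_)
    · rw [show -cR + ε = -(cR - ε) by ring]
      exact (hR (show cR - ε < cR - ε / 2 by linarith)).resolve_left
        (hinf hbddR ⟨pR, hpR⟩ ε hε).2
    · exact (hL (show cL - ε < cL - ε / 2 by linarith)).resolve_left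
        (hinf hbddL ⟨pL, hpL⟩ ε hε).2
  have hlim : ∀ {F : ℝ → ℝ → ℝ} {l a b : ℝ}, Continuous (fun q : ℝ × ℝ => F q.1 q.2) →
      (∀ ε > 0, l + F (a - ε) (b + ε) ≤ 0) → l + F a b ≤ 0 := by
    intro F l a b hF h
    have hc : Continuous fun ε : ℝ => l + F (a - ε) (b + ε) :=
      continuous_const.add (hF.comp (f := fun ε : ℝ => (a - ε, b + ε)) (by fun_prop))
    have ht : Tendsto (fun ε : ℝ => l + F (a - ε) (b + ε)) (𝓝[>] 0) (𝓝 (l + F a b)) := by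
      have := hc.tendsto 0
      simp only [sub_zero, add_zero] at this
      exact this.mono_left nhdsWithin_le_nhds
    exact le_of_tendsto ht (eventually_nhdsWithin_of_forall fun ε hε => h ε hε)
  exact hconF (-cL) cR (hlim hF hku') (by simpa using hlim hF' hkv')

end twoSided

/-! ### A priori estimates -/

/-- A smooth convex function that behaves like `|x|`. -/
noncomputable def softAbs (x : ℝ) : ℝ := √(1 + x ^ 2) - 1

lemma one_le_sqrt (x : ℝ) : 1 ≤ √(1 + x ^ 2) :=
  Real.one_le_sqrt.2 (by linarith [sq_nonneg x])

lemma contDiff_softAbs : ContDiff ℝ 1 softAbs := by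
  unfold softAbs
  exact (ContDiff.sqrt (by fun_prop) fun x => by positivity).sub contDiff_const

@[simp] lemma softAbs_zero : softAbs 0 = 0 := by simp [softAbs]

lemma softAbs_neg (x : ℝ) : softAbs (-x) = softAbs x := by simp [softAbs]

lemma softAbs_nonneg (x : ℝ) : 0 ≤ softAbs x := by
  have := one_le_sqrt x
  unfold softAbs; linarith

lemma abs_sub_one_le_softAbs (x : ℝ) : |x| - 1 ≤ softAbs x := by
  have : |x| ≤ √(1 + x ^ 2) := Real.abs_le_sqrt (by linarith)
  unfold softAbs; linarith

lemma hasDerivAt_softAbs (x : ℝ) : HasDerivAt softAbs (x / √(1 + x ^ 2)) x := by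
  have h : HasDerivAt (fun x : ℝ => 1 + x ^ 2) (2 * x) x := by
    simpa using (hasDerivAt_pow 2 x).const_add 1
  refine ((h.sqrt (by positivity)).sub_const 1).congr_deriv ?_
  rw [mul_div_mul_left _ _ two_ne_zero]

lemma abs_deriv_softAbs_le (x : ℝ) : |deriv softAbs x| ≤ 1 := by
  rw [(hasDerivAt_softAbs x).deriv, abs_div, abs_of_pos (lt_of_lt_of_le one_pos (one_le_sqrt x))]
  exact div_le_one_of_le₀ (Real.abs_le_sqrt (by linarith)) (Real.sqrt_nonneg _)

lemma softAbs_le_softAbs {x y : ℝ} (h : |x| ≤ |y|) : softAbs x ≤ softAbs y := by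
  unfold softAbs
  have : x ^ 2 ≤ y ^ 2 := sq_le_sq.2 h
  gcongr

lemma softAbs_pos {x : ℝ} (h : 0 < x) : 0 < softAbs x := by
  have : 1 < √(1 + x ^ 2) := Real.lt_sqrt_of_sq_lt (by nlinarith)
  unfold softAbs; linarith

/-- Uniform continuity covers `|x - y| < r`; beyond that `K * softAbs r` exceeds the total
oscillation `2 C`. -/
lemma IsBUC.exists_modulus {u₀ : ℝ → ℝ} (h : IsBUC u₀) {ε : ℝ} (hε : 0 < ε) (K₀ : ℝ) :
    ∃ K > 0, K₀ ≤ K ∧ ∀ x y, u₀ x ≤ u₀ y + ε + K * softAbs (x - y) := by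
  obtain ⟨⟨C, hC⟩, huc⟩ := h
  obtain ⟨r, hr, hr'⟩ := Metric.uniformContinuous_iff.1 huc ε hε
  have hs := softAbs_pos hr
  refine ⟨max (max 1 K₀) (2 * C / softAbs r), lt_max_of_lt_left (lt_max_of_lt_left one_pos),
    (le_max_right _ _).trans (le_max_left _ _), fun x y => ?_⟩
  set K := max (max 1 K₀) (2 * C / softAbs r)
  have hK1 : 1 ≤ K := (le_max_left _ _).trans (le_max_left _ _)
  have hK2 : 2 * C ≤ K * softAbs r := (div_le_iff₀ hs).1 (le_max_right _ _)
  rcases lt_or_ge |x - y| r with hxy | hxy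
  · have := hr' (a := x) (b := y) (by rwa [Real.dist_eq])
    rw [Real.dist_eq] at this
    have := (abs_lt.1 this).2
    have : 0 ≤ K * softAbs (x - y) := mul_nonneg (by linarith) (softAbs_nonneg _)
    linarith
  · have h1 : softAbs r ≤ softAbs (x - y) := softAbs_le_softAbs (by rwa [abs_of_pos hr])
    have h2 : K * softAbs r ≤ K * softAbs (x - y) := by gcongr
    have := (abs_le.1 (hC x)).2
    have := (abs_le.1 (hC y)).1
    linarith

lemma IsBUC.neg {u₀ : ℝ → ℝ} (h : IsBUC u₀) : IsBUC fun x => -u₀ x :=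
  ⟨by simpa using h.1, h.2.neg⟩

lemma exists_lower_bound {H : ℝ → ℝ} (hH : Continuous H) (K : ℝ) :
    ∃ c, 0 ≤ c ∧ ∀ p, |p| ≤ K → -c ≤ H p := by
  obtain ⟨c, hc⟩ := (isCompact_Icc (a := -K) (b := K)).bddBelow_image (f := H) hH.continuousOn
  refine ⟨max 0 (-c), le_max_left _ _, fun p hp => ?_⟩
  have := hc (mem_image_of_mem H (abs_le.1 hp))
  have := le_max_right 0 (-c)
  linarith

lemma exists_lower_bound₂ {F : ℝ → ℝ → ℝ} (hF : Continuous fun q : ℝ × ℝ => F q.1 q.2) (K : ℝ) :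
    ∃ c, 0 ≤ c ∧ ∀ p q, |p| ≤ K → |q| ≤ K → -c ≤ F p q := by
  obtain ⟨c, hc⟩ := ((isCompact_Icc (a := -K) (b := K)).prod
    (isCompact_Icc (a := -K) (b := K))).bddBelow_image hF.continuousOn
  refine ⟨max 0 (-c), le_max_left _ _, fun p q hp hq => ?_⟩
  have := hc (mem_image_of_mem (fun q : ℝ × ℝ => F q.1 q.2)
    (show (p, q) ∈ _ from ⟨abs_le.1 hp, abs_le.1 hq⟩))
  have := le_max_right 0 (-c)
  simp only at *
  linarith

/-- Sub-solutions of at most linear growth depart from their initial datum at a controlled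
speed. -/
lemma le_datum_add {H₁ H₂ : ℝ → ℝ} {F w : ℝ → ℝ → ℝ} {u₀ : ℝ → ℝ} {T Cg : ℝ}
    (hH₁ : Continuous H₁) (hH₂ : Continuous H₂) (hF : Continuous fun q : ℝ × ℝ => F q.1 q.2)
    (husc : UpperSemicontinuousOn (fun z : ℝ × ℝ => w z.1 z.2) (Ici (0 : ℝ) ×ˢ univ))
    (hjet : ∀ t x, 0 < t → JetSub H₁ H₂ F w t x)
    (hgr : ∀ t x, 0 ≤ t → t ≤ T → w t x ≤ Cg * (1 + |x|)) (h0 : ∀ x, w 0 x ≤ u₀ x)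
    (hu₀ : IsBUC u₀) {ε : ℝ} (hε : 0 < ε) :
    ∃ C, 0 ≤ C ∧ ∀ t x, 0 ≤ t → t < T → w t x ≤ u₀ x + ε + C * t := by
  -- The barrier is `u₀ y + ε + K * softAbs (x - y) + c * t`; with a slope `K` above the growth rate
  -- of `w` it dominates at distance `R` from `y`.
  obtain ⟨K, hK0, hKg, hK⟩ := hu₀.exists_modulus hε (|Cg| + 1)
  obtain ⟨M, hM⟩ := hu₀.1
  -- The slopes of the barrier are at most `K`; the extra `1` is for the junction, where the smooth
  -- barrier is opened into a kink with slopes `p ± 1`.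
  obtain ⟨c₁, hc₁, hc₁'⟩ := exists_lower_bound hH₁ (K + 1)
  obtain ⟨c₂, hc₂, hc₂'⟩ := exists_lower_bound hH₂ (K + 1)
  obtain ⟨c₃, hc₃, hc₃'⟩ := exists_lower_bound₂ hF (K + 1)
  set c := c₁ + c₂ + c₃
  refine ⟨c, by positivity, fun t y ht htT => ?_⟩
  set R := |Cg| * (1 + |y|) + |M| + K + 1
  have hR0 : 0 < R := by positivity
  have hs := contDiff_softAbs.continuous
  have hgrow : ∀ t ∈ Icc (0 : ℝ) T, ∀ x, |x - y| = R →
      w t x ≤ u₀ y + ε + K * softAbs (x - y) := by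
    intro t ht x hx
    have h1 := hgr t x ht.1 ht.2
    have h2 : |x| ≤ |y| + R := by
      have := abs_add_le (x - y) y
      rw [sub_add_cancel] at this; linarith
    have h3 : Cg * (1 + |x|) ≤ |Cg| * (1 + (|y| + R)) :=
      (mul_le_mul_of_nonneg_right (le_abs_self Cg) (by positivity)).trans (by gcongr)
    have h4 := abs_sub_one_le_softAbs (x - y)
    rw [hx] at h4
    have h5 : K * (R - 1) ≤ K * softAbs (x - y) := by gcongr
    have h6 := (abs_le.1 (hM y)).1
    have h7 : (|Cg| + 1) * R ≤ K * R := by gcongr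
    have h8 := le_abs_self M
    have h9 : (|Cg| + 1) * R = |Cg| * R + (|Cg| * (1 + |y|) + |M| + K + 1) := by ring
    linarith
  have key := nonpos_of_no_localMax (f := fun z : ℝ × ℝ => w z.1 z.2 +
      (-(u₀ y + ε + K * softAbs (z.2 - y) + c * z.1))) (T := T) (c := y - R) (d := y + R)
    ?_ ?_ ?_ ?_ ?_ ht htT (x := y) ⟨by linarith, by linarith⟩
  · simp only [sub_self, softAbs_zero, mul_zero] at key
    linarith
  · have h3 : Continuous fun z : ℝ × ℝ => -(u₀ y + ε + K * softAbs (z.2 - y) + c * z.1) := by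
      fun_prop
    exact (husc.mono (prod_mono Icc_subset_Ici_self (subset_univ _))).add
      h3.continuousOn.upperSemicontinuousOn
  · intro x hx
    have := hK x y
    have := h0 x
    simp only [mul_zero]
    linarith
  · intro t ht
    have := hgrow t ht (y - R) (by rw [sub_sub_cancel_left, abs_neg, abs_of_pos hR0])
    have : 0 ≤ c * t := mul_nonneg (by positivity) ht.1
    simp only
    linarith
  · intro t ht
    have := hgrow t ht (y + R) (by rw [add_sub_cancel_left, abs_of_pos hR0])
    have : 0 ≤ c * t := mul_nonneg (by positivity) ht.1
    simp only
    linarith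
  · intro a ha ha' t ht x hx hmax
    have hds : HasDerivAt (fun x => K * softAbs (x - y)) (K * deriv softAbs (x - y)) x := by
      have h1 := (contDiff_softAbs.differentiable one_ne_zero (x - y)).hasDerivAt
      have h2 := (h1.comp (h := fun x => x - y) x ((hasDerivAt_id x).sub_const y)).const_mul K
      exact h2.congr_deriv (by ring)
    have hj : UJet w t x (deriv a t + c) (K * deriv softAbs (x - y)) := by
      refine ⟨fun t => a t + c * t, fun x => K * softAbs (x - y), by fun_prop,
        contDiff_const.mul (contDiff_softAbs.comp (contDiff_id.sub contDiff_const)), ?_,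
        hds.deriv, ?_⟩
      · have h1 := ((ha.differentiable one_ne_zero t).hasDerivAt).add
          ((hasDerivAt_id t).const_mul c)
        exact (h1.congr_deriv (by ring)).deriv
      · filter_upwards [hmax] with z hz
        linarith
    have hp : |K * deriv softAbs (x - y)| ≤ K := by
      rw [abs_mul, abs_of_pos hK0]
      have : K * |deriv softAbs (x - y)| ≤ K * 1 := by
        gcongr; exact abs_deriv_softAbs_le _
      linarith
    have hJ := hjet t x ht.1
    have hat := ha' t
    rcases lt_trichotomy x 0 with hx0 | rfl | hx0
    · have := hJ.1 hx0 _ _ hj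
      have := hc₁' _ (hp.trans (by linarith))
      have : c₁ ≤ c := by linarith
      linarith
    · have := hJ.2.2 rfl _ _ _ (hj.ukink (sub_one_lt _) (lt_add_one _))
      rw [abs_le] at hp
      have := hc₃' (K * deriv softAbs (0 - y) - 1) (K * deriv softAbs (0 - y) + 1)
        (abs_le.2 ⟨by linarith, by linarith⟩) (abs_le.2 ⟨by linarith, by linarith⟩)
      have : c₃ ≤ c := by linarith
      linarith
    · have := hJ.2.1 hx0 _ _ hj
      have := hc₂' _ (hp.trans (by linarith))
      have : c₂ ≤ c := by linarith
      linarith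

lemma HasLinearGrowth.neg {u : ℝ → ℝ → ℝ} (h : HasLinearGrowth u) :
    HasLinearGrowth fun t x => -u t x := fun T hT => by simpa using h T hT

lemma HasLinearGrowth.upperEnv_le {u : ℝ → ℝ → ℝ} (hu : LocallyBdd u) (h : HasLinearGrowth u)
    {T : ℝ} (hT : 0 < T) : ∃ C, ∀ t x, 0 ≤ t → t ≤ T → upperEnv u t x ≤ C * (1 + |x|) := by
  obtain ⟨C, hC⟩ := h (T + 1) (by linarith)
  refine ⟨C, fun t x ht htT => ?_⟩
  refine hu.upperEnv_le_of_le ht (g := fun z => C * (1 + |z.2|)) (by fun_prop) ?_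
  filter_upwards [self_mem_nhdsWithin, nhdsWithin_le_nhds
    (continuousAt_fst.eventually (gt_mem_nhds (show t < T + 1 by linarith)))] with z h1 h2
  exact (abs_le.1 (hC z.1 z.2 h1.1 h2)).2

/-! ### Comparison principle -/

section truncation

variable {H : ℝ → ℝ} {p₀ η C : ℝ}

/-- A truncation of `h - η`. -/
noncomputable def trunc (η C h : ℝ) : ℝ := min (h - η) C

lemma continuous_trunc : Continuous (trunc η C) := by unfold trunc; fun_prop

lemma monotone_trunc : Monotone (trunc η C) := fun a b h => by unfold trunc; gcongr

lemma IsQuasiConvex.trunc (h : IsQuasiConvex H p₀) :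
    IsQuasiConvex (fun p => trunc η C (H p)) p₀ :=
  ⟨continuous_trunc.comp h.continuous, monotone_trunc.comp_antitoneOn h.anti,
    monotone_trunc.comp_monotoneOn h.mono⟩

lemma fluxFun_trunc {H₁ H₂ : ℝ → ℝ} {p₁ p₂ A : ℝ} (q₁ q₂ : ℝ) :
    fluxFun (fun p => trunc η C (H₁ p)) (fun p => trunc η C (H₂ p)) p₁ p₂ (trunc η C A) q₁ q₂ =
      trunc η C (fluxFun H₁ H₂ p₁ p₂ A q₁ q₂) := by
  simp only [fluxFun, incPart_eq, decPart_eq, monotone_trunc.map_max]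

/-- `min H (C + η)` is constant near infinity, hence uniformly continuous, so small changes of slope
cost at most `η`. A coercive Hamiltonian need not be uniformly continuous itself; this is the reason
for truncating. -/
lemma exists_trunc_le (hc : Continuous H) (hH : Tendsto H (cocompact ℝ) atTop) (hη : 0 < η) :
    ∃ κ > 0, ∀ p z, |z| ≤ κ → trunc η C (H p) ≤ H (p + z) := by
  have huc : UniformContinuous fun p => min (H p) (C + η) := by
    refine Continuous.uniformContinuous_of_tendsto_cocompact (x := C + η) (by fun_prop) ?_
    refine tendsto_const_nhds.congr' ?_
    filter_upwards [hH.eventually (eventually_ge_atTop (C + η))] with p hp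
    rw [min_eq_right hp]
  obtain ⟨δ, hδ, h⟩ := Metric.uniformContinuous_iff.1 huc η hη
  refine ⟨δ / 2, by positivity, fun p z hz => ?_⟩
  have h1 := h (a := p) (b := p + z) (by
    rw [Real.dist_eq, sub_add_cancel_left, abs_neg]; linarith)
  rw [Real.dist_eq] at h1
  have h2 := (abs_lt.1 h1).2
  have h3 := min_le_left (H (p + z)) (C + η)
  have h4 : trunc η C (H p) = min (H p) (C + η) - η := by
    unfold HJ.trunc
    rw [min_sub_sub_right (H p) (C + η) η |>.symm, add_sub_cancel_right]
  linarith

/-- For `l > -C` the cut at height `C` is not active, and the truncation loses only `η`. -/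
lemma le_of_trunc_le {l h : ℝ} (hl : -C < l) (h' : l + trunc η C h ≤ 0) : l + h ≤ η := by
  unfold HJ.trunc at h'
  rcases min_choice (h - η) C with e | e <;> rw [e] at h' <;> linarith

lemma eventually_trunc_pos {l : ℝ} (hl : -C < l) {f : Filter ℝ} (hH : Tendsto H f atTop) :
    ∀ᶠ p in f, (l + C) / 2 < l + trunc η C (H p) := by
  filter_upwards [hH.eventually (eventually_ge_atTop (C + η))] with p hp
  unfold HJ.trunc
  rw [min_eq_right (by linarith)]
  linarith

end truncation

lemma tendsto_atBot_of_cocompact {H : ℝ → ℝ} (h : Tendsto H (cocompact ℝ) atTop) :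
    Tendsto H atBot atTop := h.mono_left (by rw [cocompact_eq_atBot_atTop]; exact le_sup_left)

lemma tendsto_atTop_of_cocompact {H : ℝ → ℝ} (h : Tendsto H (cocompact ℝ) atTop) :
    Tendsto H atTop atTop := h.mono_left (by rw [cocompact_eq_atBot_atTop]; exact le_sup_right)

/-- The contradiction in the doubling of the time variable, for flux-limited solutions. -/
lemma false_of_doubling_flux {u v : ℝ → ℝ → ℝ} {ψ χ : ℝ → ℝ} {t₀ s₀ x₀ N : ℝ} {HL HR : ℝ → ℝ}
    {pL pR A η C : ℝ} (hHL : IsQuasiConvexHamiltonian HL pL) (hHR : IsQuasiConvexHamiltonian HR pR)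
    (hψ : ContDiff ℝ 1 ψ) (hχ : ContDiff ℝ 1 χ)
    (husc : ∀ᶠ z in 𝓝 (t₀, x₀), UpperSemicontinuousAt (fun z : ℝ × ℝ => u z.1 z.2) z)
    (hvsc : ∀ᶠ z in 𝓝 (s₀, x₀), UpperSemicontinuousAt (fun z : ℝ × ℝ => v z.1 z.2) z)
    (hψ0 : ψ t₀ = u t₀ x₀) (hχ0 : χ s₀ = v s₀ x₀) (hN : 0 < N) {r : ℝ} (hr : 0 < r)
    (huv : ∀ t s x, |t - t₀| < r → |s - s₀| < r → |x - x₀| < r →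
      u t x + v s x ≤ ψ t + χ s + N * |t - t₀| * |s - s₀|)
    (hjuL : ∀ᶠ z in 𝓝 (t₀, x₀), z.2 < x₀ → ∀ l p, UJet u z.1 z.2 l p →
      l + trunc η C (HL p) ≤ 0)
    (hjuR : ∀ᶠ z in 𝓝 (t₀, x₀), x₀ < z.2 → ∀ l p, UJet u z.1 z.2 l p →
      l + trunc η C (HR p) ≤ 0)
    (hjvL : ∀ᶠ z in 𝓝 (s₀, x₀), z.2 < x₀ → ∀ l p, UJet v z.1 z.2 l p → l + -HL (-p) ≤ 0)
    (hjvR : ∀ᶠ z in 𝓝 (s₀, x₀), x₀ < z.2 → ∀ l p, UJet v z.1 z.2 l p → l + -HR (-p) ≤ 0)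
    (hku : ∀ q₁ q₂, UKink u t₀ x₀ (deriv ψ t₀) q₁ q₂ →
      deriv ψ t₀ + trunc η C (fluxFun HL HR pL pR A q₁ q₂) ≤ 0)
    (hkv : ∀ q₁ q₂, UKink v s₀ x₀ (deriv χ s₀) q₁ q₂ →
      deriv χ s₀ + -fluxFun HL HR pL pR A (-q₁) (-q₂) ≤ 0)
    (hC : -C < deriv ψ t₀) (hstrict : η < deriv ψ t₀ + deriv χ s₀) : False := by
  have hpos : 0 < (deriv ψ t₀ + C) / 2 := by linarith
  have hflux := continuous_fluxFun (p₁ := pL) (p₂ := pR) (A := A) hHL.continuous hHR.continuous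
  have hcon : ∀ {h : ℝ}, deriv ψ t₀ + trunc η C h ≤ 0 → deriv χ s₀ + -h ≤ 0 → False :=
    fun h1 h2 => by linarith [le_of_trunc_le hC h1]
  refine false_of_doubling (KL := fun p => trunc η C (HL p)) (KR := fun p => trunc η C (HR p))
    (KL' := fun p => -HL (-p)) (KR' := fun p => -HR (-p))
    (F := fun q₁ q₂ => trunc η C (fluxFun HL HR pL pR A q₁ q₂))
    (F' := fun q₁ q₂ => -fluxFun HL HR pL pR A (-q₁) (-q₂)) hψ hχ husc hvsc hψ0 hχ0 ?_ ?_ hN hr huv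
    hjuL hjuR hjvL hjvR hku hkv (continuous_trunc.comp hflux)
    (hflux.comp (f := fun q : ℝ × ℝ => (-q.1, -q.2)) (by fun_prop)).neg
    (fun p h1 h2 => hcon h1 (by simpa using h2)) (fun p h1 h2 => hcon h1 (by simpa using h2))
    (fun p q h1 h2 => hcon h1 (by simpa using h2))
    ⟨_, hpos, eventually_trunc_pos hC (tendsto_atBot_of_cocompact hHL.coercive)⟩
    ⟨_, hpos, eventually_trunc_pos hC (tendsto_atTop_of_cocompact hHR.coercive)⟩ ?_ ?_
  · filter_upwards [Metric.ball_mem_nhds t₀ hr] with t ht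
    have := huv t s₀ x₀ (by simpa [Real.dist_eq] using ht) (by simpa using hr) (by simpa using hr)
    rw [sub_self, abs_zero, mul_zero] at this
    linarith
  · filter_upwards [Metric.ball_mem_nhds s₀ hr] with s hs
    have := huv t₀ s x₀ (by simpa using hr) (by simpa [Real.dist_eq] using hs) (by simpa using hr)
    rw [sub_self, abs_zero, mul_zero, zero_mul] at this
    linarith
  · intro q₂
    obtain ⟨q₁, h1, h2⟩ := ((eventually_trunc_pos (η := η) hC
      (tendsto_atTop_of_cocompact hHL.coercive)).and (eventually_ge_atTop pL)).exists
    refine ⟨q₁, ?_⟩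
    have : trunc η C (HL q₁) ≤ trunc η C (fluxFun HL HR pL pR A q₁ q₂) := monotone_trunc (by
      refine le_trans ?_ ((le_max_left _ _).trans (le_max_right _ _))
      rw [incPart_eq, max_eq_left h2])
    linarith
  · intro q₁
    obtain ⟨q₂, h1, h2⟩ := ((eventually_trunc_pos (η := η) hC
      (tendsto_atBot_of_cocompact hHR.coercive)).and (eventually_le_atBot pR)).exists
    refine ⟨q₂, ?_⟩
    have : trunc η C (HR q₂) ≤ trunc η C (fluxFun HL HR pL pR A q₁ q₂) := monotone_trunc (by
      refine le_trans ?_ ((le_max_right _ _).trans (le_max_right _ _))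
      rw [decPart_eq, min_eq_left h2])
    linarith

lemma UJet.of_sub_space {w : ℝ → ℝ → ℝ} {t x l p : ℝ} {g : ℝ → ℝ} (hg : ContDiff ℝ 1 g)
    (h : UJet (fun t x => w t x - g x) t x l p) : UJet w t x l (p + deriv g x) := by
  obtain ⟨a, b, ha, hb, rfl, rfl, hmax⟩ := h
  refine ⟨a, fun x => b x + g x, ha, hb.add hg, rfl, ?_, ?_⟩
  · exact ((hb.differentiable one_ne_zero x).hasDerivAt.add
      (hg.differentiable one_ne_zero x).hasDerivAt).deriv
  · filter_upwards [hmax] with z hz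
    linarith

lemma UKink.of_sub_space {w : ℝ → ℝ → ℝ} {t x l q₁ q₂ : ℝ} {g : ℝ → ℝ} (hg : HasDerivAt g 0 x)
    (h : UKink (fun t x => w t x - g x) t x l q₁ q₂) {ε : ℝ} (hε : 0 < ε) :
    UKink w t x l (q₁ - ε) (q₂ + ε) := by
  obtain ⟨a, ha, rfl, hmax⟩ := h
  refine ⟨a, ha, rfl, ?_⟩
  filter_upwards [hmax, continuousAt_snd.eventually
    (eventually_le_kink hg (neg_lt_zero.2 hε) hε)] with z hz hz'
  have := kink_add q₁ q₂ (-ε) ε (z.2 - x)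
  rw [← sub_eq_add_neg] at this
  simp only [sub_self, kink_zero] at hz hz' ⊢
  linarith

/-! ### Doubling of the time variable. -/

section doubling

variable {H₁ H₂ : ℝ → ℝ} {p₁ p₂ A : ℝ} {W V : ℝ → ℝ → ℝ} {θ : ℝ → ℝ} {κ N η C t₀ s₀ x₀ : ℝ}

/-- The function maximised in the proof of the comparison principle. -/
noncomputable def doubled (W V : ℝ → ℝ → ℝ) (θ : ℝ → ℝ) (κ N : ℝ) (z : ℝ × ℝ × ℝ) : ℝ :=
  W z.1 z.2.2 + V z.2.1 z.2.2 - N / 2 * (z.1 - z.2.1) ^ 2 - θ z.1 - κ * softAbs z.2.2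

/-- Around `(t₀, s₀)`, the square `(t - s)²` splits into a function of `t`, a function of `s` and
the cross term `-2 (t - t₀) (s - s₀)`, which explains the bound by `N |t - t₀| |s - s₀|`. The
contributions `± N (t₀ - s₀)` to the two time derivatives cancel, leaving `deriv θ t₀ > η`. -/
lemma false_of_isLocalMax_doubled_of_jets {HL HR : ℝ → ℝ} {pL pR : ℝ}
    (hHL : IsQuasiConvexHamiltonian HL pL) (hHR : IsQuasiConvexHamiltonian HR pR)
    (hWsc : ∀ᶠ z in 𝓝 (t₀, x₀), UpperSemicontinuousAt (fun z : ℝ × ℝ => W z.1 z.2) z)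
    (hVsc : ∀ᶠ z in 𝓝 (s₀, x₀), UpperSemicontinuousAt (fun z : ℝ × ℝ => V z.1 z.2) z)
    (hθ : ContDiff ℝ 1 θ) (hmax : IsLocalMax (doubled W V θ κ N) (t₀, s₀, x₀))
    (hηθ : η < deriv θ t₀) (hN : 0 < N) (hC : -C < N * (t₀ - s₀) + deriv θ t₀)
    (hWL : ∀ᶠ z in 𝓝 (t₀, x₀), z.2 < x₀ → ∀ l p,
      UJet (fun t x => W t x - κ * softAbs x) z.1 z.2 l p → l + trunc η C (HL p) ≤ 0)
    (hWR : ∀ᶠ z in 𝓝 (t₀, x₀), x₀ < z.2 → ∀ l p,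
      UJet (fun t x => W t x - κ * softAbs x) z.1 z.2 l p → l + trunc η C (HR p) ≤ 0)
    (hVL : ∀ᶠ z in 𝓝 (s₀, x₀), z.2 < x₀ → ∀ l p, UJet V z.1 z.2 l p → l + -HL (-p) ≤ 0)
    (hVR : ∀ᶠ z in 𝓝 (s₀, x₀), x₀ < z.2 → ∀ l p, UJet V z.1 z.2 l p → l + -HR (-p) ≤ 0)
    (hkW : ∀ l q₁ q₂, -C < l → UKink (fun t x => W t x - κ * softAbs x) t₀ x₀ l q₁ q₂ →
      l + trunc η C (fluxFun HL HR pL pR A q₁ q₂) ≤ 0)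
    (hkV : ∀ l q₁ q₂, UKink V s₀ x₀ l q₁ q₂ →
      l + -fluxFun HL HR pL pR A (-q₁) (-q₂) ≤ 0) : False := by
  obtain ⟨r, hr, hr'⟩ := Metric.eventually_nhds_iff.1 hmax
  set ψ : ℝ → ℝ := fun t => W t₀ x₀ - κ * softAbs x₀ + N / 2 * ((t - s₀) ^ 2 - (t₀ - s₀) ^ 2) +
    (θ t - θ t₀) with hψdef
  set χ : ℝ → ℝ := fun s => V s₀ x₀ + N / 2 * ((t₀ - s) ^ 2 - (t₀ - s₀) ^ 2) with hχdef
  have hψ' : HasDerivAt ψ (N * (t₀ - s₀) + deriv θ t₀) t₀ := by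
    have h1 : HasDerivAt (fun t : ℝ => (t - s₀) ^ 2) (2 * (t₀ - s₀)) t₀ := by
      simpa using ((hasDerivAt_id t₀).sub_const s₀).fun_pow 2
    have h2 := (((h1.sub_const ((t₀ - s₀) ^ 2)).const_mul (N / 2)).const_add
      (W t₀ x₀ - κ * softAbs x₀)).add
      ((hθ.differentiable one_ne_zero t₀).hasDerivAt.sub_const (θ t₀))
    exact h2.congr_deriv (by ring)
  have hχ' : HasDerivAt χ (-(N * (t₀ - s₀))) s₀ := by
    have h1 : HasDerivAt (fun s : ℝ => (t₀ - s) ^ 2) (-(2 * (t₀ - s₀))) s₀ := by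
      simpa using ((hasDerivAt_id s₀).const_sub t₀).fun_pow 2
    have h2 := ((h1.sub_const ((t₀ - s₀) ^ 2)).const_mul (N / 2)).const_add (V s₀ x₀)
    exact h2.congr_deriv (by ring)
  have hs := contDiff_softAbs.continuous
  refine false_of_doubling_flux (u := fun t x => W t x - κ * softAbs x) (v := V) (ψ := ψ) (χ := χ)
    (N := N) (A := A) (η := η) (C := C) hHL hHR (by fun_prop) (by fun_prop) ?_ hVsc (by simp [hψdef])
    (by simp [hχdef]) hN hr ?_ hWL hWR hVL hVR ?_ (fun q₁ q₂ => hkV _ q₁ q₂) ?_ ?_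
  · filter_upwards [hWsc] with z hz
    have h3 : Continuous fun z : ℝ × ℝ => -(κ * softAbs z.2) := by fun_prop
    simpa only [sub_eq_add_neg] using hz.add h3.continuousAt.upperSemicontinuousAt
  · intro t s x ht hs hx
    have h1 := hr' (y := (t, s, x)) (by
      simp only [Prod.dist_eq, Real.dist_eq, sup_lt_iff]; exact ⟨ht, hs, hx⟩)
    simp only [doubled] at h1
    have h2 : -((t - t₀) * (s - s₀)) ≤ |t - t₀| * |s - s₀| := by
      rw [← abs_mul]; exact neg_le_abs _
    have h3 := mul_le_mul_of_nonneg_left h2 hN.le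
    simp only [hψdef, hχdef]
    nlinarith
  · intro q₁ q₂
    rw [hψ'.deriv]
    exact hkW _ q₁ q₂ hC
  · rwa [hψ'.deriv]
  · rw [hψ'.deriv, hχ'.deriv]; linarith

/-- If `x₀ ≠ 0`, the point is regarded as a junction with the same Hamiltonian `H` on both sides.
Both Ishii limiters then equal `min H`, and the smooth inequalities give junction inequalities, so a
single contradiction covers all points. -/
lemma false_of_isLocalMax_doubled (h₁ : IsQuasiConvexHamiltonian H₁ p₁)
    (h₂ : IsQuasiConvexHamiltonian H₂ p₂) (ht₀ : 0 < t₀) (hs₀ : 0 < s₀)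
    (hWsc : ∀ t x, 0 < t → UpperSemicontinuousAt (fun z : ℝ × ℝ => W z.1 z.2) (t, x))
    (hVsc : ∀ t x, 0 < t → UpperSemicontinuousAt (fun z : ℝ × ℝ => V z.1 z.2) (t, x))
    (hW : ∀ t x, 0 < t → JetSub H₁ H₂ (fluxFun H₁ H₂ p₁ p₂ A) W t x)
    (hV : ∀ t x, 0 < t → JetSub (fun p => -H₁ (-p)) (fun p => -H₂ (-p))
      (fun q₁ q₂ => -fluxFun H₁ H₂ p₁ p₂ A (-q₁) (-q₂)) V t x)
    (hθ : ContDiff ℝ 1 θ) (hmax : IsLocalMax (doubled W V θ κ N) (t₀, s₀, x₀))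
    (hη : 0 < η) (hηθ : η < deriv θ t₀) (hN : 0 < N) (hC : -C < N * (t₀ - s₀) + deriv θ t₀)
    (hκ : 0 ≤ κ) (hκ₁ : ∀ p z, |z| ≤ κ → trunc η C (H₁ p) ≤ H₁ (p + z))
    (hκ₂ : ∀ p z, |z| ≤ κ → trunc η C (H₂ p) ≤ H₂ (p + z)) : False := by
  have hposW : ∀ᶠ z : ℝ × ℝ in 𝓝 (t₀, x₀), 0 < z.1 :=
    continuousAt_fst.eventually (lt_mem_nhds ht₀)
  have hposV : ∀ᶠ z : ℝ × ℝ in 𝓝 (s₀, x₀), 0 < z.1 :=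
    continuousAt_fst.eventually (lt_mem_nhds hs₀)
  have hWsc' : ∀ᶠ z in 𝓝 (t₀, x₀), UpperSemicontinuousAt (fun z : ℝ × ℝ => W z.1 z.2) z :=
    hposW.mono fun z hz => hWsc z.1 z.2 hz
  have hVsc' : ∀ᶠ z in 𝓝 (s₀, x₀), UpperSemicontinuousAt (fun z : ℝ × ℝ => V z.1 z.2) z :=
    hposV.mono fun z hz => hVsc z.1 z.2 hz
  have hsm : ContDiff ℝ 1 fun x => κ * softAbs x := contDiff_const.mul contDiff_softAbs
  have hd : ∀ x, |deriv (fun x => κ * softAbs x) x| ≤ κ := by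
    intro x
    rw [((hasDerivAt_softAbs x).differentiableAt.hasDerivAt.const_mul κ).deriv, abs_mul,
      abs_of_nonneg hκ]
    exact mul_le_of_le_one_right hκ (abs_deriv_softAbs_le x)
  -- slopes of the perturbed function
  have hW₁ : ∀ t x, 0 < t → x < 0 → ∀ l p, UJet (fun t x => W t x - κ * softAbs x) t x l p →
      l + trunc η C (H₁ p) ≤ 0 := fun t x ht hx l p hj => by
    have := (hW t x ht).1 hx _ _ (hj.of_sub_space hsm)
    have := hκ₁ p _ (hd x)
    linarith
  have hW₂ : ∀ t x, 0 < t → 0 < x → ∀ l p, UJet (fun t x => W t x - κ * softAbs x) t x l p →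
      l + trunc η C (H₂ p) ≤ 0 := fun t x ht hx l p hj => by
    have := (hW t x ht).2.1 hx _ _ (hj.of_sub_space hsm)
    have := hκ₂ p _ (hd x)
    linarith
  -- the case of a point away from the origin
  have away : ∀ (H : ℝ → ℝ) (p₀ : ℝ), IsQuasiConvexHamiltonian H p₀ →
      (∀ᶠ z in 𝓝 (t₀, x₀), ∀ l p, UJet (fun t x => W t x - κ * softAbs x) z.1 z.2 l p →
        l + trunc η C (H p) ≤ 0) →
      (∀ᶠ z in 𝓝 (s₀, x₀), ∀ l p, UJet V z.1 z.2 l p → l + -H (-p) ≤ 0) → False := by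
    intro H p₀ hH hjW hjV
    have hWsc'' : ∀ᶠ z in 𝓝 (t₀, x₀),
        UpperSemicontinuousAt (fun z : ℝ × ℝ => W z.1 z.2 - κ * softAbs z.2) z := by
      filter_upwards [hWsc'] with z hz
      have hs := contDiff_softAbs.continuous
      have h3 : Continuous fun z : ℝ × ℝ => -(κ * softAbs z.2) := by fun_prop
      simpa only [sub_eq_add_neg] using hz.add h3.continuousAt.upperSemicontinuousAt
    have hminus : ∀ G : ℝ → ℝ, ishiiMinus G G p₀ p₀ = G p₀ := fun G => by
      simp [ishiiMinus, fluxA0]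
    have hplus : ishiiPlus H H p₀ p₀ = H p₀ := by
      simp [ishiiPlus, fluxA0, fluxAstar]
    refine false_of_isLocalMax_doubled_of_jets (A := H p₀) hH hH hWsc' hVsc' hθ hmax hηθ hN hC
      (hjW.mono fun z hz _ => hz) (hjW.mono fun z hz _ => hz) (hjV.mono fun z hz _ => hz)
      (hjV.mono fun z hz _ => hz) (fun l q₁ q₂ hl hk => ?_) (fun l q₁ q₂ hk => ?_)
    · have hco : ∀ᶠ p in cocompact ℝ, 0 < l + trunc η C (H p) :=
        (eventually_trunc_pos (η := η) hl hH.coercive).mono fun p hp => by linarith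
      have := fluxFun_le_of_kink (G₁ := fun p => trunc η C (H p)) (G₂ := fun p => trunc η C (H p))
        hH.isQuasiConvex.trunc hH.isQuasiConvex.trunc hWsc'' (hjW.mono fun z hz _ => hz)
        (hjW.mono fun z hz _ => hz)
        (fun p hj => by rw [min_self]; exact hjW.self_of_nhds l p hj) hco hco hk
      rwa [hminus, fluxFun_trunc] at this
    · have := le_fluxFun_of_kink hH.isQuasiConvex hH.isQuasiConvex hVsc'
        (hjV.mono fun z hz _ => hz) (hjV.mono fun z hz _ => hz)
        (fun p hj => by rw [max_self]; linarith [hjV.self_of_nhds l p hj]) hk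
      rw [hplus] at this
      linarith
  rcases lt_trichotomy x₀ 0 with hx | rfl | hx
  · refine away H₁ p₁ h₁ ?_ ?_
    · filter_upwards [hposW, continuousAt_snd.eventually (gt_mem_nhds hx)] with z hz hz'
      exact hW₁ z.1 z.2 hz hz'
    · filter_upwards [hposV, continuousAt_snd.eventually (gt_mem_nhds hx)] with z hz hz'
      exact (hV z.1 z.2 hz).1 hz'
  · refine false_of_isLocalMax_doubled_of_jets (A := A) h₁ h₂ hWsc' hVsc' hθ hmax hηθ hN hC
      (hposW.mono fun z hz hz' => hW₁ z.1 z.2 hz hz')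
      (hposW.mono fun z hz hz' => hW₂ z.1 z.2 hz hz')
      (hposV.mono fun z hz hz' => (hV z.1 z.2 hz).1 hz')
      (hposV.mono fun z hz hz' => (hV z.1 z.2 hz).2.1 hz') (fun l q₁ q₂ hl hk => ?_)
      (fun l q₁ q₂ hk => (hV s₀ 0 hs₀).2.2 rfl l q₁ q₂ hk)
    have hg : HasDerivAt (fun x => κ * softAbs x) 0 0 := by
      simpa using (hasDerivAt_softAbs 0).const_mul κ
    have hlim : Tendsto (fun ε : ℝ => l + fluxFun H₁ H₂ p₁ p₂ A (q₁ - ε) (q₂ + ε)) (𝓝[>] 0)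
        (𝓝 (l + fluxFun H₁ H₂ p₁ p₂ A q₁ q₂)) := by
      have hcont := continuous_fluxFun (p₁ := p₁) (p₂ := p₂) (A := A) h₁.continuous h₂.continuous
      have : Continuous fun ε : ℝ => l + fluxFun H₁ H₂ p₁ p₂ A (q₁ - ε) (q₂ + ε) :=
        (hcont.comp (f := fun ε : ℝ => (q₁ - ε, q₂ + ε)) (by fun_prop)).const_add l
      simpa using (this.tendsto 0).mono_left nhdsWithin_le_nhds
    have hle := le_of_tendsto hlim (b := 0) (by
      filter_upwards [self_mem_nhdsWithin] with ε hε
      exact (hW t₀ 0 ht₀).2.2 rfl _ _ _ (hk.of_sub_space hg hε))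
    have : trunc η C (fluxFun H₁ H₂ p₁ p₂ A q₁ q₂) ≤ fluxFun H₁ H₂ p₁ p₂ A q₁ q₂ :=
      (min_le_left _ _).trans (by linarith)
    linarith
  · refine away H₂ p₂ h₂ ?_ ?_
    · filter_upwards [hposW, continuousAt_snd.eventually (lt_mem_nhds hx)] with z hz hz'
      exact hW₂ z.1 z.2 hz hz'
    · filter_upwards [hposV, continuousAt_snd.eventually (lt_mem_nhds hx)] with z hz hz'
      exact (hV z.1 z.2 hz).2.1 hz'

end doubling

/-! ### The comparison theorem. -/

section comparison

variable {H₁ H₂ : ℝ → ℝ} {p₁ p₂ A : ℝ}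

/-- The upper semi-continuous version of the comparison principle, for a sub-solution `W` and
the opposite `V` of a super-solution. -/
lemma add_nonpos_of_jets {W V : ℝ → ℝ → ℝ} {u₀ : ℝ → ℝ} (h₁ : IsQuasiConvexHamiltonian H₁ p₁)
    (h₂ : IsQuasiConvexHamiltonian H₂ p₂) (hu₀ : IsBUC u₀)
    (hWsc : UpperSemicontinuousOn (fun z : ℝ × ℝ => W z.1 z.2) (Ici (0 : ℝ) ×ˢ univ))
    (hVsc : UpperSemicontinuousOn (fun z : ℝ × ℝ => V z.1 z.2) (Ici (0 : ℝ) ×ˢ univ))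
    (hW : ∀ t x, 0 < t → JetSub H₁ H₂ (fluxFun H₁ H₂ p₁ p₂ A) W t x)
    (hV : ∀ t x, 0 < t → JetSub (fun p => -H₁ (-p)) (fun p => -H₂ (-p))
      (fun q₁ q₂ => -fluxFun H₁ H₂ p₁ p₂ A (-q₁) (-q₂)) V t x)
    (hWgr : ∀ T > 0, ∃ C, ∀ t x, 0 ≤ t → t ≤ T → W t x ≤ C * (1 + |x|))
    (hVgr : ∀ T > 0, ∃ C, ∀ t x, 0 ≤ t → t ≤ T → V t x ≤ C * (1 + |x|))
    (hW0 : ∀ x, W 0 x ≤ u₀ x) (hV0 : ∀ x, V 0 x ≤ -u₀ x) {t₁ : ℝ} (ht₁ : 0 ≤ t₁) (x₁ : ℝ) :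
    W t₁ x₁ + V t₁ x₁ ≤ 0 := by
  have hposAt : ∀ {U : ℝ → ℝ → ℝ}, UpperSemicontinuousOn (fun z : ℝ × ℝ => U z.1 z.2)
      (Ici (0 : ℝ) ×ˢ univ) → ∀ t x, 0 < t →
      UpperSemicontinuousAt (fun z : ℝ × ℝ => U z.1 z.2) (t, x) := by
    intro U hU t x ht c hc
    have := hU (t, x) (mem_domain_self ht.le) c hc
    rwa [nhdsWithin_domain ht] at this
  by_contra! hm
  set m := W t₁ x₁ + V t₁ x₁
  have ht₁' : 0 < t₁ := lt_of_le_of_ne ht₁ fun h => by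
    have := hW0 x₁; have := hV0 x₁
    simp only [m, ← h] at hm
    linarith
  set T := t₁ + 1
  have hT : 0 < T := by positivity
  obtain ⟨Cw, hCw⟩ := hWgr (T + 1) (by positivity)
  obtain ⟨Cv, hCv⟩ := hVgr (T + 1) (by positivity)
  have hflux := continuous_fluxFun (p₁ := p₁) (p₂ := p₂) (A := A) h₁.continuous h₂.continuous
  obtain ⟨c₁, hc₁, hWle⟩ := le_datum_add h₁.continuous h₂.continuous hflux hWsc hW hCw hW0 hu₀
    (show 0 < m / 16 by positivity)
  obtain ⟨c₂, hc₂, hVle⟩ := le_datum_add (h₁.continuous.comp continuous_neg).neg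
    (h₂.continuous.comp continuous_neg).neg
    (hflux.comp (f := fun q : ℝ × ℝ => (-q.1, -q.2)) (by fun_prop)).neg hVsc hV hCv hV0 hu₀.neg
    (show 0 < m / 16 by positivity)
  obtain ⟨B, hB⟩ := hu₀.1
  have hB0 : 0 ≤ B := (abs_nonneg _).trans (hB 0)
  -- a common bound
  set M := B + m / 16 + (c₁ + c₂) * T + 1
  have hM1 : 1 ≤ M := by
    have : 0 ≤ (c₁ + c₂) * T := by positivity
    simp only [M]; linarith
  have hWM : ∀ t x, 0 ≤ t → t ≤ T → W t x ≤ M := fun t x ht htT => by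
    have k1 := hWle t x ht (by linarith)
    have k2 := (abs_le.1 (hB x)).2
    have k3 : c₁ * t ≤ (c₁ + c₂) * T := by
      apply mul_le_mul (by linarith) htT ht (by positivity)
    simp only [M]; linarith
  have hVM : ∀ t x, 0 ≤ t → t ≤ T → V t x ≤ M := fun t x ht htT => by
    have k1 := hVle t x ht (by linarith)
    have k2 := (abs_le.1 (hB x)).1
    have k3 : c₂ * t ≤ (c₁ + c₂) * T := by
      apply mul_le_mul (by linarith) htT ht (by positivity)
    simp only [M]; linarith
  -- the penalty in time
  obtain ⟨θ, hθ, hθ', hθ0, hθ₁, hθT, hθmono⟩ := exists_time_penalty (M := 2 * M + 1)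
    (show t₁ < T by simp [T]) (show 0 < m / 4 by positivity)
  obtain ⟨τ₀, hτ₀, hτ₀'⟩ := Metric.eventually_nhds_iff.1
    (hθ.continuous.continuousAt.eventually (lt_mem_nhds (show 2 * M < θ T by linarith)))
  -- Once `|t - s| < τ`, the first bound keeps `s` below `T`, and the second limits the departure
  -- from the datum to `m / 16`, which excludes a maximum at time zero.
  set τ := min τ₀ (m / (16 * (c₁ + c₂ + 1)))
  have hτ : 0 < τ := lt_min hτ₀ (by positivity)
  have hτc : (c₁ + c₂) * τ ≤ m / 16 := by
    have k1 : τ ≤ m / (16 * (c₁ + c₂ + 1)) := min_le_right _ _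
    rw [le_div_iff₀ (by positivity)] at k1
    nlinarith
  -- At the maximum `N / 2 * (t - s) ^ 2` is below `2 M`, hence `|t - s| < τ`. No limit in `N` is
  -- taken.
  set N := 4 * M / τ ^ 2
  have hN : 0 < N := by positivity
  have hNτ : N * τ ^ 2 = 4 * M := by simp only [N]; field_simp
  -- The time derivative at the maximum is `N (t - s) + θ' t > -C`, so truncating at this height is
  -- harmless. The spatial penalty `κ` is chosen only afterwards.
  set C := N * τ + 1
  -- Since `deriv θ` is monotone, it exceeds this `η` at every positive time.
  have hη : 0 < deriv θ 0 / 2 := half_pos (hθ' 0)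
  obtain ⟨κ₁, hκ₁, hκ₁'⟩ := exists_trunc_le (C := C) h₁.continuous h₁.coercive hη
  obtain ⟨κ₂, hκ₂, hκ₂'⟩ := exists_trunc_le (C := C) h₂.continuous h₂.coercive hη
  obtain ⟨κ, hκ, hκ'⟩ := exists_between (lt_min (lt_min hκ₁ hκ₂)
    (show 0 < m / (4 * (softAbs x₁ + 1)) by have := softAbs_nonneg x₁; positivity))
  simp only [lt_min_iff] at hκ'
  have hκx : κ * softAbs x₁ ≤ m / 4 := by
    have k0 := softAbs_nonneg x₁
    have k1 := hκ'.2
    rw [lt_div_iff₀ (by positivity)] at k1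
    nlinarith
  set R := |x₁| + 1 + 2 * M / κ
  have hR : κ * (R - 1) ≥ 2 * M := by
    have k1 : κ * (2 * M / κ) = 2 * M := by field_simp
    have k2 : 0 ≤ κ * |x₁| := by positivity
    simp only [R]; nlinarith
  have hRx : |x₁| < R := by
    have : 0 < 2 * M / κ := by positivity
    simp only [R]; linarith
  -- the maximum of the doubled function
  have hsc : UpperSemicontinuousOn (doubled W V θ κ N) (Icc 0 T ×ˢ Icc 0 T ×ˢ Icc (-R) R) := by
    have hs := contDiff_softAbs.continuous
    have hθc := hθ.continuous
    have k1 : UpperSemicontinuousOn (fun z : ℝ × ℝ × ℝ => W z.1 z.2.2)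
        (Icc 0 T ×ˢ Icc 0 T ×ˢ Icc (-R) R) :=
      hWsc.comp (g := fun z : ℝ × ℝ × ℝ => (z.1, z.2.2)) (by fun_prop)
        fun z hz => mem_domain_self hz.1.1
    have k2 : UpperSemicontinuousOn (fun z : ℝ × ℝ × ℝ => V z.2.1 z.2.2)
        (Icc 0 T ×ˢ Icc 0 T ×ˢ Icc (-R) R) :=
      hVsc.comp (g := fun z : ℝ × ℝ × ℝ => (z.2.1, z.2.2)) (by fun_prop)
        fun z hz => mem_domain_self hz.2.1.1
    have k3 : Continuous fun z : ℝ × ℝ × ℝ =>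
      -(N / 2 * (z.1 - z.2.1) ^ 2) + (-θ z.1 + -(κ * softAbs z.2.2)) := by fun_prop
    have k4 : doubled W V θ κ N = fun z => W z.1 z.2.2 + V z.2.1 z.2.2 +
        (-(N / 2 * (z.1 - z.2.1) ^ 2) + (-θ z.1 + -(κ * softAbs z.2.2))) := by
      funext z; simp only [doubled]; ring
    rw [k4]
    exact (k1.add k2).add k3.continuousOn.upperSemicontinuousOn
  have hmem : (t₁, t₁, x₁) ∈ Icc 0 T ×ˢ Icc 0 T ×ˢ Icc (-R) R :=
    ⟨⟨ht₁, by simp [T]⟩, ⟨ht₁, by simp [T]⟩, abs_le.1 hRx.le⟩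
  obtain ⟨⟨t, s, x⟩, ⟨ht, hs, hx⟩, hmax⟩ := hsc.exists_isMaxOn ⟨_, hmem⟩
    (isCompact_Icc.prod (isCompact_Icc.prod isCompact_Icc))
  have hval : m / 2 ≤ doubled W V θ κ N (t, s, x) := by
    refine le_trans ?_ (hmax hmem)
    simp only [doubled, sub_self, hθ₁]
    have : W t₁ x₁ + V t₁ x₁ = m := rfl
    linarith
  simp only [doubled] at hval
  simp only at ht hs hx
  have e1 := hWM t x ht.1 ht.2
  have e2 := hVM s x hs.1 hs.2
  have e3 := hθ0 t
  have e4 : 0 ≤ κ * softAbs x := mul_nonneg hκ.le (softAbs_nonneg x)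
  have e5 : 0 ≤ N / 2 * (t - s) ^ 2 := by positivity
  have hts : |t - s| < τ := by
    refine abs_lt_of_sq_lt_sq (lt_of_mul_lt_mul_left ?_ hN.le) hτ.le
    linarith
  have htT : t < T - τ₀ := by
    by_contra! hcon
    rcases hcon.lt_or_eq with hcon | hcon
    · have := hτ₀' (y := t) (by rw [Real.dist_eq, abs_lt]; constructor <;> linarith [ht.2])
      linarith
    · have hc : θ t ≥ 2 * M := by
        refine le_of_tendsto_of_tendsto (f := fun _ => 2 * M) (b := 𝓝[>] t) tendsto_const_nhds
          (hθ.continuous.continuousAt.tendsto.mono_left nhdsWithin_le_nhds) ?_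
        filter_upwards [Ioo_mem_nhdsGT (show t < T by linarith)] with y hy
        exact (hτ₀' (y := y) (by rw [Real.dist_eq, abs_lt]; constructor <;> linarith [hy.1, hy.2])).le
      linarith
  have hτ₀τ : τ ≤ τ₀ := min_le_left _ _
  rw [abs_lt] at hts
  have hsT : s < T := by linarith
  have hsum : W t x + V s x ≤ m / 8 + c₁ * t + c₂ * s := by
    have k1 := hWle t x ht.1 (by linarith)
    have k2 := hVle s x hs.1 (by linarith)
    linarith
  have ht0 : 0 < t := by
    refine lt_of_le_of_ne ht.1 fun h => ?_
    subst h
    have : c₂ * s ≤ (c₁ + c₂) * τ := by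
      apply mul_le_mul (by linarith) (by linarith) hs.1 (by positivity)
    linarith
  have hs0 : 0 < s := by
    refine lt_of_le_of_ne hs.1 fun h => ?_
    subst h
    have : c₁ * t ≤ (c₁ + c₂) * τ := by
      apply mul_le_mul (by linarith) (by linarith) ht.1 (by positivity)
    linarith
  have hxR : |x| < R := by
    by_contra! hcon
    have k1 := abs_sub_one_le_softAbs x
    have k2 : κ * (R - 1) ≤ κ * softAbs x := by gcongr; linarith
    linarith
  rw [abs_lt] at hxR
  have hloc : IsLocalMax (doubled W V θ κ N) (t, s, x) := hmax.isLocalMax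
    (prod_mem_nhds (Icc_mem_nhds ht0 (by linarith)) (prod_mem_nhds (Icc_mem_nhds hs0 hsT)
      (Icc_mem_nhds hxR.1 hxR.2)))
  have hmono := hθmono ht0.le
  have hNts : N * (-τ) ≤ N * (t - s) := by gcongr; exact hts.1.le
  exact false_of_isLocalMax_doubled (C := C) h₁ h₂ ht0 hs0 (hposAt hWsc) (hposAt hVsc) hW hV hθ
    hloc hη (by linarith [hθ' 0]) hN (by simp only [C]; linarith [hθ' t]) hκ.le
    (fun p z hz => hκ₁' p z (by linarith [hκ'.1.1])) fun p z hz => hκ₂' p z (by linarith [hκ'.1.2])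

/-- Comparison principle for flux-limited sub- and super-solutions. -/
theorem IsFluxSub.le_of_isFluxSuper {u v : ℝ → ℝ → ℝ} {u₀ : ℝ → ℝ}
    (h₁ : IsQuasiConvexHamiltonian H₁ p₁) (h₂ : IsQuasiConvexHamiltonian H₂ p₂) (hu₀ : IsBUC u₀)
    (hu : IsFluxSub H₁ H₂ p₁ p₂ A u) (hv : IsFluxSuper H₁ H₂ p₁ p₂ A v)
    (hugr : HasLinearGrowth u) (hvgr : HasLinearGrowth v)
    (hu0 : ∀ x, upperEnv u 0 x ≤ u₀ x) (hv0 : ∀ x, u₀ x ≤ lowerEnv v 0 x) {t : ℝ} (ht : 0 ≤ t)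
    (x : ℝ) : u t x ≤ v t x := by
  have key := add_nonpos_of_jets (A := A) (W := upperEnv u) (V := upperEnv fun t x => -v t x) h₁ h₂
    hu₀ hu.1.upperSemicontinuousOn hv.1.neg.upperSemicontinuousOn (fun t x ht => hu.jetSub ht x)
    (fun t x ht => by
      simpa only [JetSuper, lowerEnv_eq_neg, neg_neg] using hv.jetSuper ht x)
    (fun T hT => hugr.upperEnv_le hu.1 hT) (fun T hT => hvgr.neg.upperEnv_le hv.1.neg hT) hu0
    (fun x => by have := hv0 x; rw [lowerEnv_eq_neg] at this; linarith) ht x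
  have k1 := hu.1.le_upperEnv (x := x) ht
  have k2 := hv.1.neg.le_upperEnv (x := x) ht
  linarith

end comparison

/-! ### Existence by Perron's method -/

section separated

variable {α β : ℝ → ℝ} {t x l l' p p' q₁ q₂ r₁ r₂ : ℝ}

/-- On the two lines through the point the contact becomes one-dimensional: a critical point in
time, and one-sided difference quotients in space. -/
lemma UKink.of_separated (h : UKink (fun t x => α t + β x) t x l q₁ q₂) (hα : HasDerivAt α l' t)
    (hβ₁ : HasDerivWithinAt β r₁ (Iic x) x) (hβ₂ : HasDerivWithinAt β r₂ (Ici x) x) :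
    l = l' ∧ q₁ ≤ r₁ ∧ r₂ ≤ q₂ := by
  obtain ⟨a, ha, rfl, hmax⟩ := h
  have hspace : ∀ᶠ y in 𝓝 x, β y ≤ β x + kink q₁ q₂ (y - x) := by
    have := (Continuous.tendsto (f := fun y : ℝ => (t, y)) (by fun_prop) x).eventually hmax
    filter_upwards [this] with y hy
    simp only [sub_self, kink_zero] at hy
    linarith
  refine ⟨?_, ?_, ?_⟩
  · have h1 : IsLocalMax (fun s => α s - a s) t := by
      have := (Continuous.tendsto (f := fun s : ℝ => (s, x)) (by fun_prop) t).eventually hmax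
      filter_upwards [this] with s hs
      linarith
    have := h1.hasDerivAt_eq_zero (hα.sub (ha.differentiable one_ne_zero t).hasDerivAt)
    linarith
  · rw [← hasDerivWithinAt_Iio_iff_Iic, hasDerivWithinAt_iff_tendsto_slope' (by simp)] at hβ₁
    refine ge_of_tendsto hβ₁ ?_
    filter_upwards [self_mem_nhdsWithin, nhdsWithin_le_nhds hspace] with y hy hy'
    rw [mem_Iio] at hy
    rw [kink_of_nonpos (by linarith)] at hy'
    rw [slope_def_field, le_div_iff_of_neg (by linarith)]
    linarith
  · rw [← hasDerivWithinAt_Ioi_iff_Ici, hasDerivWithinAt_iff_tendsto_slope' (by simp)] at hβ₂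
    refine le_of_tendsto hβ₂ ?_
    filter_upwards [self_mem_nhdsWithin, nhdsWithin_le_nhds hspace] with y hy hy'
    rw [mem_Ioi] at hy
    rw [kink_of_nonneg (by linarith)] at hy'
    rw [slope_def_field, div_le_iff₀ (by linarith)]
    linarith

lemma UJet.of_separated (h : UJet (fun t x => α t + β x) t x l p) (hα : HasDerivAt α l' t)
    (hβ : HasDerivAt β p' x) : l = l' ∧ p = p' := by
  refine ⟨((h.ukink (sub_one_lt p) (lt_add_one p)).of_separated hα hβ.hasDerivWithinAt
    hβ.hasDerivWithinAt).1, le_antisymm ?_ ?_⟩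
  · refine le_of_forall_lt fun c hc => ?_
    obtain ⟨d, hd, hd'⟩ := exists_between hc
    exact hd.trans_le ((h.ukink hd' (lt_add_one p)).of_separated hα hβ.hasDerivWithinAt
      hβ.hasDerivWithinAt).2.1
  · refine le_of_forall_gt fun c hc => ?_
    obtain ⟨d, hd, hd'⟩ := exists_between hc
    exact ((h.ukink (sub_one_lt p) hd).of_separated hα hβ.hasDerivWithinAt
      hβ.hasDerivWithinAt).2.2.trans_lt hd'

end separated

/-! ### Perron's function and the bump construction. -/

section perron

variable {H₁ H₂ : ℝ → ℝ} {F : ℝ → ℝ → ℝ} {u₀ : ℝ → ℝ} {C : ℝ}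

/-- Whatever touches the larger function from above also touches the smaller one at a point of
contact. This is why maxima of sub-solutions are sub-solutions. -/
lemma JetSub.of_le {w W : ℝ → ℝ → ℝ} {t x : ℝ} (h : JetSub H₁ H₂ F W t x)
    (hle : ∀ᶠ z in 𝓝 (t, x), W z.1 z.2 ≤ w z.1 z.2) (heq : w t x ≤ W t x) :
    JetSub H₁ H₂ F w t x :=
  ⟨fun hx l p hj => h.1 hx l p (hj.congr hle heq), fun hx l p hj => h.2.1 hx l p (hj.congr hle heq),
    fun hx l q₁ q₂ hj => h.2.2 hx l q₁ q₂ (hj.congr hle heq)⟩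

/-- Sub-solutions lying below the barrier `u₀ + C t`. -/
def perronClass (H₁ H₂ : ℝ → ℝ) (F : ℝ → ℝ → ℝ) (u₀ : ℝ → ℝ) (C : ℝ) : Set (ℝ → ℝ → ℝ) :=
  {w | UpperSemicontinuousOn (fun z : ℝ × ℝ => w z.1 z.2) (Ici (0 : ℝ) ×ˢ univ) ∧
    (∀ t x, 0 < t → JetSub H₁ H₂ F w t x) ∧ ∀ t x, 0 ≤ t → w t x ≤ u₀ x + C * t}

/-- The largest sub-solution lying below the barrier `u₀ + C t`. -/
noncomputable def perron (H₁ H₂ : ℝ → ℝ) (F : ℝ → ℝ → ℝ) (u₀ : ℝ → ℝ) (C t x : ℝ) : ℝ :=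
  sSup ((fun w : ℝ → ℝ → ℝ => w t x) '' perronClass H₁ H₂ F u₀ C)

lemma le_perron {w : ℝ → ℝ → ℝ} (hw : w ∈ perronClass H₁ H₂ F u₀ C) {t x : ℝ} (ht : 0 ≤ t) :
    w t x ≤ perron H₁ H₂ F u₀ C t x :=
  le_csSup ⟨u₀ x + C * t, by rintro _ ⟨w, hw, rfl⟩; exact hw.2.2 t x ht⟩ (mem_image_of_mem _ hw)

lemma perron_le (hne : (perronClass H₁ H₂ F u₀ C).Nonempty) {t x : ℝ} (ht : 0 ≤ t) :
    perron H₁ H₂ F u₀ C t x ≤ u₀ x + C * t :=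
  csSup_le (hne.image _) (by rintro _ ⟨w, hw, rfl⟩; exact hw.2.2 t x ht)

/-- Replacing a sub-solution by its maximum with a local sub-solution. -/
lemma exists_mem_perronClass_ge {W b : ℝ → ℝ → ℝ} {z₀ : ℝ × ℝ} {r : ℝ}
    (hW : W ∈ perronClass H₁ H₂ F u₀ C) (hr : 0 < r)
    (hb : Continuous fun z : ℝ × ℝ => b z.1 z.2)
    (hjb : ∀ z ∈ Metric.ball z₀ r, JetSub H₁ H₂ F b z.1 z.2)
    (hbg : ∀ z ∈ Metric.ball z₀ r, b z.1 z.2 ≤ u₀ z.2 + C * z.1)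
    (hbW : ∀ z ∈ Metric.ball z₀ r, r / 2 < dist z z₀ → b z.1 z.2 ≤ W z.1 z.2) :
    ∃ w ∈ perronClass H₁ H₂ F u₀ C, ∀ z ∈ Metric.ball z₀ r, b z.1 z.2 ≤ w z.1 z.2 := by
  classical
  set w : ℝ → ℝ → ℝ := fun t x =>
    if (t, x) ∈ Metric.ball z₀ r then max (W t x) (b t x) else W t x with hw
  have hin : ∀ z ∈ Metric.ball z₀ r, w z.1 z.2 = max (W z.1 z.2) (b z.1 z.2) := fun z hz => if_pos hz
  have hin' : ∀ z ∈ Metric.ball z₀ r, ∀ᶠ y in 𝓝 z, w y.1 y.2 = max (W y.1 y.2) (b y.1 y.2) :=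
    fun z hz => by
      filter_upwards [Metric.isOpen_ball.mem_nhds hz] with y hy using hin y hy
  -- Outside the half ball `b ≤ W`, so the glued function coincides with `W` near the sphere and
  -- beyond.
  have hfar : ∀ z, r / 2 < dist z z₀ → w z.1 z.2 = W z.1 z.2 := fun z hz => by
    by_cases h : z ∈ Metric.ball z₀ r
    · rw [hin z h, max_eq_left (hbW z h hz)]
    · exact if_neg h
  have hout : ∀ z ∉ Metric.ball z₀ r, r / 2 < dist z z₀ := fun z hz => by
    rw [Metric.mem_ball, not_lt] at hz; linarith
  have hfar' : ∀ z ∉ Metric.ball z₀ r, ∀ᶠ y in 𝓝 z, w y.1 y.2 = W y.1 y.2 := fun z hz => by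
    have : Continuous fun y : ℝ × ℝ => dist y z₀ := by fun_prop
    filter_upwards [this.continuousAt.eventually (lt_mem_nhds (hout z hz))] with y hy
    exact hfar y hy
  refine ⟨w, ⟨?_, ?_, ?_⟩, fun z hz => by rw [hin z hz]; exact le_max_right _ _⟩
  · intro z hz c hc
    simp only at hc
    by_cases h : z ∈ Metric.ball z₀ r
    · rw [hin z h, max_lt_iff] at hc
      filter_upwards [hW.1 z hz c hc.1, nhdsWithin_le_nhds (hin' z h),
        nhdsWithin_le_nhds (hb.continuousAt.eventually (gt_mem_nhds hc.2))] with y h1 h2 h3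
      rw [h2]
      exact max_lt h1 h3
    · rw [hfar z (hout z h)] at hc
      filter_upwards [hW.1 z hz c hc, nhdsWithin_le_nhds (hfar' z h)] with y h1 h2
      rwa [h2]
  · intro t x ht
    have hWj := hW.2.1 t x ht
    by_cases h : (t, x) ∈ Metric.ball z₀ r
    · have he := hin _ h
      simp only at he
      rcases le_total (b t x) (W t x) with h' | h'
      · refine hWj.of_le ?_ (by rw [he, max_eq_left h'])
        filter_upwards [hin' _ h] with y hy
        rw [hy]; exact le_max_left _ _
      · refine (hjb _ h).of_le ?_ (by rw [he, max_eq_right h'])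
        filter_upwards [hin' _ h] with y hy
        rw [hy]; exact le_max_right _ _
    · refine hWj.of_le ?_ (hfar _ (hout _ h)).le
      filter_upwards [hfar' _ h] with y hy
      exact hy.ge
  · intro t x ht
    by_cases h : (t, x) ∈ Metric.ball z₀ r
    · have he := hin _ h
      simp only at he
      rw [he]
      exact max_le (hW.2.2 t x ht) (hbg _ h)
    · rw [hfar _ (hout _ h)]
      exact hW.2.2 t x ht

/-- No strict sub-solution touches the lower envelope of Perron's function from below. -/
lemma false_of_touching_perron {a k : ℝ → ℝ} {t₀ x₀ : ℝ}
    (hP : LocallyBdd (perron H₁ H₂ F u₀ C)) (hu₀ : Continuous u₀)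
    (hmem : upperEnv (perron H₁ H₂ F u₀ C) ∈ perronClass H₁ H₂ F u₀ C) (ht₀ : 0 < t₀)
    (ha : ContDiff ℝ 1 a) (hk : Continuous k)
    (hmax : IsLocalMax (fun z : ℝ × ℝ => -lowerEnv (perron H₁ H₂ F u₀ C) z.1 z.2 - a z.1 - k z.2)
      (t₀, x₀)) (hC : -deriv a t₀ < C)
    (hjet : ∀ᶠ z in 𝓝 (t₀, x₀), ∀ c,
      JetSub H₁ H₂ F (fun t x => c - a t - (t - t₀) ^ 2 + (-k x - (x - x₀) ^ 2)) z.1 z.2) :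
    False := by
  set U := perron H₁ H₂ F u₀ C
  have hne : (perronClass H₁ H₂ F u₀ C).Nonempty := ⟨_, hmem⟩
  have hlow : ∀ t x, 0 ≤ t → lowerEnv U t x ≤ U t x := fun t x ht => by
    have := hP.neg.le_upperEnv (x := x) ht
    rw [lowerEnv_eq_neg]; linarith
  have hac := ha.continuous
  set b₀ : ℝ × ℝ → ℝ := fun z => lowerEnv U t₀ x₀ + a t₀ + k x₀ - a z.1 - k z.2 with hb₀
  have hb₀c : Continuous b₀ := by fun_prop
  have hb₀le : ∀ᶠ z in 𝓝 (t₀, x₀), b₀ z ≤ lowerEnv U z.1 z.2 := by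
    filter_upwards [hmax] with z hz
    simp only [hb₀]; linarith
  -- If the lower envelope reached the barrier `u₀ + C t` here, the test function would touch the
  -- barrier along `x = x₀`, forcing `-deriv a t₀ = C`.
  have hgap : lowerEnv U t₀ x₀ < u₀ x₀ + C * t₀ := by
    refine lt_of_le_of_ne ((hlow t₀ x₀ ht₀.le).trans (perron_le hne ht₀.le)) fun heq => ?_
    have h1 : IsLocalMax (fun t => -a t - C * t) t₀ := by
      filter_upwards [(Continuous.tendsto (f := fun s : ℝ => (s, x₀)) (by fun_prop) t₀).eventually
        hb₀le, lt_mem_nhds ht₀] with s hs hs'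
      have h2 := hs.trans ((hlow s x₀ hs'.le).trans (perron_le hne hs'.le))
      simp only [hb₀] at h2
      linarith
    have h3 : HasDerivAt (fun t => -a t - C * t) (-deriv a t₀ - C * 1) t₀ :=
      (ha.differentiable one_ne_zero t₀).hasDerivAt.neg.sub ((hasDerivAt_id t₀).const_mul C)
    have := h1.hasDerivAt_eq_zero h3
    linarith
  obtain ⟨δ, hδ, hδ'⟩ := exists_between (sub_pos.2 hgap)
  have hbar : ∀ᶠ z : ℝ × ℝ in 𝓝 (t₀, x₀), b₀ z + δ < u₀ z.2 + C * z.1 := by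
    have h1 : Continuous fun z : ℝ × ℝ => u₀ z.2 + C * z.1 - b₀ z := by fun_prop
    have h2 : δ < u₀ x₀ + C * t₀ - b₀ (t₀, x₀) := by simp only [hb₀]; linarith
    filter_upwards [h1.continuousAt.eventually (lt_mem_nhds h2)] with z hz
    linarith
  obtain ⟨r', hr', hball⟩ := Metric.eventually_nhds_iff_ball.1 (hb₀le.and (hbar.and hjet))
  set r := min r' t₀
  have hr : 0 < r := lt_min hr' ht₀
  -- The test function, lowered by a paraboloid, is raised by `ε`: `δ` keeps it under the barrier,
  -- and `r ^ 2 / 4` is what the paraboloid takes away outside the half ball.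
  set ε := min δ (r ^ 2 / 4)
  have hε : 0 < ε := lt_min hδ (by positivity)
  have hsub : ∀ z ∈ Metric.ball (t₀, x₀) r, z ∈ Metric.ball (t₀, x₀) r' := fun z hz =>
    Metric.ball_subset_ball (min_le_left _ _) hz
  have hpos : ∀ z ∈ Metric.ball (t₀, x₀) r, 0 < z.1 := fun z hz => by
    rw [Metric.mem_ball, Prod.dist_eq, sup_lt_iff, Real.dist_eq] at hz
    have := (abs_lt.1 hz.1).1
    have : r ≤ t₀ := min_le_right _ _
    simp only at *
    linarith
  obtain ⟨w, hw, hbw⟩ := exists_mem_perronClass_ge (b := fun t x =>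
      (lowerEnv U t₀ x₀ + a t₀ + k x₀ + ε) - a t - (t - t₀) ^ 2 + (-k x - (x - x₀) ^ 2))
    (z₀ := (t₀, x₀)) hmem hr (by fun_prop)
    (fun z hz => (hball z (hsub z hz)).2.2 _) (fun z hz => by
      have h1 := (hball z (hsub z hz)).2.1
      have h2 : ε ≤ δ := min_le_left _ _
      have h3 := sq_nonneg (z.1 - t₀)
      have h4 := sq_nonneg (z.2 - x₀)
      simp only [hb₀] at h1
      linarith) (fun z hz hfar => by
      have h1 := (hball z (hsub z hz)).1
      have h2 : ε ≤ r ^ 2 / 4 := min_le_right _ _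
      have h3 := hlow z.1 z.2 (hpos z hz).le
      have h4 := hP.le_upperEnv (x := z.2) (hpos z hz).le
      have h5 : r ^ 2 / 4 ≤ (z.1 - t₀) ^ 2 + (z.2 - x₀) ^ 2 := by
        rw [Prod.dist_eq, lt_sup_iff, Real.dist_eq, Real.dist_eq] at hfar
        have e : r ^ 2 / 4 = (r / 2) ^ 2 := by ring
        have k3 := sq_nonneg (z.1 - t₀)
        have k4 := sq_nonneg (z.2 - x₀)
        rcases hfar with h | h
        · have := pow_le_pow_left₀ (by positivity) h.le 2
          rw [sq_abs] at this
          simp only at *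
          linarith
        · have := pow_le_pow_left₀ (by positivity) h.le 2
          rw [sq_abs] at this
          simp only at *
          linarith
      simp only [hb₀] at h1
      linarith)
  -- Perron's function dominates the raised bump, so its lower envelope at the centre would exceed
  -- itself by `ε`.
  have hfin : upperEnv (fun t x => -U t x) t₀ x₀ ≤ -(lowerEnv U t₀ x₀ + ε) := by
    have := hP.neg.upperEnv_le_of_le (t := t₀) (x := x₀) ht₀.le (g := fun z =>
      -((lowerEnv U t₀ x₀ + a t₀ + k x₀ + ε) - a z.1 - (z.1 - t₀) ^ 2 +
        (-k z.2 - (z.2 - x₀) ^ 2))) (by fun_prop) (by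
      refine nhdsWithin_le_nhds ?_
      filter_upwards [Metric.ball_mem_nhds _ hr] with z hz
      have h1 := hbw z hz
      have h2 := le_perron hw (t := z.1) (x := z.2) (hpos z hz).le
      linarith)
    simp only [sub_self] at this
    linarith
  have := lowerEnv_eq_neg U t₀ x₀
  linarith

end perron

/-! ### Barriers and the solution of the Cauchy problem. -/

section existence

variable {H₁ H₂ : ℝ → ℝ} {p₁ p₂ A : ℝ} {F : ℝ → ℝ → ℝ} {u₀ : ℝ → ℝ} {C : ℝ}

/-- A function with separated variables is a sub-solution at a point of differentiability if its
gradient is admissible there. -/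
lemma jetSub_separated {α β : ℝ → ℝ} {t x l p : ℝ} (hα : HasDerivAt α l t)
    (hβ : HasDerivAt β p x) (h₁ : x < 0 → l + H₁ p ≤ 0) (h₂ : 0 < x → l + H₂ p ≤ 0)
    (hF : x = 0 → ∀ q₁ q₂, q₁ ≤ p → p ≤ q₂ → l + F q₁ q₂ ≤ 0) :
    JetSub H₁ H₂ F (fun t x => α t + β x) t x := by
  refine ⟨fun hx l' p' hj => ?_, fun hx l' p' hj => ?_, fun hx l' q₁ q₂ hk => ?_⟩
  · obtain ⟨rfl, rfl⟩ := hj.of_separated hα hβ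
    exact h₁ hx
  · obtain ⟨rfl, rfl⟩ := hj.of_separated hα hβ
    exact h₂ hx
  · obtain ⟨rfl, k1, k2⟩ := hk.of_separated hα hβ.hasDerivWithinAt hβ.hasDerivWithinAt
    exact hF hx q₁ q₂ k1 k2

/-- Smooth cones `u₀ y - ε - K * softAbs (x - y) - c * t` do this: their slopes are bounded, so one
speed `c` suffices for all `y`, and the modulus of `u₀` keeps them below the datum. They make
Perron's class nonempty and force its supremum to attain the datum. -/
lemma exists_barrier_mem_perronClass (h₁ : IsQuasiConvexHamiltonian H₁ p₁)
    (h₂ : IsQuasiConvexHamiltonian H₂ p₂) (hu₀ : IsBUC u₀) (hC : 0 ≤ C) {ε : ℝ} (hε : 0 < ε) :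
    ∃ c, 0 ≤ c ∧ ∀ y, ∃ w ∈ perronClass H₁ H₂ (fluxFun H₁ H₂ p₁ p₂ A) u₀ C,
      ∀ t, w t y = u₀ y - ε - c * t := by
  obtain ⟨K, hK0, -, hK⟩ := hu₀.exists_modulus hε 0
  have hflux := continuous_fluxFun (p₁ := p₁) (p₂ := p₂) (A := A) h₁.continuous h₂.continuous
  obtain ⟨c₁, hc₁, hc₁'⟩ := exists_lower_bound h₁.continuous.neg K
  obtain ⟨c₂, hc₂, hc₂'⟩ := exists_lower_bound h₂.continuous.neg K
  obtain ⟨c₃, hc₃, hc₃'⟩ := exists_lower_bound₂ (F := fun q₁ q₂ => -fluxFun H₁ H₂ p₁ p₂ A q₁ q₂) hflux.neg K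
  refine ⟨c₁ + c₂ + c₃, by positivity, fun y => ⟨fun t x => (u₀ y - ε - (c₁ + c₂ + c₃) * t) +
    -(K * softAbs (x - y)), ⟨?_, fun t x ht => ?_, fun t x ht => ?_⟩, fun t => by simp⟩⟩
  · have hs := contDiff_softAbs.continuous
    refine Continuous.continuousOn ?_ |>.upperSemicontinuousOn
    fun_prop
  · have hα : HasDerivAt (fun t => u₀ y - ε - (c₁ + c₂ + c₃) * t) (-(c₁ + c₂ + c₃)) t :=
      (((hasDerivAt_id t).const_mul (c₁ + c₂ + c₃)).const_sub (u₀ y - ε)).congr_deriv (by ring)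
    have hβ : HasDerivAt (fun x => -(K * softAbs (x - y))) (-(K * deriv softAbs (x - y))) x := by
      have h1 := (contDiff_softAbs.differentiable one_ne_zero (x - y)).hasDerivAt
      have h2 := ((h1.comp (h := fun x => x - y) x ((hasDerivAt_id x).sub_const y)).const_mul K).neg
      exact h2.congr_deriv (by ring)
    have hp : |-(K * deriv softAbs (x - y))| ≤ K := by
      rw [abs_neg, abs_mul, abs_of_pos hK0]
      exact mul_le_of_le_one_right hK0.le (abs_deriv_softAbs_le _)
    refine jetSub_separated hα hβ (fun _ => ?_) (fun _ => ?_) fun _ q₁ q₂ k1 k2 => ?_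
    · have := hc₁' _ hp
      rw [Pi.neg_apply] at this
      linarith
    · have := hc₂' _ hp
      rw [Pi.neg_apply] at this
      linarith
    · have := hc₃' _ _ hp hp
      have := fluxFun_mono (A := A) h₁.isQuasiConvex h₂.isQuasiConvex k1 k2
      linarith
  · have h1 := hK y x
    rw [← neg_sub x y, softAbs_neg] at h1
    have h2 : 0 ≤ C * t := by positivity
    have h3 : 0 ≤ (c₁ + c₂ + c₃) * t := by positivity
    simp only
    linarith

/-- Perron's function solves the Cauchy problem. -/
theorem exists_isFluxCauchySol (h₁ : IsQuasiConvexHamiltonian H₁ p₁)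
    (h₂ : IsQuasiConvexHamiltonian H₂ p₂) (A : ℝ) (hu₀ : IsBUC u₀) :
    ∃ U, IsFluxCauchySol H₁ H₂ p₁ p₂ A u₀ U ∧
      ∀ ε > 0, ∃ c, 0 ≤ c ∧ ∀ t x, 0 ≤ t → u₀ x - ε - c * t ≤ U t x := by
  -- `-C` is below `A` and both minima, so a violated super-solution inequality gives `-deriv a t₀ <
  -- C`, as needed in `false_of_touching_perron`.
  set C := |A| + |H₁ p₁| + |H₂ p₂|
  have hC : 0 ≤ C := by positivity
  have hCA : -C ≤ A := by
    have := neg_abs_le A; have := abs_nonneg (H₁ p₁); have := abs_nonneg (H₂ p₂)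
    simp only [C]; linarith
  have hC₁ : ∀ p, -C ≤ H₁ p := fun p => by
    have := neg_abs_le (H₁ p₁); have := abs_nonneg A; have := abs_nonneg (H₂ p₂)
    have := h₁.isQuasiConvex.min_le p
    simp only [C]; linarith
  have hC₂ : ∀ p, -C ≤ H₂ p := fun p => by
    have := neg_abs_le (H₂ p₂); have := abs_nonneg A; have := abs_nonneg (H₁ p₁)
    have := h₂.isQuasiConvex.min_le p
    simp only [C]; linarith
  have hbar := fun {ε : ℝ} (hε : 0 < ε) =>
    exists_barrier_mem_perronClass (A := A) h₁ h₂ hu₀ hC hε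
  set S := perronClass H₁ H₂ (fluxFun H₁ H₂ p₁ p₂ A) u₀ C
  set U := perron H₁ H₂ (fluxFun H₁ H₂ p₁ p₂ A) u₀ C
  have hne : S.Nonempty := by
    obtain ⟨c, -, h⟩ := hbar one_pos
    obtain ⟨w, hw, -⟩ := h 0
    exact ⟨w, hw⟩
  have hlow : ∀ ε > 0, ∃ c, 0 ≤ c ∧ ∀ t x, 0 ≤ t → u₀ x - ε - c * t ≤ U t x := fun ε hε => by
    obtain ⟨c, hc, h⟩ := hbar hε
    refine ⟨c, hc, fun t x ht => ?_⟩
    obtain ⟨w, hw, hwx⟩ := h x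
    rw [← hwx t]
    exact le_perron hw ht
  have hup : ∀ t x, 0 ≤ t → U t x ≤ u₀ x + C * t := fun t x ht => perron_le hne ht
  have hcont : Continuous u₀ := hu₀.2.continuous
  obtain ⟨B, hB⟩ := hu₀.1
  obtain ⟨c, hc, hcU⟩ := hlow 1 one_pos
  have habs : ∀ T t x, 0 ≤ t → t ≤ T → |U t x| ≤ B + 1 + (c + C) * T := fun T t x ht htT => by
    have k1 := hcU t x ht
    have k2 := hup t x ht
    have k3 := abs_le.1 (hB x)
    have k4 : c * t ≤ c * T := by gcongr
    have k5 : C * t ≤ C * T := by gcongr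
    have k6 : 0 ≤ c * t := by positivity
    have k7 : 0 ≤ C * t := by positivity
    rw [abs_le]; constructor <;> linarith
  have hbdd : LocallyBdd U := fun t x ht => by
    refine ⟨B + 1 + (c + C) * (t + 1), ?_⟩
    filter_upwards [self_mem_nhdsWithin, nhdsWithin_le_nhds
      (continuousAt_fst.eventually (gt_mem_nhds (show t < t + 1 by linarith)))] with z hz hz'
    exact habs _ _ _ hz.1 (le_of_lt hz')
  have hsub : IsFluxSub H₁ H₂ p₁ p₂ A U := by
    refine IsFluxSub.of_family (𝓕 := S) h₁ h₂ hbdd (fun w hw t x ht c hc => ?_)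
      (fun w hw t x ht => hw.2.1 t x ht)
      (fun w hw t x ht => (le_perron hw ht.le).trans (hbdd.le_upperEnv ht.le))
      fun t x ht ε hε => ?_
    · have := hw.1 (t, x) (mem_domain_self ht.le) c hc
      rwa [nhdsWithin_domain ht] at this
    · have h := hbdd.frequently_lt (x := x) ht.le (sub_lt_self _ hε)
      rw [nhdsWithin_domain ht] at h
      refine h.mono fun z hz => ?_
      obtain ⟨_, ⟨w, hw, rfl⟩, hlt⟩ := exists_lt_of_lt_csSup (hne.image _) hz
      exact ⟨w, hw, hlt⟩
  have henv : ∀ t x, 0 ≤ t → upperEnv U t x ≤ u₀ x + C * t := fun t x ht => by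
    refine hbdd.upperEnv_le_of_le ht (g := fun z => u₀ z.2 + C * z.1) (by fun_prop) ?_
    filter_upwards [self_mem_nhdsWithin] with z hz
    exact hup _ _ hz.1
  have hmem : upperEnv U ∈ S :=
    ⟨hbdd.upperSemicontinuousOn, fun t x ht => hsub.jetSub ht x, henv⟩
  have hderiv : ∀ {a : ℝ → ℝ}, ContDiff ℝ 1 a → ∀ c t₀ t,
      HasDerivAt (fun t => c - a t - (t - t₀) ^ 2) (-deriv a t - 2 * (t - t₀)) t := by
    intro a ha c t₀ t
    have e1 := (ha.differentiable one_ne_zero t).hasDerivAt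
    have e2 : HasDerivAt (fun t : ℝ => (t - t₀) ^ 2) (2 * (t - t₀)) t := by
      simpa using ((hasDerivAt_id t).sub_const t₀).fun_pow 2
    exact ((e1.const_sub c).sub e2)
  have hderiv' : ∀ {g : ℝ → ℝ} {p x₀ x : ℝ}, HasDerivAt g p x →
      HasDerivAt (fun x => -g x - (x - x₀) ^ 2) (-p - 2 * (x - x₀)) x := by
    intro g p x₀ x hg
    have e2 : HasDerivAt (fun x : ℝ => (x - x₀) ^ 2) (2 * (x - x₀)) x := by
      simpa using ((hasDerivAt_id x).sub_const x₀).fun_pow 2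
    exact hg.neg.sub e2
  have hca : ∀ {a : ℝ → ℝ}, ContDiff ℝ 1 a → Continuous (deriv a) := fun ha =>
    ha.continuous_deriv le_rfl
  have hsuper : IsFluxSuper H₁ H₂ p₁ p₂ A U := by
    refine IsFluxSuper.of_jetSuper h₁ h₂ hbdd fun t₀ x₀ ht₀ => ⟨fun hx l p hj => ?_,
      fun hx l p hj => ?_, fun hx l q₁ q₂ hk => ?_⟩
    · by_contra! hcon
      obtain ⟨a, g, ha, hg, rfl, rfl, hmax⟩ := hj
      refine false_of_touching_perron hbdd hcont hmem ht₀ ha hg.continuous hmax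
        (by linarith [hC₁ (-deriv g x₀)]) ?_
      have hcl : Continuous fun z : ℝ × ℝ => -deriv a z.1 - 2 * (z.1 - t₀) +
          H₁ (-deriv g z.2 - 2 * (z.2 - x₀)) := by
        have := hca ha; have := hca hg; have := h₁.continuous; fun_prop
      have h0 : -deriv a t₀ - 2 * (t₀ - t₀) + H₁ (-deriv g x₀ - 2 * (x₀ - x₀)) < 0 := by
        rw [sub_self, sub_self, mul_zero, sub_zero, sub_zero]; linarith
      filter_upwards [hcl.continuousAt.eventually (gt_mem_nhds h0),
        continuousAt_snd.eventually (gt_mem_nhds hx)] with z hz hz' c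
      exact jetSub_separated (hderiv ha c t₀ z.1)
        (hderiv' (hg.differentiable one_ne_zero z.2).hasDerivAt) (fun _ => le_of_lt hz)
        (fun h => absurd hz' h.not_gt) fun h => absurd h (ne_of_lt hz')
    · by_contra! hcon
      obtain ⟨a, g, ha, hg, rfl, rfl, hmax⟩ := hj
      refine false_of_touching_perron hbdd hcont hmem ht₀ ha hg.continuous hmax
        (by linarith [hC₂ (-deriv g x₀)]) ?_
      have hcl : Continuous fun z : ℝ × ℝ => -deriv a z.1 - 2 * (z.1 - t₀) +
          H₂ (-deriv g z.2 - 2 * (z.2 - x₀)) := by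
        have := hca ha; have := hca hg; have := h₂.continuous; fun_prop
      have h0 : -deriv a t₀ - 2 * (t₀ - t₀) + H₂ (-deriv g x₀ - 2 * (x₀ - x₀)) < 0 := by
        rw [sub_self, sub_self, mul_zero, sub_zero, sub_zero]; linarith
      filter_upwards [hcl.continuousAt.eventually (gt_mem_nhds h0),
        continuousAt_snd.eventually (lt_mem_nhds hx)] with z hz hz' c
      exact jetSub_separated (hderiv ha c t₀ z.1)
        (hderiv' (hg.differentiable one_ne_zero z.2).hasDerivAt)
        (fun h => absurd hz' h.not_gt) (fun _ => le_of_lt hz)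
        fun h => absurd h (ne_of_gt hz')
    · subst hx
      by_contra! hcon
      -- With these slopes the flux is the same and dominates both Hamiltonians, so the lowered test
      -- function is a strict sub-solution on the two sides as well as at the junction.
      set r₁ := max (-q₁) p₁
      set r₂ := min (-q₂) p₂
      have hF : max A (max (H₁ r₁) (H₂ r₂)) = fluxFun H₁ H₂ p₁ p₂ A (-q₁) (-q₂) := by
        rw [fluxFun, incPart_eq, decPart_eq]
      have hF' : fluxFun H₁ H₂ p₁ p₂ A r₁ r₂ = max A (max (H₁ r₁) (H₂ r₂)) := by
        rw [fluxFun, incPart_eq, decPart_eq, max_eq_left (le_max_right _ _),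
          min_eq_left (min_le_right _ _)]
      have hk' := hk.mono (r₁ := -r₁) (r₂ := -r₂) (by linarith [le_max_left (-q₁) p₁])
        (by linarith [min_le_left (-q₂) p₂])
      obtain ⟨a, ha, rfl, hmax⟩ := hk'
      have hlt : -deriv a t₀ + max A (max (H₁ r₁) (H₂ r₂)) < 0 := by rw [hF]; linarith
      simp only [sub_zero] at hmax
      refine false_of_touching_perron hbdd hcont hmem ht₀ ha (continuous_kink (-r₁) (-r₂)) hmax
        (by linarith [le_max_left A (max (H₁ r₁) (H₂ r₂))]) ?_
      have hcl : Continuous fun z : ℝ × ℝ => -deriv a z.1 - 2 * (z.1 - t₀) +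
          max A (max (H₁ (r₁ - 2 * z.2)) (H₂ (r₂ - 2 * z.2))) := by
        have := hca ha; have := h₁.continuous; have := h₂.continuous; fun_prop
      have h0 : -deriv a t₀ - 2 * (t₀ - t₀) +
          max A (max (H₁ (r₁ - 2 * 0)) (H₂ (r₂ - 2 * 0))) < 0 := by
        rw [sub_self, mul_zero, sub_zero, sub_zero, sub_zero]; exact hlt
      filter_upwards [hcl.continuousAt.eventually (gt_mem_nhds h0)] with z hz c
      obtain ⟨t, x⟩ := z
      have hz₁ := (le_max_left (H₁ (r₁ - 2 * x)) (H₂ (r₂ - 2 * x))).trans (le_max_right A _)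
      have hz₂ := (le_max_right (H₁ (r₁ - 2 * x)) (H₂ (r₂ - 2 * x))).trans (le_max_right A _)
      simp only at hz ⊢
      have hβ₁ : ∀ y ≤ 0, HasDerivWithinAt (fun x => -kink (-r₁) (-r₂) x - (x - 0) ^ 2)
          (r₁ - 2 * y) (Iic 0) y := by
        intro y hy
        have e1 := (hderiv' (x₀ := 0) ((hasDerivAt_id y).const_mul (-r₁))).hasDerivWithinAt
          (s := Iic 0)
        refine (e1.congr (fun x hx => ?_) ?_).congr_deriv (by ring)
        · rw [kink_of_nonpos hx]; rfl
        · rw [kink_of_nonpos hy]; rfl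
      have hβ₂ : ∀ y ≥ 0, HasDerivWithinAt (fun x => -kink (-r₁) (-r₂) x - (x - 0) ^ 2)
          (r₂ - 2 * y) (Ici 0) y := by
        intro y hy
        have e1 := (hderiv' (x₀ := 0) ((hasDerivAt_id y).const_mul (-r₂))).hasDerivWithinAt
          (s := Ici 0)
        refine (e1.congr (fun x hx => ?_) ?_).congr_deriv (by ring)
        · rw [kink_of_nonneg hx]; rfl
        · rw [kink_of_nonneg hy]; rfl
      rcases lt_trichotomy x 0 with hx | rfl | hx
      · exact jetSub_separated (hderiv ha c t₀ t)
          ((hβ₁ x hx.le).hasDerivAt (Iic_mem_nhds hx)) (fun _ => by linarith)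
          (fun h => absurd hx h.not_gt) fun h => absurd h hx.ne
      · refine ⟨fun h => absurd h (lt_irrefl 0), fun h => absurd h (lt_irrefl 0),
          fun _ l s₁ s₂ hk => ?_⟩
        obtain ⟨rfl, k1, k2⟩ := hk.of_separated (hderiv ha c t₀ t) (hβ₁ 0 le_rfl) (hβ₂ 0 le_rfl)
        rw [mul_zero, sub_zero] at k1 k2
        rw [mul_zero, sub_zero, sub_zero, ← hF'] at hz
        have := fluxFun_mono (A := A) h₁.isQuasiConvex h₂.isQuasiConvex k1 k2
        linarith
      · exact jetSub_separated (hderiv ha c t₀ t)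
          ((hβ₂ x hx.le).hasDerivAt (Ici_mem_nhds hx)) (fun h => absurd hx h.not_gt)
          (fun _ => by linarith) fun h => absurd h hx.ne'
  refine ⟨U, ⟨⟨hsub, hsuper⟩, fun x => ⟨by simpa using henv 0 x le_rfl, ?_⟩, fun T hT => ?_⟩, hlow⟩
  · refine le_of_forall_pos_le_add fun ε hε => ?_
    obtain ⟨c, hc, h⟩ := hlow ε hε
    have := hbdd.neg.upperEnv_le_of_le (t := 0) (x := x) le_rfl
      (g := fun z => -u₀ z.2 + ε + c * z.1) (by fun_prop) (by
        filter_upwards [self_mem_nhdsWithin] with z hz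
        have := h z.1 z.2 hz.1
        linarith)
    rw [lowerEnv_eq_neg]
    simp only [mul_zero] at this
    linarith
  · refine ⟨B + 1 + (c + C) * T, fun t x ht htT => (habs T t x ht htT.le).trans ?_⟩
    have hB0 : 0 ≤ B := (abs_nonneg _).trans (hB 0)
    exact le_mul_of_one_le_right (by positivity) (by linarith [abs_nonneg x])

end existence

/-! ### The junction values of flux-limited solutions -/

section junction

variable {H₁ H₂ : ℝ → ℝ} {p₁ p₂ A : ℝ} {u₀ : ℝ → ℝ}

/-- A flux limiter bounds sub-solutions from above at the junction. -/
lemma IsFluxSub.le_neg_mul {U : ℝ → ℝ → ℝ} (h₁ : IsQuasiConvexHamiltonian H₁ p₁)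
    (h₂ : IsQuasiConvexHamiltonian H₂ p₂) (hU : IsFluxSub H₁ H₂ p₁ p₂ A U)
    (hgr : HasLinearGrowth U) (h0 : ∀ x, upperEnv U 0 x ≤ u₀ x) {K : ℝ}
    (hu₀ : ∀ x, |x| ≤ 1 → u₀ x ≤ K * |x|) {t : ℝ} (ht : 0 ≤ t) (ht1 : t < 1) :
    U t 0 ≤ -(A * t) := by
  obtain ⟨B, hB⟩ := hgr.upperEnv_le hU.1 one_pos
  -- The barrier is `-A t + N |x|`: `N` makes both Hamiltonians at least `A` at its slopes, lies
  -- above the datum, and beats the growth of `U` at `|x| = 1`.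
  obtain ⟨N, hN₂, hN₁, hNK, hNB⟩ := (((tendsto_atTop_of_cocompact h₂.coercive).eventually
    (eventually_ge_atTop A)).and (((tendsto_atBot_of_cocompact h₁.coercive).comp
    tendsto_neg_atTop_atBot |>.eventually (eventually_ge_atTop A)).and
    ((eventually_ge_atTop K).and (eventually_ge_atTop (B * 2 + |A|))))).exists
  simp only [Function.comp_apply] at hN₁
  have habs : ∀ x, kink (-N) N x = N * |x| := fun x => by
    rcases le_total x 0 with h | h
    · rw [kink_of_nonpos h, abs_of_nonpos h]; ring
    · rw [kink_of_nonneg h, abs_of_nonneg h]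
  have hside : ∀ t ∈ Icc (0 : ℝ) 1, ∀ x, |x| = 1 →
      upperEnv U t x + (A * t - kink (-N) N x) ≤ 0 := fun t ht x hx => by
    have k1 := hB t x ht.1 ht.2
    rw [hx] at k1
    rw [habs, hx]
    have k2 : A * t ≤ |A| * 1 := by
      apply mul_le_mul (le_abs_self A) ht.2 ht.1 (abs_nonneg A)
    linarith
  have hkc := continuous_kink (-N) N
  have key := nonpos_of_no_localMax (f := fun z : ℝ × ℝ => upperEnv U z.1 z.2 +
    (A * z.1 - kink (-N) N z.2)) (T := 1) (c := -1) (d := 1) ?_ ?_ (fun t ht => hside t ht _ (by simp))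
    (fun t ht => hside t ht _ (by simp)) ?_ ht ht1 (x := 0) ⟨by norm_num, by norm_num⟩
  · simp only [kink_zero] at key
    have := hU.1.le_upperEnv (x := 0) ht
    linarith
  · have h3 : Continuous fun z : ℝ × ℝ => A * z.1 - kink (-N) N z.2 := by fun_prop
    exact (hU.1.upperSemicontinuousOn.mono (prod_mono Icc_subset_Ici_self (subset_univ _))).add
      h3.continuousOn.upperSemicontinuousOn
  · intro x hx
    have k1 := h0 x
    have k2 := hu₀ x (abs_le.2 hx)
    have k3 : K * |x| ≤ N * |x| := by gcongr
    simp only [habs]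
    linarith
  · intro a ha ha' t ht x hx hmax
    have hl : HasDerivAt (fun t => a t - A * t) (deriv a t - A) t :=
      ((ha.differentiable one_ne_zero t).hasDerivAt.sub ((hasDerivAt_id t).const_mul A)).congr_deriv
        (by ring)
    have hat := ha' t
    have hJ := hU.jetSub ht.1 x
    rcases lt_trichotomy x 0 with hx0 | rfl | hx0
    · have hj : UJet (upperEnv U) t x (deriv a t - A) (-N) := by
        refine ⟨fun t => a t - A * t, fun x => -N * x, by fun_prop, by fun_prop, hl.deriv, ?_, ?_⟩
        · simp
        · filter_upwards [hmax, continuousAt_snd.eventually (gt_mem_nhds hx0)] with z hz hz'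
          rw [kink_of_nonpos hx0.le, kink_of_nonpos (le_of_lt hz')] at hz
          linarith
      have := hJ.1 hx0 _ _ hj
      linarith
    · have hk : UKink (upperEnv U) t 0 (deriv a t - A) (-N) N := by
        refine ⟨fun t => a t - A * t, by fun_prop, hl.deriv, ?_⟩
        filter_upwards [hmax] with z hz
        simp only [sub_zero] at hz ⊢
        linarith
      have := hJ.2.2 rfl _ _ _ hk
      have : A ≤ fluxFun H₁ H₂ p₁ p₂ A (-N) N := le_max_left _ _
      linarith
    · have hj : UJet (upperEnv U) t x (deriv a t - A) N := by
        refine ⟨fun t => a t - A * t, fun x => N * x, by fun_prop, by fun_prop, hl.deriv, ?_, ?_⟩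
        · simp
        · filter_upwards [hmax, continuousAt_snd.eventually (lt_mem_nhds hx0)] with z hz hz'
          rw [kink_of_nonneg hx0.le, kink_of_nonneg (le_of_lt hz')] at hz
          linarith
      have := hJ.2.1 hx0 _ _ hj
      linarith

/-- The junction values of a super-solution whose datum has minimal slopes. -/
lemma IsFluxSuper.exists_neg_mul_le {U : ℝ → ℝ → ℝ} (h₁ : IsQuasiConvexHamiltonian H₁ p₁)
    (h₂ : IsQuasiConvexHamiltonian H₂ p₂) (hU : IsFluxSuper H₁ H₂ p₁ p₂ A U)
    (hlow : ∀ ε > 0, ∃ c, 0 ≤ c ∧ ∀ t x, 0 ≤ t → u₀ x - ε - c * t ≤ U t x)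
    (hu₀c : Continuous u₀) (hu₀ : ∀ x, |x| ≤ 1 → u₀ x = kink p₁ p₂ x) (hA₁ : H₁ p₁ ≤ A)
    (hA₂ : H₂ p₂ ≤ A) {δ : ℝ} (hδ : 0 < δ) :
    ∃ τ > 0, ∀ t, 0 ≤ t → t < τ → -((A + δ) * t) ≤ U t 0 := by
  set V : ℝ → ℝ → ℝ := upperEnv fun t x => -U t x
  have hVle : ∀ ε > 0, ∃ c, 0 ≤ c ∧ ∀ t x, 0 ≤ t → V t x ≤ -u₀ x + ε + c * t := fun ε hε => by
    obtain ⟨c, hc, h⟩ := hlow ε hε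
    refine ⟨c, hc, fun t x ht => hU.1.neg.upperEnv_le_of_le ht
      (g := fun z => -u₀ z.2 + ε + c * z.1) (by fun_prop) ?_⟩
    filter_upwards [self_mem_nhdsWithin] with z hz
    have := h z.1 z.2 hz.1
    linarith
  have hjet : ∀ t x, 0 < t → JetSub (fun p => -H₁ (-p)) (fun p => -H₂ (-p))
      (fun q₁ q₂ => -fluxFun H₁ H₂ p₁ p₂ A (-q₁) (-q₂)) V t x := fun t x ht => by
    simpa only [JetSuper, lowerEnv_eq_neg, neg_neg] using hU.jetSuper ht x
  obtain ⟨r₁, hr₁, hr₁'⟩ := Metric.eventually_nhds_iff.1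
    (h₁.continuous.continuousAt.eventually (gt_mem_nhds (show H₁ p₁ < A + δ by linarith)))
  obtain ⟨r₂, hr₂, hr₂'⟩ := Metric.eventually_nhds_iff.1
    (h₂.continuous.continuousAt.eventually (gt_mem_nhds (show H₂ p₂ < A + δ by linarith)))
  obtain ⟨r, hr, hr'⟩ := exists_between (lt_min one_pos (half_pos (lt_min hr₁ hr₂)))
  rw [lt_min_iff] at hr'
  have hH₁ : ∀ y, |y| ≤ r → H₁ (p₁ + 2 * y) < A + δ := fun y hy => by
    refine hr₁' ?_
    rw [Real.dist_eq, add_sub_cancel_left, abs_mul, abs_two]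
    linarith [min_le_left r₁ r₂]
  have hH₂ : ∀ y, |y| ≤ r → H₂ (p₂ + 2 * y) < A + δ := fun y hy => by
    refine hr₂' ?_
    rw [Real.dist_eq, add_sub_cancel_left, abs_mul, abs_two]
    linarith [min_le_right r₁ r₂]
  -- The barrier from below is `kink p₁ p₂ x - x² - (A + δ) t`. At `|x| = r` it has lost `r ^ 2`:
  -- one half pays for the error in the datum, the other for the drift, at most `D t`.
  obtain ⟨c, hc, hcV⟩ := hVle (r ^ 2 / 2) (by positivity)
  set D := c + |A + δ| + 1
  have hD : 0 < D := by positivity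
  refine ⟨r ^ 2 / 2 / D, by positivity, fun t ht htτ => ?_⟩
  have hside : ∀ t ∈ Icc 0 (r ^ 2 / 2 / D), ∀ x, |x| = r →
      V t x + (-((A + δ) * t) + kink p₁ p₂ x - x ^ 2) ≤ 0 := fun t ht x hx => by
    have k1 := hcV t x ht.1
    rw [hu₀ x (by linarith)] at k1
    have k2 : x ^ 2 = r ^ 2 := by rw [← hx, sq_abs]
    have k3 : t * D ≤ r ^ 2 / 2 := (le_div_iff₀ hD).1 ht.2
    have k4 : -(A + δ) * t ≤ |A + δ| * t := mul_le_mul_of_nonneg_right (neg_le_abs _) ht.1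
    have k5 : t * D = c * t + |A + δ| * t + t := by simp only [D]; ring
    have := ht.1
    linarith
  have hkc := continuous_kink p₁ p₂
  have key := nonpos_of_no_localMax (f := fun z : ℝ × ℝ => V z.1 z.2 +
    (-((A + δ) * z.1) + kink p₁ p₂ z.2 - z.2 ^ 2)) (T := r ^ 2 / 2 / D) (c := -r) (d := r) ?_ ?_
    (fun t ht => hside t ht _ (by rw [abs_neg, abs_of_pos hr]))
    (fun t ht => hside t ht _ (abs_of_pos hr)) ?_ ht htτ (x := 0) ⟨by linarith, hr.le⟩
  · simp only [kink_zero] at key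
    have := hU.1.neg.le_upperEnv (x := 0) ht
    have : V t 0 = upperEnv (fun t x => -U t x) t 0 := rfl
    linarith
  · have h3 : Continuous fun z : ℝ × ℝ => -((A + δ) * z.1) + kink p₁ p₂ z.2 - z.2 ^ 2 := by
      fun_prop
    exact (hU.1.neg.upperSemicontinuousOn.mono
      (prod_mono Icc_subset_Ici_self (subset_univ _))).add h3.continuousOn.upperSemicontinuousOn
  · intro x hx
    have k1 : V 0 x ≤ -u₀ x := le_of_forall_pos_le_add fun ε hε => by
      obtain ⟨c, -, h⟩ := hVle ε hε
      simpa using h 0 x le_rfl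
    rw [hu₀ x ((abs_le.2 hx).trans hr'.1.le)] at k1
    simp only [mul_zero]
    linarith [sq_nonneg x]
  · intro a ha ha' t ht x hx hmax
    have hl : HasDerivAt (fun t => a t + (A + δ) * t) (deriv a t + (A + δ)) t :=
      ((ha.differentiable one_ne_zero t).hasDerivAt.add
        ((hasDerivAt_id t).const_mul (A + δ))).congr_deriv (by ring)
    have hat := ha' t
    have hsq : ∀ q, HasDerivAt (fun x => -(q * x) + x ^ 2) (-(q + 2 * -x)) x := fun q => by
      have e2 : HasDerivAt (fun x : ℝ => x ^ 2) (2 * x) x := by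
        simpa using (hasDerivAt_id x).fun_pow 2
      exact (((hasDerivAt_id x).const_mul q).neg.add e2).congr_deriv (by ring)
    have hxr : |-x| ≤ r := by rw [abs_neg]; exact abs_le.2 (Ioo_subset_Icc_self hx)
    have hJ := hjet t x ht.1
    rcases lt_trichotomy x 0 with hx0 | rfl | hx0
    · have hj : UJet V t x (deriv a t + (A + δ)) (-(p₁ + 2 * -x)) := by
        refine ⟨fun t => a t + (A + δ) * t, fun x => -(p₁ * x) + x ^ 2, by fun_prop, by fun_prop,
          hl.deriv, (hsq p₁).deriv, ?_⟩
        filter_upwards [hmax, continuousAt_snd.eventually (gt_mem_nhds hx0)] with z hz hz'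
        rw [kink_of_nonpos hx0.le, kink_of_nonpos (le_of_lt hz')] at hz
        linarith
      have k1 := hJ.1 hx0 _ _ hj
      simp only [neg_neg] at k1
      linarith [hH₁ _ hxr]
    · have hk : UKink (fun t x => V t x - x ^ 2) t 0 (deriv a t + (A + δ)) (-p₁) (-p₂) := by
        refine ⟨fun t => a t + (A + δ) * t, by fun_prop, hl.deriv, ?_⟩
        filter_upwards [hmax] with z hz
        have k1 := kink_neg p₁ p₂ z.2
        simp only [sub_zero, kink_zero] at hz ⊢
        linarith
      have k1 := hJ.2.2 rfl _ _ _ (hk.of_sub_space (by simpa using (hasDerivAt_id (0 : ℝ)).fun_pow 2)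
        (show 0 < 2 * r by positivity))
      have k2 := hH₁ r (abs_of_pos hr).le
      have k3 := hH₂ (-r) (by rw [abs_neg, abs_of_pos hr])
      have k4 : fluxFun H₁ H₂ p₁ p₂ A (-(-p₁ - 2 * r)) (-(-p₂ + 2 * r)) ≤ A + δ := by
        rw [show -(-p₁ - 2 * r) = p₁ + 2 * r by ring, show -(-p₂ + 2 * r) = p₂ + 2 * -r by ring,
          fluxFun, incPart_eq, decPart_eq,
          max_eq_left (show p₁ ≤ p₁ + 2 * r by linarith),
          min_eq_left (show p₂ + 2 * -r ≤ p₂ by linarith)]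
        exact max_le (by linarith) (max_le k2.le k3.le)
      linarith
    · have hj : UJet V t x (deriv a t + (A + δ)) (-(p₂ + 2 * -x)) := by
        refine ⟨fun t => a t + (A + δ) * t, fun x => -(p₂ * x) + x ^ 2, by fun_prop, by fun_prop,
          hl.deriv, (hsq p₂).deriv, ?_⟩
        filter_upwards [hmax, continuousAt_snd.eventually (lt_mem_nhds hx0)] with z hz hz'
        rw [kink_of_nonneg hx0.le, kink_of_nonneg (le_of_lt hz')] at hz
        linarith
      have k1 := hJ.2.1 hx0 _ _ hj
      simp only [neg_neg] at k1
      linarith [hH₂ _ hxr]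

/-- The datum for non-uniqueness: at the slopes `p₁`, `p₂` both Hamiltonians are minimal, so for any
limiter `A ≥ A₀` the flux at the vertex is `A` itself. -/
lemma exists_isBUC_eq_kink (p₁ p₂ : ℝ) :
    ∃ u₀ : ℝ → ℝ, IsBUC u₀ ∧ ∀ x, |x| ≤ 1 → u₀ x = kink p₁ p₂ x := by
  have h11 : (-1 : ℝ) ≤ 1 := by norm_num
  have hkc := continuous_kink p₁ p₂
  refine ⟨fun x => kink p₁ p₂ (projIcc (-1) 1 h11 x), ⟨?_, ?_⟩, fun x hx => ?_⟩
  · obtain ⟨C, hC⟩ := (isCompact_Icc (a := (-1 : ℝ)) (b := 1)).exists_bound_of_continuousOn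
      hkc.continuousOn
    exact ⟨C, fun x => by simpa using hC _ (projIcc (-1) 1 h11 x).2⟩
  · have h1 : UniformContinuous fun y : Icc (-1 : ℝ) 1 => kink p₁ p₂ y :=
      CompactSpace.uniformContinuous_of_continuous (by fun_prop)
    exact h1.comp (LipschitzWith.projIcc h11).uniformContinuous
  · simp only
    rw [projIcc_of_mem h11 (abs_le.1 hx)]

end junction

/-! ### Ishii solutions of the Cauchy problem -/

section cauchy

variable {H₁ H₂ : ℝ → ℝ} {p₁ p₂ A A' : ℝ} {u₀ : ℝ → ℝ} {u v : ℝ → ℝ → ℝ}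

lemma IsFluxCauchySol.isIshiiCauchySol (h₁ : IsQuasiConvexHamiltonian H₁ p₁)
    (h₂ : IsQuasiConvexHamiltonian H₂ p₂) (hA : ishiiMinus H₁ H₂ p₁ p₂ ≤ A)
    (hA' : A ≤ ishiiPlus H₁ H₂ p₁ p₂) (hu : IsFluxCauchySol H₁ H₂ p₁ p₂ A u₀ u) :
    IsIshiiCauchySol H₁ H₂ u₀ u :=
  ⟨⟨hu.1.1.isIshiiSub h₁.isQuasiConvex h₂.isQuasiConvex hA,
    hu.1.2.isIshiiSuper h₁.isQuasiConvex h₂.isQuasiConvex hA'⟩, hu.2⟩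

lemma IsFluxCauchySol.eq (h₁ : IsQuasiConvexHamiltonian H₁ p₁)
    (h₂ : IsQuasiConvexHamiltonian H₂ p₂) (hu₀ : IsBUC u₀)
    (hu : IsFluxCauchySol H₁ H₂ p₁ p₂ A u₀ u) (hv : IsFluxCauchySol H₁ H₂ p₁ p₂ A u₀ v) {t : ℝ}
    (ht : 0 ≤ t) (x : ℝ) : u t x = v t x :=
  le_antisymm
    (hu.1.1.le_of_isFluxSuper h₁ h₂ hu₀ hv.1.2 hu.2.2 hv.2.2 (fun x => (hu.2.1 x).1)
      (fun x => (hv.2.1 x).2) ht x)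
    (hv.1.1.le_of_isFluxSuper h₁ h₂ hu₀ hu.1.2 hv.2.2 hu.2.2 (fun x => (hv.2.1 x).1)
      (fun x => (hu.2.1 x).2) ht x)

lemma IsFluxCauchySol.le_ishii (h₁ : IsQuasiConvexHamiltonian H₁ p₁)
    (h₂ : IsQuasiConvexHamiltonian H₂ p₂) (hu₀ : IsBUC u₀)
    (hu : IsFluxCauchySol H₁ H₂ p₁ p₂ (ishiiPlus H₁ H₂ p₁ p₂) u₀ u)
    (hv : IsIshiiCauchySol H₁ H₂ u₀ v) {t : ℝ} (ht : 0 ≤ t) (x : ℝ) : u t x ≤ v t x :=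
  hu.1.1.le_of_isFluxSuper h₁ h₂ hu₀ (hv.1.2.isFluxSuper h₁ h₂) hu.2.2 hv.2.2
    (fun x => (hu.2.1 x).1) (fun x => (hv.2.1 x).2) ht x

lemma IsFluxCauchySol.ishii_le (h₁ : IsQuasiConvexHamiltonian H₁ p₁)
    (h₂ : IsQuasiConvexHamiltonian H₂ p₂) (hu₀ : IsBUC u₀)
    (hu : IsFluxCauchySol H₁ H₂ p₁ p₂ (ishiiMinus H₁ H₂ p₁ p₂) u₀ u)
    (hv : IsIshiiCauchySol H₁ H₂ u₀ v) {t : ℝ} (ht : 0 ≤ t) (x : ℝ) : v t x ≤ u t x :=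
  (hv.1.1.isFluxSub h₁ h₂).le_of_isFluxSuper h₁ h₂ hu₀ hu.1.2 hv.2.2 hu.2.2
    (fun x => (hv.2.1 x).1) (fun x => (hu.2.1 x).2) ht x

/-- If the Ishii flux limiters differ, then so do the two extremal Ishii solutions, for some
datum. -/
lemma exists_ishiiCauchySol_ne (h₁ : IsQuasiConvexHamiltonian H₁ p₁)
    (h₂ : IsQuasiConvexHamiltonian H₂ p₂)
    (hne : ishiiPlus H₁ H₂ p₁ p₂ ≠ ishiiMinus H₁ H₂ p₁ p₂) :
    ∃ u₀ : ℝ → ℝ, IsBUC u₀ ∧ ∃ u v : ℝ → ℝ → ℝ, IsIshiiCauchySol H₁ H₂ u₀ u ∧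
      IsIshiiCauchySol H₁ H₂ u₀ v ∧ ∃ t, 0 ≤ t ∧ u t 0 < v t 0 := by
  have hle := ishiiMinus_le_ishiiPlus (H₁ := H₁) (H₂ := H₂) (p₁ := p₁) (p₂ := p₂)
  have hlt := lt_of_le_of_ne hle hne.symm
  -- Distinct limiters force `p₁ ≤ p₂`; then `A_I^-` is `A₀`, which dominates both minima.
  have hmin : ishiiMinus H₁ H₂ p₁ p₂ = fluxA0 H₁ H₂ p₁ p₂ := by
    unfold ishiiMinus at hne ⊢
    split_ifs with h
    · rw [if_pos h] at hne
      exact absurd rfl hne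
    · rfl
  obtain ⟨u₀, hu₀, hkink⟩ := exists_isBUC_eq_kink p₁ p₂
  obtain ⟨u, hu, -⟩ := exists_isFluxCauchySol h₁ h₂ (ishiiPlus H₁ H₂ p₁ p₂) hu₀
  obtain ⟨v, hv, hvlow⟩ := exists_isFluxCauchySol h₁ h₂ (ishiiMinus H₁ H₂ p₁ p₂) hu₀
  refine ⟨u₀, hu₀, u, v, hu.isIshiiCauchySol h₁ h₂ hle le_rfl, hv.isIshiiCauchySol h₁ h₂ le_rfl hle,
    ?_⟩
  -- With `δ` inside the gap, `u t 0 ≤ -A_I^+ t < -(A_I^- + δ) t ≤ v t 0` at small positive times.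
  obtain ⟨δ, hδ, hδ'⟩ := exists_between (sub_pos.2 hlt)
  obtain ⟨τ, hτ, hτ'⟩ := hv.1.2.exists_neg_mul_le h₁ h₂ hvlow hu₀.2.continuous hkink
    (by rw [hmin]; exact le_max_left _ _) (by rw [hmin]; exact le_max_right _ _) hδ
  obtain ⟨t, ht, ht'⟩ := exists_between (lt_min one_pos hτ)
  rw [lt_min_iff] at ht'
  refine ⟨t, ht.le, ?_⟩
  have k1 := hu.1.1.le_neg_mul h₁ h₂ hu.2.2 (fun x => (hu.2.1 x).1) (K := |p₁| + |p₂|)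
    (fun x hx => by
      rw [hkink x hx]
      refine (le_abs_self _).trans ?_
      rcases le_total x 0 with h | h
      · rw [kink_of_nonpos h, abs_mul]; gcongr; linarith [abs_nonneg p₂]
      · rw [kink_of_nonneg h, abs_mul]; gcongr; linarith [abs_nonneg p₁]) ht.le ht'.1
  have k2 := hτ' t ht.le ht'.2
  have k3 : (ishiiMinus H₁ H₂ p₁ p₂ + δ) * t < ishiiPlus H₁ H₂ p₁ p₂ * t := by
    gcongr; linarith
  linarith

end cauchy

end HJ

theorem theorem6p1 (H₁ H₂ : ℝ → ℝ) (p₁ p₂ : ℝ)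
    (h₁ : HJ.IsQuasiConvexHamiltonian H₁ p₁) (h₂ : HJ.IsQuasiConvexHamiltonian H₂ p₂) :
    HJ.ishiiMinus H₁ H₂ p₁ p₂ ≤ HJ.ishiiPlus H₁ H₂ p₁ p₂ ∧
    -- Ishii sub-solutions
    (∀ u : ℝ → ℝ → ℝ, HJ.IsIshiiSub H₁ H₂ u →
      HJ.IsFluxSub H₁ H₂ p₁ p₂ (HJ.ishiiMinus H₁ H₂ p₁ p₂) u) ∧
    -- Ishii super-solutions
    (∀ u : ℝ → ℝ → ℝ, HJ.IsIshiiSuper H₁ H₂ u →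
      HJ.IsFluxSuper H₁ H₂ p₁ p₂ (HJ.ishiiPlus H₁ H₂ p₁ p₂) u) ∧
    -- particular Ishii solutions
    (∀ A : ℝ, HJ.ishiiMinus H₁ H₂ p₁ p₂ ≤ A → A ≤ HJ.ishiiPlus H₁ H₂ p₁ p₂ →
      ∀ u : ℝ → ℝ → ℝ, HJ.IsFluxSol H₁ H₂ p₁ p₂ A u → HJ.IsIshiiSol H₁ H₂ u) ∧
    -- minimal and maximal Ishii solutions
    (∀ u₀ : ℝ → ℝ, HJ.IsBUC u₀ →
      (∃ U : ℝ → ℝ → ℝ,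
        HJ.IsFluxCauchySol H₁ H₂ p₁ p₂ (HJ.ishiiPlus H₁ H₂ p₁ p₂) u₀ U ∧
        (∀ V : ℝ → ℝ → ℝ,
          HJ.IsFluxCauchySol H₁ H₂ p₁ p₂ (HJ.ishiiPlus H₁ H₂ p₁ p₂) u₀ V →
          ∀ t x : ℝ, 0 ≤ t → V t x = U t x) ∧
        HJ.IsIshiiCauchySol H₁ H₂ u₀ U ∧
        (∀ v : ℝ → ℝ → ℝ, HJ.IsIshiiCauchySol H₁ H₂ u₀ v →
          ∀ t x : ℝ, 0 ≤ t → U t x ≤ v t x)) ∧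
      (∃ U : ℝ → ℝ → ℝ,
        HJ.IsFluxCauchySol H₁ H₂ p₁ p₂ (HJ.ishiiMinus H₁ H₂ p₁ p₂) u₀ U ∧
        (∀ V : ℝ → ℝ → ℝ,
          HJ.IsFluxCauchySol H₁ H₂ p₁ p₂ (HJ.ishiiMinus H₁ H₂ p₁ p₂) u₀ V →
          ∀ t x : ℝ, 0 ≤ t → V t x = U t x) ∧
        HJ.IsIshiiCauchySol H₁ H₂ u₀ U ∧
        (∀ v : ℝ → ℝ → ℝ, HJ.IsIshiiCauchySol H₁ H₂ u₀ v →
          ∀ t x : ℝ, 0 ≤ t → v t x ≤ U t x))) ∧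
    -- uniqueness of the Ishii solution
    ((∀ u₀ : ℝ → ℝ, HJ.IsBUC u₀ → ∀ u v : ℝ → ℝ → ℝ,
        HJ.IsIshiiCauchySol H₁ H₂ u₀ u → HJ.IsIshiiCauchySol H₁ H₂ u₀ v →
        ∀ t x : ℝ, 0 ≤ t → u t x = v t x) ↔
      HJ.ishiiPlus H₁ H₂ p₁ p₂ = HJ.ishiiMinus H₁ H₂ p₁ p₂) := by
  have hle := HJ.ishiiMinus_le_ishiiPlus (H₁ := H₁) (H₂ := H₂) (p₁ := p₁) (p₂ := p₂)
  refine ⟨hle, fun u hu => hu.isFluxSub h₁ h₂, fun u hu => hu.isFluxSuper h₁ h₂,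
    fun A hA hA' u hu => ⟨hu.1.isIshiiSub h₁.isQuasiConvex h₂.isQuasiConvex hA,
      hu.2.isIshiiSuper h₁.isQuasiConvex h₂.isQuasiConvex hA'⟩, fun u₀ hu₀ => ⟨?_, ?_⟩, ?_, ?_⟩
  · obtain ⟨U, hU, -⟩ := HJ.exists_isFluxCauchySol h₁ h₂ (HJ.ishiiPlus H₁ H₂ p₁ p₂) hu₀
    exact ⟨U, hU, fun V hV t x ht => hV.eq h₁ h₂ hu₀ hU ht x,
      hU.isIshiiCauchySol h₁ h₂ hle le_rfl, fun v hv t x ht => hU.le_ishii h₁ h₂ hu₀ hv ht x⟩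
  · obtain ⟨U, hU, -⟩ := HJ.exists_isFluxCauchySol h₁ h₂ (HJ.ishiiMinus H₁ H₂ p₁ p₂) hu₀
    exact ⟨U, hU, fun V hV t x ht => hV.eq h₁ h₂ hu₀ hU ht x,
      hU.isIshiiCauchySol h₁ h₂ le_rfl hle, fun v hv t x ht => hU.ishii_le h₁ h₂ hu₀ hv ht x⟩
  · intro huniq
    by_contra hne
    obtain ⟨u₀, hu₀, u, v, hu, hv, t, ht, hlt⟩ := HJ.exists_ishiiCauchySol_ne h₁ h₂ hne
    exact hlt.ne (huniq u₀ hu₀ u v hu hv t 0 ht)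
  · intro heq u₀ hu₀ u v hu hv t x ht
    obtain ⟨U, hU, -⟩ := HJ.exists_isFluxCauchySol h₁ h₂ (HJ.ishiiPlus H₁ H₂ p₁ p₂) hu₀
    -- When the limiters agree, the same `U` is both the minimal and the maximal Ishii solution.
    have hU' := hU
    rw [heq] at hU'
    have key : ∀ w, HJ.IsIshiiCauchySol H₁ H₂ u₀ w → w t x = U t x := fun w hw =>
      le_antisymm (hU'.ishii_le h₁ h₂ hu₀ hw ht x) (hU.le_ishii h₁ h₂ hu₀ hw ht x)
    rw [key u hu, key v hv]
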